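/- Let $(M,g)$ be a nonempty smooth ($C^\infty$) Riemannian manifold of dimension $n\ge 2$, $\pi:T^*M\to M$ its cotangent bundle, and for $p\in T^*M$ put $t=\frac12 g^{-1}_{\pi(p)}(p,p)$. For a tangent vector $X$ and a covector $\theta$ at $\pi(p)$ let $X^H_p$ be the horizontal lift (with respect to the Levi-Civita connection) and $\theta^V_p$ the vertical lift to $T_p(T^*M)$, $g_X=g(X,\cdot)$, and $\theta^\sharp$ the vector with $g_{\theta^\sharp}=\theta$. Let $a_1,\dots,a_4,b_1,\dots,b_4,c_1,c_2,c_3,d_1,d_2,d_3:[0,\infty)\to\mathbb R$ be smooth functions with $a_1,\ a_2,\ a_1+2tb_1,\ a_2+2tb_2>0$ for all $t\ge 0$, and define the tensor field $J$ of type $(1,1)$ and the symmetric tensor field $G$ of type $(0,2)$ on $T^*M$ by $$JX^H_p=a_1(t)(g_X)^V_p+b_1(t)p(X)p^V_p+a_4(t)X^H_p+b_4(t)p(X)(p^\sharp)^H_p,$$ $$J\theta^V_p=a_3(t)\theta^V_p+b_3(t)g^{-1}(p,\theta)p^V_p-a_2(t)(\theta^\sharp)^H_p-b_2(t)g^{-1}(p,\theta)(p^\sharp)^H_p,$$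 $$G_p(X^H,Y^H)=c_1(t)g(X,Y)+d_1(t)p(X)p(Y),\qquad G_p(\theta^V,\eta^V)=c_2(t)g^{-1}(\theta,\eta)+d_2(t)g^{-1}(p,\theta)g^{-1}(p,\eta),$$ $$G_p(X^H,\theta^V)=G_p(\theta^V,X^H)=c_3(t)\theta(X)+d_3(t)p(X)g^{-1}(p,\theta).$$ Suppose that $(G,J)$ is almost Hermitian: $J^2=-\mathrm{id}$, $G$ is positive definite and $G(J\cdot,J\cdot)=G$. Then: (1) There are smooth functions $\lambda,\mu:[0,\infty)\to\mathbb R$ with $\lambda>0$, $\lambda+2t\mu>0$ and, for $i=1,2,3$ and all $t\ge0$, $$c_i=\lambda a_i,\qquad c_i+2td_i=(\lambda+2t\mu)(a_i+2tb_i).$$ (2) For all such $\lambda,\mu$: the structure $(G,J)$ is Kähler (that is, the Nijenhuis tensor $N_J$ vanishes and the $2$-form $\Omega(X,Y)=G(X,JY)$ is closed) if and only if $J$ is integrable (that is, $N_J=0$) and $\mu=\lambda'$ on $[0,\infty)$. (3) If $n>2$ and $M$ is connected, then $J$ is integrable if and only if there is a real number $c$ such that $(M,g)$ has constant sectional curvature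 $c$ and, for all $t\ge 0$, the number $D=a_1-2ta_1'-2cta_2-4ct^2a_2'$ is not zero and $$b_1=\frac{2c^2ta_2^2+2cta_1a_2'+a_1a_1'-c+3ca_3^2}{D},\qquad b_2=\frac{2ta_3'^2-2ta_1'a_2'+ca_2^2+2cta_2a_2'+a_1a_2'}{D},$$ $$b_3=\frac{a_1a_3'+2ca_2a_3+4cta_2'a_3-2cta_2a_3'}{D}.$$ -/

import Mathlib

open scoped Manifold ContDiff


noncomputable section AlmostHermitianGeometry

/-! ### Almost Hermitian and Kähler structures on a manifold `N` -/

variable {F : Type*} [NormedAddCommGroup F] [NormedSpace ℝ F]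
  {H : Type*} [TopologicalSpace H] (I : ModelWithCorners ℝ F H)
  {N : Type*} [TopologicalSpace N] [ChartedSpace H N]

/-- Almost Hermitian structure `(G, J)`: `J` is an almost complex structure, `G` is symmetric and
positive definite, and `G (J X, J Y) = G (X, Y)`. -/
structure IsAlmostHermitian
    (G : (p : N) → TangentSpace I p →ₗ[ℝ] TangentSpace I p →ₗ[ℝ] ℝ)
    (J : (p : N) → TangentSpace I p →ₗ[ℝ] TangentSpace I p) : Prop where
  sq_eq_neg : ∀ (p : N) (ξ : TangentSpace I p), J p (J p ξ) = -ξ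
  symm : ∀ (p : N) (ξ η : TangentSpace I p), G p ξ η = G p η ξ
  pos : ∀ (p : N) (ξ : TangentSpace I p), ξ ≠ 0 → 0 < G p ξ ξ
  hermitian : ∀ (p : N) (ξ η : TangentSpace I p), G p (J p ξ) (J p η) = G p ξ η

/-- The Nijenhuis bracket `N_J(X, Y) = [JX, JY] - J[JX, Y] - J[X, JY] - [X, Y]` at `p`. -/
def nijenhuis (J : (p : N) → TangentSpace I p →ₗ[ℝ] TangentSpace I p)
    (X Y : (p : N) → TangentSpace I p) (p : N) : TangentSpace I p :=
  VectorField.mlieBracket I (fun q => J q (X q)) (fun q => J q (Y q)) p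
    - J p (VectorField.mlieBracket I (fun q => J q (X q)) Y p)
    - J p (VectorField.mlieBracket I X (fun q => J q (Y q)) p)
    - VectorField.mlieBracket I X Y p

/-- The 2-form `Ω(X, Y) = G(X, JY)`. -/
def fundamentalForm (G : (p : N) → TangentSpace I p →ₗ[ℝ] TangentSpace I p →ₗ[ℝ] ℝ)
    (J : (p : N) → TangentSpace I p →ₗ[ℝ] TangentSpace I p)
    (p : N) (ξ η : TangentSpace I p) : ℝ := G p ξ (J p η)

/-- The derivative `ξ(f)` of a function along a tangent vector at `p`. -/
def directionalDeriv (f : N → ℝ) (p : N) (ξ : TangentSpace I p) : ℝ :=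
  mfderiv I 𝓘(ℝ, ℝ) f p ξ

/-- The exterior derivative of a 2-form `Φ`, evaluated on vector fields:
`dΦ(X,Y,Z) = X Φ(Y,Z) - Y Φ(X,Z) + Z Φ(X,Y) - Φ([X,Y],Z) + Φ([X,Z],Y) - Φ([Y,Z],X)`. -/
def exteriorDerivTwoForm (Φ : (p : N) → TangentSpace I p → TangentSpace I p → ℝ)
    (X Y Z : (p : N) → TangentSpace I p) (p : N) : ℝ :=
  directionalDeriv I (fun q => Φ q (Y q) (Z q)) p (X p)
    - directionalDeriv I (fun q => Φ q (X q) (Z q)) p (Y p)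
    + directionalDeriv I (fun q => Φ q (X q) (Y q)) p (Z p)
    - Φ p (VectorField.mlieBracket I X Y p) (Z p)
    + Φ p (VectorField.mlieBracket I X Z p) (Y p)
    - Φ p (VectorField.mlieBracket I Y Z p) (X p)

variable [IsManifold I 1 N]

/-- `X` is a smooth vector field on the set `U`. -/
def SmoothVectorFieldOn (X : (p : N) → TangentSpace I p) (U : Set N) : Prop :=
  ContMDiffOn I I.tangent ∞ (fun p => (⟨p, X p⟩ : TangentBundle I N)) U

/-- Integrability of an almost complex structure: its Nijenhuis tensor vanishes. -/
def IsIntegrableStructure (J : (p : N) → TangentSpace I p →ₗ[ℝ] TangentSpace I p) : Prop :=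
  ∀ (U : Set N), IsOpen U → ∀ X Y : (p : N) → TangentSpace I p,
    SmoothVectorFieldOn I X U → SmoothVectorFieldOn I Y U → ∀ p ∈ U, nijenhuis I J X Y p = 0

/-- `dΦ = 0`. -/
def IsClosedTwoForm (Φ : (p : N) → TangentSpace I p → TangentSpace I p → ℝ) : Prop :=
  ∀ (U : Set N), IsOpen U → ∀ X Y Z : (p : N) → TangentSpace I p,
    SmoothVectorFieldOn I X U → SmoothVectorFieldOn I Y U → SmoothVectorFieldOn I Z U →
    ∀ p ∈ U, exteriorDerivTwoForm I Φ X Y Z p = 0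

/-- A Kähler structure: almost Hermitian, with integrable `J` and closed `Ω`. -/
structure IsKahlerStructure
    (G : (p : N) → TangentSpace I p →ₗ[ℝ] TangentSpace I p →ₗ[ℝ] ℝ)
    (J : (p : N) → TangentSpace I p →ₗ[ℝ] TangentSpace I p) : Prop where
  almostHermitian : IsAlmostHermitian I G J
  integrable : IsIntegrableStructure I J
  closed : IsClosedTwoForm I (fundamentalForm I G J)

end AlmostHermitianGeometry

noncomputable section RiemannianGeometry

/-! ### Levi-Civita connection and curvature of `(M, g)` in charts -/

/-- Smooth Riemannian metrics on `M`. -/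
abbrev SmoothMetric (E : Type*) [NormedAddCommGroup E] [NormedSpace ℝ E]
    (M : Type*) [TopologicalSpace M] [ChartedSpace E M] [IsManifold 𝓘(ℝ, E) ∞ M] : Type _ :=
  Bundle.ContMDiffRiemannianMetric 𝓘(ℝ, E) ∞ E (fun x : M => TangentSpace 𝓘(ℝ, E) x)

variable {E : Type*} [NormedAddCommGroup E] [NormedSpace ℝ E]
  {M : Type*} [TopologicalSpace M] [ChartedSpace E M] [IsManifold 𝓘(ℝ, E) ∞ M]

/-- The components of `g` in the chart `φ` around `x₀`: the pull-back of `g` by `φ⁻¹` at the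
point `y` of the target of `φ`. -/
def metricInChart (g : SmoothMetric E M) (x₀ : M) (y : E) : E →L[ℝ] E →L[ℝ] ℝ :=
  let φ := extChartAt 𝓘(ℝ, E) x₀
  let L : E →L[ℝ] E := mfderiv 𝓘(ℝ, E) 𝓘(ℝ, E) φ.symm y
  let b : E →L[ℝ] E →L[ℝ] ℝ := g.inner (φ.symm y)
  b.bilinearComp L L

/-- The Christoffel symbols of `g` in the chart around `x₀`, at the point `y` of its target:
`christoffel g x₀ y u v` is the vector `Γ(u, v)` with
`g(Γ(u, v), w) = (∂ᵤ g(v, w) + ∂ᵥ g(u, w) - ∂_w g(u, v)) / 2`. -/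
def christoffel (g : SmoothMetric E M) (x₀ : M) (y : E) (u : E) : E →L[ℝ] E :=
  let Dg : E →L[ℝ] E →L[ℝ] E →L[ℝ] ℝ := fderiv ℝ (metricInChart g x₀) y
  (metricInChart g x₀ y).inverse.comp
    ((1 / 2 : ℝ) • (Dg u + Dg.flip u - (Dg.flip u).flip))

lemma christoffel_add (g : SmoothMetric E M) (x₀ : M) (y u v : E) :
    christoffel g x₀ y (u + v) = christoffel g x₀ y u + christoffel g x₀ y v := by
  simp only [christoffel, ← ContinuousLinearMap.comp_add, map_add, ContinuousLinearMap.flip_add]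
  congr 1
  module

lemma christoffel_smul (g : SmoothMetric E M) (x₀ : M) (y : E) (r : ℝ) (u : E) :
    christoffel g x₀ y (r • u) = r • christoffel g x₀ y u := by
  simp only [christoffel, ← ContinuousLinearMap.comp_smul, map_smul,
    ContinuousLinearMap.flip_smul]
  congr 1
  module

/-- The curvature tensor `R(u, v)w = ∇ᵤ∇ᵥw - ∇ᵥ∇ᵤw - ∇_[u,v]w` at `x`, computed in the preferred
chart around `x` (in which Mathlib identifies the tangent space at `x` with `E`). -/
def curvatureTensor (g : SmoothMetric E M) (x : M) (u v w : TangentSpace 𝓘(ℝ, E) x) :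
    TangentSpace 𝓘(ℝ, E) x :=
  let y : E := extChartAt 𝓘(ℝ, E) x x
  let Γ : E → E → E → E := fun z a b => christoffel g x z a b
  let u : E := u
  let v : E := v
  let w : E := w
  (fderiv ℝ (fun z => Γ z v w) y u - fderiv ℝ (fun z => Γ z u w) y v
    + Γ y u (Γ y v w) - Γ y v (Γ y u w) : E)

/-- The sectional curvature of the plane spanned by `u, v`. -/
def sectionalCurvature (g : SmoothMetric E M) (x : M) (u v : TangentSpace 𝓘(ℝ, E) x) : ℝ :=
  g.inner x (curvatureTensor g x u v v) u /
    (g.inner x u u * g.inner x v v - g.inner x u v ^ 2)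

/-- `(M, g)` has constant sectional curvature `c`. -/
def HasConstantSectionalCurvature (g : SmoothMetric E M) (c : ℝ) : Prop :=
  ∀ (x : M) (u v : TangentSpace 𝓘(ℝ, E) x), LinearIndependent ℝ ![u, v] →
    sectionalCurvature g x u v = c

/-- `θ ↦ θ♯`, the inverse of `X ↦ g(X, ·)`. -/
def sharp (g : SmoothMetric E M) (x : M) :
    (TangentSpace 𝓘(ℝ, E) x →L[ℝ] ℝ) →L[ℝ] TangentSpace 𝓘(ℝ, E) x :=
  (g.inner x).inverse

/-- The metric `g⁻¹` on covectors. -/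
def cometric (g : SmoothMetric E M) (x : M) (θ η : TangentSpace 𝓘(ℝ, E) x →L[ℝ] ℝ) : ℝ :=
  θ (sharp g x η)

end RiemannianGeometry

noncomputable section CotangentGeometry

/-! ### Lifts to the cotangent bundle -/

/-- The cotangent bundle `T*M`, a smooth manifold modelled on `E × E*`. -/
abbrev CotangentBundle (E : Type*) [NormedAddCommGroup E] [NormedSpace ℝ E]
    (M : Type*) [TopologicalSpace M] [ChartedSpace E M] [IsManifold 𝓘(ℝ, E) ∞ M] : Type _ :=
  Bundle.TotalSpace (E →L[ℝ] ℝ) (fun x : M => TangentSpace 𝓘(ℝ, E) x →L[ℝ] ℝ)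

/-- The model with corners of `T*M`. -/
abbrev cotangentModel (E : Type*) [NormedAddCommGroup E] [NormedSpace ℝ E] :
    ModelWithCorners ℝ (E × (E →L[ℝ] ℝ)) (ModelProd E (E →L[ℝ] ℝ)) :=
  𝓘(ℝ, E).prod 𝓘(ℝ, E →L[ℝ] ℝ)

variable {E : Type*} [NormedAddCommGroup E] [NormedSpace ℝ E]
  {M : Type*} [TopologicalSpace M] [ChartedSpace E M] [IsManifold 𝓘(ℝ, E) ∞ M]

/-- The energy density `t = g⁻¹(p, p) / 2`. -/
def energyDensity (g : SmoothMetric E M) (p : CotangentBundle E M) : ℝ :=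
  (1 / 2) * cometric g p.proj p.snd p.snd

/-- `Γ⁰(X) = p(Γ(X, ·))`, i.e. `Xⁱ Γ⁰ᵢₕ dxʰ`, with the Christoffel symbols at `π(p)` in the preferred chart there. -/
def christoffelZero (g : SmoothMetric E M) (p : CotangentBundle E M) (X : E) : E →L[ℝ] ℝ :=
  let p' : E →L[ℝ] ℝ := p.snd
  p'.comp (christoffel g p.proj (extChartAt 𝓘(ℝ, E) p.proj p.proj) X)

lemma christoffelZero_add (g : SmoothMetric E M) (p : CotangentBundle E M) (X Y : E) :
    christoffelZero g p (X + Y) = christoffelZero g p X + christoffelZero g p Y := by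
  simp only [christoffelZero, christoffel_add]
  exact ContinuousLinearMap.comp_add _ _ _

lemma christoffelZero_smul (g : SmoothMetric E M) (p : CotangentBundle E M) (r : ℝ) (X : E) :
    christoffelZero g p (r • X) = r • christoffelZero g p X := by
  simp only [christoffelZero, christoffel_smul]
  exact ContinuousLinearMap.comp_smul _ _ _

/-- Mathlib's chart of `T*M` around `p` is the induced chart `(qⁱ, pᵢ)`: its components at a covector
`q` are the coordinates of the base point of `q` and the restriction of `q` to the coordinate
frame `∂/∂xⁱ`. -/
lemma extChartAt_cotangentBundle (p q : CotangentBundle E M)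
    (hq : q.proj ∈ (chartAt E p.proj).source) :
    extChartAt (cotangentModel E) p q = (extChartAt 𝓘(ℝ, E) p.proj q.proj,
      (show E →L[ℝ] ℝ from q.snd).comp
        (mfderiv 𝓘(ℝ, E) 𝓘(ℝ, E) (extChartAt 𝓘(ℝ, E) p.proj).symm
          (extChartAt 𝓘(ℝ, E) p.proj q.proj) : E →L[ℝ] E)) := by
  rw [FiberBundle.extChartAt]
  have h := TangentBundle.symmL_trivializationAt (I := 𝓘(ℝ, E)) (x₀ := p.proj) (x := q.proj) hq
  simp only [modelWithCornersSelf_coe, Set.range_id, mfderivWithin_univ] at h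
  refine Prod.ext ?_ ?_
  · simp [hom_trivializationAt_apply]
  · rw [← h]
    simp [hom_trivializationAt_apply, ContinuousLinearMap.inCoordinates]
    ext
    simp
    rfl

/-- `T_p(T*M)`. Mathlib identifies it with `E × E*` by means of the chart of `T*M` induced from the
preferred chart of `M` around `π(p)`: the vector `q̇ⁱ ∂/∂qⁱ + ṗᵢ ∂/∂pᵢ` is the pair `(q̇, ṗ)`. -/
abbrev CotangentTangent (p : CotangentBundle E M) : Type _ := TangentSpace (cotangentModel E) p

/-- The tangent vector with components `(q̇, ṗ)` in the induced chart. -/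
def ofComponents (p : CotangentBundle E M) :
    (TangentSpace 𝓘(ℝ, E) p.proj × (TangentSpace 𝓘(ℝ, E) p.proj →L[ℝ] ℝ)) →ₗ[ℝ]
      CotangentTangent p :=
  (LinearMap.id : (E × (E →L[ℝ] ℝ)) →ₗ[ℝ] (E × (E →L[ℝ] ℝ)))

/-- The projection `π_* ξ`, i.e. the components `q̇`. -/
def basePart (p : CotangentBundle E M) : CotangentTangent p →ₗ[ℝ] TangentSpace 𝓘(ℝ, E) p.proj :=
  LinearMap.fst ℝ E (E →L[ℝ] ℝ)

/-- The components `ṗ`. -/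
def fibrePart (p : CotangentBundle E M) :
    CotangentTangent p →ₗ[ℝ] (TangentSpace 𝓘(ℝ, E) p.proj →L[ℝ] ℝ) :=
  LinearMap.snd ℝ E (E →L[ℝ] ℝ)

/-- `Γ⁰` as a linear map from vectors to covectors at `π(p)`. -/
def christoffelZeroMap (g : SmoothMetric E M) (p : CotangentBundle E M) :
    TangentSpace 𝓘(ℝ, E) p.proj →ₗ[ℝ] (TangentSpace 𝓘(ℝ, E) p.proj →L[ℝ] ℝ) :=
  ({ toFun := christoffelZero g p
     map_add' := christoffelZero_add g p
     map_smul' := christoffelZero_smul g p } : E →ₗ[ℝ] (E →L[ℝ] ℝ))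

/-- The vertical lift `θ^V = θᵢ ∂/∂pᵢ`. -/
def verticalLift (p : CotangentBundle E M) :
    (TangentSpace 𝓘(ℝ, E) p.proj →L[ℝ] ℝ) →ₗ[ℝ] CotangentTangent p :=
  ofComponents p ∘ₗ LinearMap.inr ℝ _ _

/-- The horizontal lift `X^H = Xⁱ δ/δqⁱ`, where `δ/δqⁱ = ∂/∂qⁱ + Γ⁰ᵢₕ ∂/∂pₕ`. -/
def horizontalLift (g : SmoothMetric E M) (p : CotangentBundle E M) :
    TangentSpace 𝓘(ℝ, E) p.proj →ₗ[ℝ] CotangentTangent p :=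
  ofComponents p ∘ₗ LinearMap.prod LinearMap.id (christoffelZeroMap g p)

/-- The covector `θ` with `ξ = (π_* ξ)^H + θ^V`. -/
def verticalPart (g : SmoothMetric E M) (p : CotangentBundle E M) :
    CotangentTangent p →ₗ[ℝ] (TangentSpace 𝓘(ℝ, E) p.proj →L[ℝ] ℝ) :=
  fibrePart p - christoffelZeroMap g p ∘ₗ basePart p

lemma horizontalLift_add_verticalLift (g : SmoothMetric E M) (p : CotangentBundle E M)
    (ξ : CotangentTangent p) :
    horizontalLift g p (basePart p ξ) + verticalLift p (verticalPart g p ξ) = ξ := by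
  refine Prod.ext ?_ ?_
  · exact add_zero _
  · exact add_sub_cancel _ _

@[simp] lemma basePart_horizontalLift (g : SmoothMetric E M) (p : CotangentBundle E M)
    (X : TangentSpace 𝓘(ℝ, E) p.proj) : basePart p (horizontalLift g p X) = X := rfl

@[simp] lemma basePart_verticalLift (p : CotangentBundle E M)
    (θ : TangentSpace 𝓘(ℝ, E) p.proj →L[ℝ] ℝ) : basePart p (verticalLift p θ) = 0 := rfl

@[simp] lemma verticalPart_horizontalLift (g : SmoothMetric E M) (p : CotangentBundle E M)
    (X : TangentSpace 𝓘(ℝ, E) p.proj) : verticalPart g p (horizontalLift g p X) = 0 :=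
  sub_self (christoffelZeroMap g p X)

@[simp] lemma verticalPart_verticalLift (g : SmoothMetric E M) (p : CotangentBundle E M)
    (θ : TangentSpace 𝓘(ℝ, E) p.proj →L[ℝ] ℝ) : verticalPart g p (verticalLift p θ) = θ := by
  change θ - christoffelZeroMap g p 0 = θ
  rw [map_zero, sub_zero]

/-! ### Tensor fields of general natural lift type -/

/-- Coefficients of a general natural tensor of type `(1,1)`: smooth functions on `[0, ∞)`
(their values at negative numbers play no role). -/
structure NaturalTensorCoeffs where
  (a₁ a₂ a₃ a₄ b₁ b₂ b₃ b₄ : ℝ → ℝ)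
  smooth_a₁ : ContDiffOn ℝ ∞ a₁ (Set.Ici 0)
  smooth_a₂ : ContDiffOn ℝ ∞ a₂ (Set.Ici 0)
  smooth_a₃ : ContDiffOn ℝ ∞ a₃ (Set.Ici 0)
  smooth_a₄ : ContDiffOn ℝ ∞ a₄ (Set.Ici 0)
  smooth_b₁ : ContDiffOn ℝ ∞ b₁ (Set.Ici 0)
  smooth_b₂ : ContDiffOn ℝ ∞ b₂ (Set.Ici 0)
  smooth_b₃ : ContDiffOn ℝ ∞ b₃ (Set.Ici 0)
  smooth_b₄ : ContDiffOn ℝ ∞ b₄ (Set.Ici 0)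

/-- Coefficients of a metric of general natural lift type: smooth functions on `[0, ∞)`. -/
structure NaturalMetricCoeffs where
  (c₁ c₂ c₃ d₁ d₂ d₃ : ℝ → ℝ)
  smooth_c₁ : ContDiffOn ℝ ∞ c₁ (Set.Ici 0)
  smooth_c₂ : ContDiffOn ℝ ∞ c₂ (Set.Ici 0)
  smooth_c₃ : ContDiffOn ℝ ∞ c₃ (Set.Ici 0)
  smooth_d₁ : ContDiffOn ℝ ∞ d₁ (Set.Ici 0)
  smooth_d₂ : ContDiffOn ℝ ∞ d₂ (Set.Ici 0)
  smooth_d₃ : ContDiffOn ℝ ∞ d₃ (Set.Ici 0)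

/-- `J X^H = a₁ (g_X)^V + b₁ p(X) p^V + a₄ X^H + b₄ p(X) (p♯)^H`. -/
def naturalJHor (g : SmoothMetric E M) (A : NaturalTensorCoeffs) (p : CotangentBundle E M)
    (X : TangentSpace 𝓘(ℝ, E) p.proj) : CotangentTangent p :=
  let t := energyDensity g p
  A.a₁ t • verticalLift p (g.inner p.proj X)
    + (A.b₁ t * p.snd X) • verticalLift p p.snd
    + A.a₄ t • horizontalLift g p X
    + (A.b₄ t * p.snd X) • horizontalLift g p (sharp g p.proj p.snd)

/-- `J θ^V = a₃ θ^V + b₃ g⁻¹(p, θ) p^V - a₂ (θ♯)^H - b₂ g⁻¹(p, θ) (p♯)^H`. -/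
def naturalJVert (g : SmoothMetric E M) (A : NaturalTensorCoeffs) (p : CotangentBundle E M)
    (θ : TangentSpace 𝓘(ℝ, E) p.proj →L[ℝ] ℝ) : CotangentTangent p :=
  let t := energyDensity g p
  A.a₃ t • verticalLift p θ
    + (A.b₃ t * cometric g p.proj p.snd θ) • verticalLift p p.snd
    - A.a₂ t • horizontalLift g p (sharp g p.proj θ)
    - (A.b₂ t * cometric g p.proj p.snd θ) • horizontalLift g p (sharp g p.proj p.snd)

/-- The general natural tensor field `J` of type `(1,1)` on `T*M` with coefficients `A`. -/
def naturalJ (g : SmoothMetric E M) (A : NaturalTensorCoeffs) (p : CotangentBundle E M) :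
    CotangentTangent p →ₗ[ℝ] CotangentTangent p where
  toFun ξ := naturalJHor g A p (basePart p ξ) + naturalJVert g A p (verticalPart g p ξ)
  map_add' ξ η := by
    simp only [naturalJHor, naturalJVert, cometric, map_add, mul_add, add_smul, smul_add]
    abel
  map_smul' r ξ := by
    simp only [naturalJHor, naturalJVert, cometric, map_smul, smul_eq_mul, RingHom.id_apply,
      smul_add, smul_sub, smul_smul, mul_left_comm _ r, mul_comm _ r]

/-- The metric `G` of general natural lift type on `T*M` with coefficients `C`:
`G(X^H, Y^H) = c₁ g(X, Y) + d₁ p(X) p(Y)`,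
`G(θ^V, η^V) = c₂ g⁻¹(θ, η) + d₂ g⁻¹(p, θ) g⁻¹(p, η)`,
`G(X^H, θ^V) = G(θ^V, X^H) = c₃ θ(X) + d₃ p(X) g⁻¹(p, θ)`. -/
def naturalMetric (g : SmoothMetric E M) (C : NaturalMetricCoeffs) (p : CotangentBundle E M) :
    CotangentTangent p →ₗ[ℝ] CotangentTangent p →ₗ[ℝ] ℝ :=
  LinearMap.mk₂ ℝ
    (fun ξ η =>
      let t := energyDensity g p
      let X := basePart p ξ
      let Y := basePart p η
      let θ := verticalPart g p ξ
      let ψ := verticalPart g p η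
      (C.c₁ t * g.inner p.proj X Y + C.d₁ t * (p.snd X * p.snd Y))
        + (C.c₂ t * cometric g p.proj θ ψ
          + C.d₂ t * (cometric g p.proj p.snd θ * cometric g p.proj p.snd ψ))
        + (C.c₃ t * ψ X + C.d₃ t * (p.snd X * cometric g p.proj p.snd ψ))
        + (C.c₃ t * θ Y + C.d₃ t * (p.snd Y * cometric g p.proj p.snd θ)))
    (by intro ξ ξ' η; simp only [cometric, map_add, add_apply]; ring)
    (by intro r ξ η
        simp only [cometric, map_smul, smul_apply, smul_eq_mul]; ring)
    (by intro ξ η η'; simp only [cometric, map_add, add_apply]; ring)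
    (by intro r ξ η
        simp only [cometric, map_smul, smul_apply, smul_eq_mul]; ring)

lemma naturalJ_horizontalLift (g : SmoothMetric E M) (A : NaturalTensorCoeffs)
    (p : CotangentBundle E M) (X : TangentSpace 𝓘(ℝ, E) p.proj) :
    naturalJ g A p (horizontalLift g p X) = naturalJHor g A p X := by
  simp [naturalJ, naturalJVert, cometric]

lemma naturalJ_verticalLift (g : SmoothMetric E M) (A : NaturalTensorCoeffs)
    (p : CotangentBundle E M) (θ : TangentSpace 𝓘(ℝ, E) p.proj →L[ℝ] ℝ) :
    naturalJ g A p (verticalLift p θ) = naturalJVert g A p θ := by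
  simp [naturalJ, naturalJHor]

/-- The sign convention for `J`: `a₁, a₂, a₁ + 2t b₁, a₂ + 2t b₂` are positive for all `t ≥ 0`. -/
def NaturalTensorCoeffs.IsPositive (A : NaturalTensorCoeffs) : Prop :=
  ∀ t : ℝ, 0 ≤ t → 0 < A.a₁ t ∧ 0 < A.a₂ t ∧
    0 < A.a₁ t + 2 * t * A.b₁ t ∧ 0 < A.a₂ t + 2 * t * A.b₂ t

/-- `lam` and `mu` are the proportionality factors of the coefficients `C` of the metric to the
coefficients `A` of the almost complex structure: smooth functions on `[0, ∞)` with
`cᵢ = λ aᵢ`, `cᵢ + 2t dᵢ = (λ + 2t μ)(aᵢ + 2t bᵢ)` for `i = 1, 2, 3`, `λ > 0`, `λ + 2t μ > 0`. -/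
structure AreProportionalityFactors (A : NaturalTensorCoeffs) (C : NaturalMetricCoeffs)
    (lam mu : ℝ → ℝ) : Prop where
  smooth_lam : ContDiffOn ℝ ∞ lam (Set.Ici 0)
  smooth_mu : ContDiffOn ℝ ∞ mu (Set.Ici 0)
  lam_pos : ∀ t : ℝ, 0 ≤ t → 0 < lam t
  lam_add_pos : ∀ t : ℝ, 0 ≤ t → 0 < lam t + 2 * t * mu t
  first : ∀ t : ℝ, 0 ≤ t →
    C.c₁ t = lam t * A.a₁ t ∧ C.c₂ t = lam t * A.a₂ t ∧ C.c₃ t = lam t * A.a₃ t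
  second : ∀ t : ℝ, 0 ≤ t →
    C.c₁ t + 2 * t * C.d₁ t = (lam t + 2 * t * mu t) * (A.a₁ t + 2 * t * A.b₁ t) ∧
    C.c₂ t + 2 * t * C.d₂ t = (lam t + 2 * t * mu t) * (A.a₂ t + 2 * t * A.b₂ t) ∧
    C.c₃ t + 2 * t * C.d₃ t = (lam t + 2 * t * mu t) * (A.a₃ t + 2 * t * A.b₃ t)

/-- The derivative of a function on `[0, ∞)` (one-sided at `0`). -/
def derivIci (f : ℝ → ℝ) (t : ℝ) : ℝ := derivWithin f (Set.Ici 0) t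

/-- The formulas expressing `b₁, b₂, b₃` through `a₁, a₂, a₃`, their derivatives and `c`; the
common denominator does not vanish. -/
def IntegrabilityFormulas (A : NaturalTensorCoeffs) (c : ℝ) : Prop :=
  ∀ t : ℝ, 0 ≤ t →
    let a₁ := A.a₁ t
    let a₂ := A.a₂ t
    let a₃ := A.a₃ t
    let a₁' := derivIci A.a₁ t
    let a₂' := derivIci A.a₂ t
    let a₃' := derivIci A.a₃ t
    let D := a₁ - 2 * t * a₁' - 2 * c * t * a₂ - 4 * c * t ^ 2 * a₂'
    D ≠ 0 ∧
    A.b₁ t = (2 * c ^ 2 * t * a₂ ^ 2 + 2 * c * t * a₁ * a₂' + a₁ * a₁' - c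
      + 3 * c * a₃ ^ 2) / D ∧
    A.b₂ t = (2 * t * a₃' ^ 2 - 2 * t * a₁' * a₂' + c * a₂ ^ 2 + 2 * c * t * a₂ * a₂'
      + a₁ * a₂') / D ∧
    A.b₃ t = (a₁ * a₃' + 2 * c * a₂ * a₃ + 4 * c * t * a₂' * a₃ - 2 * c * t * a₂ * a₃') / D

end CotangentGeometry

/-!
The chart of `T*M` around a covector has coordinates `z = (y, p)` in `E × E*`. A vector `(u, σ)`
there has the vertical part `σ - p Γ(u, ·)`, and this description is the same in every chart
because of the transformation law of the Christoffel symbols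
(`IsLocalMetric.christoffel_transform`, `chartVert_comp`). So in each chart `J` and `G` are given
by explicit formulas in the metric and its Christoffel symbols (`naturalJ_chartDeriv`,
`naturalMetric_chartDeriv`). As the Nijenhuis bracket and the exterior derivative are tensorial,
`N_J = 0` and `dΩ = 0` are conditions on derivatives of these formulas at the centre of each chart
(`isIntegrableStructure_iff`, `isClosedTwoForm_iff`).

*Proportionality factors.* The planes spanned by `v^H`, `(g_v)^V` with `p(v) = 0` and by `(p♯)^H`,
`p^V` are invariant under `J`. On each of them the almost Hermitian condition is a statement about
`2 × 2` matrices, by which the Gram matrix of `G` is a multiple of the one formed from the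
coefficients of `J` (`hermitian_plane`, `HermitianRelations`); the two multiples are `λ` and `λ +
2tμ` (`HermitianRelations.exists_factors`). Dimension at least two provides the vector `v`.

*The Kähler condition.* The fundamental form is `Ω = λ ω + μ dt ∧ τ`, where `τ` is the Liouville
form and `ω = dτ` (`naturalForm_naturalJ`, `localOmega`). Hence `dΩ = (λ' - μ) dt ∧ ω`
(`IsLocalMetric.exteriorDeriv_localOmega`), and `dt ∧ ω` vanishes nowhere off the zero section.

*Integrability.* From `N_J(Jξ, η) = -J N_J(ξ, η)` and the fact that vertical vectors and their
images under `J` span, `N_J` vanishes as soon as it vanishes on pairs of vertical vectors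
(`nijenhuisTensor_eq_zero_of_span`). There it has a horizontal part and a vertical part with scalar
coefficients `horObstruction` and `vertObstruction`, and a curvature term
(`IsLocalMetric.nijenhuisTensor_localJ_vertical`). Evaluated at the multiple of `g_u` of energy
density `t`, its vanishing gives for each plane through `u` that `a₂ (a₂ + 2t b₂) K =
-vertObstruction` at `t` (`sectional_of_verticalNijenhuisVanishes`). Since `u` and `t > 0` are
independent, the sectional curvature `K` is one constant `c` on all of `M`. What remains are two
equations at each `t`, linear in `b₂` and `b₃`. Cramer's rule, simplified by the derivative of
`a₁a₂ = 1 + a₃²`, turns them into the formulas for `b₂` and `b₃`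
(`NaturalTensorCoeffs.ObstructionsVanish.cramer`), and the formula for `b₁` follows from `(a₁ + 2t
b₁)(a₂ + 2t b₂) = 1 + (a₃ + 2t b₃)²` (`NaturalTensorCoeffs.denom_mul_radial`). That the denominator
`D` has no zero is a uniqueness argument: up to a first zero, `D (a₁ + 2t b₁)` solves a homogeneous
linear differential equation (`NaturalTensorCoeffs.denom_ne_zero`).
-/

set_option maxSynthPendingDepth 3

/-! ### Inner products, local metrics and their curvature -/

noncomputable section LocalRiemannian

variable {E : Type*} [NormedAddCommGroup E] [NormedSpace ℝ E]

/-- `B` is an inner product on `E` (not tied to the norm of `E`). -/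
structure IsInnerForm (B : E →L[ℝ] E →L[ℝ] ℝ) : Prop where
  symm : ∀ u v, B u v = B v u
  pos : ∀ u, u ≠ 0 → 0 < B u u

namespace IsInnerForm

variable {B : E →L[ℝ] E →L[ℝ] ℝ}

lemma nonneg (hB : IsInnerForm B) (u : E) : 0 ≤ B u u := by
  rcases eq_or_ne u 0 with rfl | h
  · simp
  · exact (hB.pos u h).le

/-- Strict Cauchy–Schwarz inequality. -/
lemma gram_pos (hB : IsInnerForm B) {u v : E} (h : LinearIndependent ℝ ![u, v]) :
    0 < B u u * B v v - B u v ^ 2 := by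
  have hu : u ≠ 0 := h.ne_zero 0
  have hw : B u u • v - B u v • u ≠ 0 := by
    intro h0
    have := LinearIndependent.pair_iff.1 h (-(B u v)) (B u u) (by rw [← h0]; module)
    exact (hB.pos u hu).ne' this.2
  have h1 := hB.pos _ hw
  have h2 : B (B u u • v - B u v • u) (B u u • v - B u v • u)
      = B u u * (B u u * B v v - B u v ^ 2) := by
    simp only [map_sub, map_smul, sub_apply, smul_apply, smul_eq_mul, hB.symm v u]
    ring
  rw [h2] at h1
  exact pos_of_mul_pos_right h1 (hB.pos u hu).le

variable [FiniteDimensional ℝ E]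

lemma isInvertible (hB : IsInnerForm B) : B.IsInvertible := by
  have hinj : Function.Injective (B : E →ₗ[ℝ] E →L[ℝ] ℝ) := by
    refine (injective_iff_map_eq_zero _).2 fun u hu => ?_
    by_contra hne
    have h := hB.pos u hne
    have h0 : B u = 0 := hu
    simp [h0] at h
  have hdim : Module.finrank ℝ E = Module.finrank ℝ (E →L[ℝ] ℝ) := by
    rw [← (LinearMap.toContinuousLinearMap (𝕜 := ℝ) (E := E) (F' := ℝ)).finrank_eq]
    exact Subspace.dual_finrank_eq.symm
  refine ⟨(LinearEquiv.ofInjectiveOfFinrankEq (B : E →ₗ[ℝ] E →L[ℝ] ℝ) hinj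
    hdim).toContinuousLinearEquiv, ?_⟩
  ext u v
  rfl

lemma apply_inverse (hB : IsInnerForm B) (θ : E →L[ℝ] ℝ) : B (B.inverse θ) = θ :=
  hB.isInvertible.self_apply_inverse θ

lemma inverse_apply (hB : IsInnerForm B) (u : E) : B.inverse (B u) = u :=
  hB.isInvertible.inverse_apply_self u

/-- The inverse form on covectors is symmetric. -/
lemma inverse_symm (hB : IsInnerForm B) (θ ψ : E →L[ℝ] ℝ) :
    θ (B.inverse ψ) = ψ (B.inverse θ) := by
  conv_lhs => rw [← hB.apply_inverse θ]
  conv_rhs => rw [← hB.apply_inverse ψ]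
  exact hB.symm _ _

lemma ext (hB : IsInnerForm B) {u v : E} (h : ∀ w, B u w = B v w) : u = v := by
  rw [← hB.inverse_apply u, ← hB.inverse_apply v]
  congr 1
  ext w
  exact h w

end IsInnerForm

/-- A smooth Riemannian metric on the open subset `U` of the vector space `E`. -/
structure IsLocalMetric (h : E → E →L[ℝ] E →L[ℝ] ℝ) (U : Set E) : Prop where
  isOpen : IsOpen U
  contDiffOn : ContDiffOn ℝ ∞ h U
  inner : ∀ y ∈ U, IsInnerForm (h y)

/-- The Christoffel symbols of the metric `h` on (an open subset of) `E`. -/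
def localChristoffel (h : E → E →L[ℝ] E →L[ℝ] ℝ) (y : E) : E →L[ℝ] E →L[ℝ] E :=
  (ContinuousLinearMap.compL ℝ E (E →L[ℝ] ℝ) E (h y).inverse) ∘L
    ((1 / 2 : ℝ) • (fderiv ℝ h y + (fderiv ℝ h y).flip
      - (ContinuousLinearMap.flipₗᵢ ℝ E E ℝ).toContinuousLinearEquiv.toContinuousLinearMap ∘L
          (fderiv ℝ h y).flip))

/-- The curvature tensor of the metric `h` on (an open subset of) `E`. -/
def localCurvature (h : E → E →L[ℝ] E →L[ℝ] ℝ) (y u v w : E) : E :=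
  fderiv ℝ (fun z => localChristoffel h z v w) y u
    - fderiv ℝ (fun z => localChristoffel h z u w) y v
    + localChristoffel h y u (localChristoffel h y v w)
    - localChristoffel h y v (localChristoffel h y u w)

namespace IsLocalMetric

variable {h : E → E →L[ℝ] E →L[ℝ] ℝ} {U : Set E} {y : E}

lemma contDiffAt (hU : IsLocalMetric h U) (hy : y ∈ U) : ContDiffAt ℝ ∞ h y :=
  hU.contDiffOn.contDiffAt (hU.isOpen.mem_nhds hy)

lemma differentiableAt (hU : IsLocalMetric h U) (hy : y ∈ U) : DifferentiableAt ℝ h y :=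
  (hU.contDiffAt hy).differentiableAt (by simp)

lemma contDiffAt_fderiv (hU : IsLocalMetric h U) (hy : y ∈ U) : ContDiffAt ℝ ∞ (fderiv ℝ h) y :=
  (hU.contDiffAt hy).fderiv_right (by simp)

lemma fderiv_symm (hU : IsLocalMetric h U) (hy : y ∈ U) (u v w : E) :
    fderiv ℝ h y u v w = fderiv ℝ h y u w v := by
  have hd := (hU.differentiableAt hy).hasFDerivAt
  have key : ∀ a b : E, HasFDerivAt (fun z => h z a b) (((fderiv ℝ h y).flip a).flip b) y := by
    intro a b
    refine ((hd.clm_apply (hasFDerivAt_const a y)).clm_apply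
      (hasFDerivAt_const b y)).congr_fderiv ?_
    ext x
    simp
  have h2 := (key w v).congr_of_eventuallyEq (f₁ := fun z => h z v w)
    (Filter.eventually_of_mem (hU.isOpen.mem_nhds hy) fun z hz => (hU.inner z hz).symm v w)
  exact congrArg (fun L => L u) ((key v w).unique h2)

variable [FiniteDimensional ℝ E]

lemma contDiffAt_inverse (hU : IsLocalMetric h U) (hy : y ∈ U) :
    ContDiffAt ℝ ∞ (fun z => (h z).inverse) y :=
  ((hU.inner y hy).isInvertible.contDiffAt_map_inverse (n := ∞)).comp y (hU.contDiffAt hy)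

lemma contDiffAt_christoffel (hU : IsLocalMetric h U) (hy : y ∈ U) :
    ContDiffAt ℝ ∞ (localChristoffel h) y := by
  have h1 := hU.contDiffAt_fderiv hy
  have h2 : ContDiffAt ℝ ∞ (fun z => (fderiv ℝ h z).flip) y :=
    (ContinuousLinearMap.flipₗᵢ ℝ E E (E →L[ℝ] ℝ)).contDiff.contDiffAt.comp y h1
  refine ContDiffAt.clm_comp ?_ (ContDiffAt.const_smul _ ((h1.add h2).sub ?_))
  · exact (ContinuousLinearMap.contDiff _).contDiffAt.comp y (hU.contDiffAt_inverse hy)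
  · exact contDiffAt_const.clm_comp h2

lemma differentiableAt_christoffel (hU : IsLocalMetric h U) (hy : y ∈ U) :
    DifferentiableAt ℝ (localChristoffel h) y :=
  (hU.contDiffAt_christoffel hy).differentiableAt (by simp)

/-- The Koszul formula. -/
lemma inner_christoffel (hU : IsLocalMetric h U) (hy : y ∈ U) (u v w : E) :
    h y (localChristoffel h y u v) w
      = (1 / 2) * (fderiv ℝ h y u v w + fderiv ℝ h y v u w - fderiv ℝ h y w u v) := by
  simp only [localChristoffel, ContinuousLinearMap.comp_apply, ContinuousLinearMap.compL_apply,
    (hU.inner y hy).apply_inverse]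
  simp

lemma christoffel_symm (hU : IsLocalMetric h U) (hy : y ∈ U) (u v : E) :
    localChristoffel h y u v = localChristoffel h y v u := by
  refine (hU.inner y hy).ext fun w => ?_
  rw [hU.inner_christoffel hy, hU.inner_christoffel hy, hU.fderiv_symm hy w u v]
  ring

/-- The connection is compatible with the metric. -/
lemma fderiv_eq (hU : IsLocalMetric h U) (hy : y ∈ U) (u v w : E) :
    fderiv ℝ h y u v w
      = h y (localChristoffel h y u v) w + h y v (localChristoffel h y u w) := by
  rw [(hU.inner y hy).symm v, hU.inner_christoffel hy, hU.inner_christoffel hy,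
    hU.fderiv_symm hy u w v, hU.fderiv_symm hy v u w]
  ring

/-- The Christoffel symbols are determined by symmetry and compatibility with the metric. -/
lemma eq_christoffel (hU : IsLocalMetric h U) (hy : y ∈ U) (Γ : E → E → E)
    (hsymm : ∀ u v, Γ u v = Γ v u)
    (hcompat : ∀ u v w, fderiv ℝ h y u v w = h y (Γ u v) w + h y v (Γ u w)) (u v : E) :
    localChristoffel h y u v = Γ u v := by
  have hs := (hU.inner y hy).symm
  refine (hU.inner y hy).ext fun w => ?_
  rw [hU.inner_christoffel hy, hcompat, hcompat, hcompat, hs v, hs u, hs u, hsymm w u, hsymm w v,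
    hsymm v u]
  ring

/-! ### Symmetries of the curvature tensor -/

lemma hasFDerivAt_christoffel_apply (hU : IsLocalMetric h U) (hy : y ∈ U) (v w : E) :
    HasFDerivAt (fun z => localChristoffel h z v w)
      (((fderiv ℝ (localChristoffel h) y).flip v).flip w) y := by
  refine (((hU.differentiableAt_christoffel hy).hasFDerivAt.clm_apply
    (hasFDerivAt_const v y)).clm_apply (hasFDerivAt_const w y)).congr_fderiv ?_
  ext x
  simp

lemma localCurvature_eq (hU : IsLocalMetric h U) (hy : y ∈ U) (u v w : E) :
    localCurvature h y u v w = fderiv ℝ (localChristoffel h) y u v w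
      - fderiv ℝ (localChristoffel h) y v u w
      + localChristoffel h y u (localChristoffel h y v w)
      - localChristoffel h y v (localChristoffel h y u w) := by
  rw [localCurvature, (hU.hasFDerivAt_christoffel_apply hy v w).fderiv,
    (hU.hasFDerivAt_christoffel_apply hy u w).fderiv]
  rfl

lemma fderiv_christoffel_symm (hU : IsLocalMetric h U) (hy : y ∈ U) (u v w : E) :
    fderiv ℝ (localChristoffel h) y u v w = fderiv ℝ (localChristoffel h) y u w v := by
  have h2 := (hU.hasFDerivAt_christoffel_apply hy w v).congr_of_eventuallyEq
    (f₁ := fun z => localChristoffel h z v w)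
    (Filter.eventually_of_mem (hU.isOpen.mem_nhds hy) fun z hz => hU.christoffel_symm hz v w)
  exact congrArg (fun L => L u) ((hU.hasFDerivAt_christoffel_apply hy v w).unique h2)

lemma localCurvature_antisymm (hU : IsLocalMetric h U) (hy : y ∈ U) (u v w : E) :
    localCurvature h y u v w = -localCurvature h y v u w := by
  rw [hU.localCurvature_eq hy, hU.localCurvature_eq hy]
  abel

/-- First Bianchi identity. -/
lemma localCurvature_bianchi (hU : IsLocalMetric h U) (hy : y ∈ U) (u v w : E) :
    localCurvature h y u v w + localCurvature h y v w u + localCurvature h y w u v = 0 := by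
  simp only [hU.localCurvature_eq hy]
  rw [hU.fderiv_christoffel_symm hy u w v, hU.fderiv_christoffel_symm hy v w u,
    hU.fderiv_christoffel_symm hy w v u, hU.christoffel_symm hy w v, hU.christoffel_symm hy u w,
    hU.christoffel_symm hy v u]
  abel

/-- The curvature operators are skew-symmetric: this is the symmetry of the second derivative of
the metric. -/
lemma localCurvature_skew (hU : IsLocalMetric h U) (hy : y ∈ U) (u v w x : E) :
    h y (localCurvature h y u v w) x = -h y w (localCurvature h y u v x) := by
  have hsymm2 : ∀ a b : E, fderiv ℝ (fderiv ℝ h) y a b = fderiv ℝ (fderiv ℝ h) y b a := by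
    have := (hU.contDiffAt hy).isSymmSndFDerivAt
      (by simpa using WithTop.coe_le_coe.2 (le_top : (2 : ℕ∞) ≤ ⊤))
    exact fun a b => this a b
  have hΓ := (hU.differentiableAt_christoffel hy).hasFDerivAt
  have hh := (hU.differentiableAt hy).hasFDerivAt
  have hD := ((hU.contDiffAt_fderiv hy).differentiableAt (by simp)).hasFDerivAt
  have key : ∀ a b : E, fderiv ℝ (fderiv ℝ h) y a b w x
      = fderiv ℝ h y a (localChristoffel h y b w) x
        + h y (fderiv ℝ (localChristoffel h) y a b w) x
        + fderiv ℝ h y a w (localChristoffel h y b x)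
        + h y w (fderiv ℝ (localChristoffel h) y a b x) := by
    intro a b
    have c1 : HasFDerivAt (fun z => fderiv ℝ h z b w x) _ y :=
      ((hD.clm_apply (hasFDerivAt_const b y)).clm_apply (hasFDerivAt_const w y)).clm_apply
        (hasFDerivAt_const x y)
    have c2 : HasFDerivAt (fun z => h z (localChristoffel h z b w) x
        + h z w (localChristoffel h z b x)) _ y :=
      ((hh.clm_apply ((hΓ.clm_apply (hasFDerivAt_const b y)).clm_apply
        (hasFDerivAt_const w y))).clm_apply (hasFDerivAt_const x y)).add
      ((hh.clm_apply (hasFDerivAt_const w y)).clm_apply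
        ((hΓ.clm_apply (hasFDerivAt_const b y)).clm_apply (hasFDerivAt_const x y)))
    have c3 := c2.congr_of_eventuallyEq (f₁ := fun z => fderiv ℝ h z b w x)
      (Filter.eventually_of_mem (hU.isOpen.mem_nhds hy) fun z hz => hU.fderiv_eq hz b w x)
    have := congrArg (fun L => L a) (c1.unique c3)
    simp at this
    linarith
  have e := congrArg (fun L => L w x) (hsymm2 u v)
  simp only [key, hU.fderiv_eq hy] at e
  rw [hU.localCurvature_eq hy, hU.localCurvature_eq hy]
  simp only [map_add, map_sub, add_apply, sub_apply]
  linarith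

end IsLocalMetric

/-- An algebraic curvature tensor all of whose sectional curvatures vanish is zero. -/
lemma curvatureLike_eq_zero {V : Type*} [AddCommGroup V] {f : V → V → V → V → ℝ}
    (hadd : ∀ u u' v w x, f (u + u') v w x = f u v w x + f u' v w x)
    (hanti : ∀ u v w x, f u v w x = -f v u w x) (hskew : ∀ u v w x, f u v w x = -f u v x w)
    (hbianchi : ∀ u v w x, f u v w x + f v w u x + f w u v x = 0)
    (hsec : ∀ u v, f u v v u = 0) (u v w x : V) : f u v w x = 0 := by
  -- pair symmetry: add up the Bianchi identities for the four cyclic arrangements of `u, v, w, x`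
  have hpair : ∀ u v w x, f u v w x = f w x u v := by
    intro u v w x
    linarith [hbianchi u v w x, hbianchi v w x u, hbianchi w x u v, hbianchi x u v w,
      hanti u v w x, hskew u v w x, hanti v w x u, hskew v w x u, hanti w x u v, hskew w x u v,
      hanti x u v w, hskew x u v w, hanti w u v x, hskew w u v x, hanti v x w u, hskew v x w u,
      hanti u w x v, hskew u w x v, hanti v w u x, hskew v w u x, hanti u w v x, hanti x v w u,
      hskew x v w u, hskew u w v x, hanti x u w v, hanti u x v w, hskew u x v w]
  have hadd4 : ∀ u v w x x', f u v w (x + x') = f u v w x + f u v w x' := by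
    intro u v w x x'
    rw [hskew, hskew u v w x, hskew u v w x', hpair, hpair u v x, hpair u v x', hadd]
    ring
  have hpol : ∀ u v x, f u v v x = 0 := by
    intro u v x
    have h1 := hsec (u + x) v
    rw [hadd, hadd4, hadd4, hsec, hsec] at h1
    have h2 : f x v v u = f u v v x := by rw [hpair, hanti, hskew]; ring
    linarith
  have hadd2 : ∀ u v v' w x, f u (v + v') w x = f u v w x + f u v' w x := by
    intro u v v' w x
    rw [hanti, hadd, hanti u v, hanti u v']; ring
  have hadd3 : ∀ u v w w' x, f u v (w + w') x = f u v w x + f u v w' x := by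
    intro u v w w' x
    rw [hskew, hadd4, hskew u v w, hskew u v w']; ring
  -- skew-symmetry in the two middle arguments, which turns the Bianchi identity into `3 f = 0`
  have hswap : ∀ u v w x, f u v w x = -f u w v x := by
    intro u v w x
    have h1 := hpol u (v + w) x
    rw [hadd2, hadd3, hadd3, hpol, hpol] at h1
    linarith
  linarith [hbianchi u v w x, hswap u v w x, hanti w u v x, hanti v w u x, hswap w v u x]

end LocalRiemannian

/-! ### The Nijenhuis tensor on a vector space -/

noncomputable section NijenhuisTensor

variable {V : Type*} [NormedAddCommGroup V] [NormedSpace ℝ V]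

/-- The value of the Nijenhuis bracket of a field `J` of endomorphisms of a vector space on constant
vector fields. -/
def nijenhuisTensor (J : V → V →L[ℝ] V) (z ξ η : V) : V :=
  fderiv ℝ J z (J z ξ) η - fderiv ℝ J z (J z η) ξ + J z (fderiv ℝ J z η ξ)
    - J z (fderiv ℝ J z ξ η)

open VectorField in
/-- The Nijenhuis bracket is a tensor: it depends on the values of the fields at the point only. -/
lemma nijenhuisTensor_eq {J : V → V →L[ℝ] V} {z : V} (hJ : DifferentiableAt ℝ J z)
    (hsq : ∀ ξ, J z (J z ξ) = -ξ) {X Y : V → V} (hX : DifferentiableAt ℝ X z)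
    (hY : DifferentiableAt ℝ Y z) :
    lieBracket ℝ (fun w => J w (X w)) (fun w => J w (Y w)) z
      - J z (lieBracket ℝ (fun w => J w (X w)) Y z) - J z (lieBracket ℝ X (fun w => J w (Y w)) z)
      - lieBracket ℝ X Y z = nijenhuisTensor J z (X z) (Y z) := by
  have hJX := (hJ.hasFDerivAt.clm_apply hX.hasFDerivAt).fderiv
  have hJY := (hJ.hasFDerivAt.clm_apply hY.hasFDerivAt).fderiv
  simp only [lieBracket, nijenhuisTensor, hJX, hJY]
  simp only [add_apply, ContinuousLinearMap.comp_apply, ContinuousLinearMap.flip_apply, map_add,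
    map_sub, hsq]
  abel

section

variable {J : V → V →L[ℝ] V} {z : V}

lemma nijenhuisTensor_antisymm (ξ η : V) : nijenhuisTensor J z ξ η = -nijenhuisTensor J z η ξ := by
  simp only [nijenhuisTensor]
  abel

lemma nijenhuisTensor_add (ξ η ζ : V) :
    nijenhuisTensor J z (ξ + η) ζ = nijenhuisTensor J z ξ ζ + nijenhuisTensor J z η ζ := by
  simp only [nijenhuisTensor, map_add, add_apply]
  abel

/-- The identity `N(Jξ, η) = -J N(ξ, η)`. -/
lemma nijenhuisTensor_apply_left (hJ : DifferentiableAt ℝ J z)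
    (hsq : ∀ᶠ w in nhds z, ∀ ξ, J w (J w ξ) = -ξ) (ξ η : V) :
    nijenhuisTensor J z (J z ξ) η = -J z (nijenhuisTensor J z ξ η) := by
  have hsqz := hsq.self_of_nhds
  -- the derivative of `J² = -1`
  have key : ∀ ζ ξ : V, fderiv ℝ J z ζ (J z ξ) = -J z (fderiv ℝ J z ζ ξ) := by
    intro ζ ξ
    have h1 := hJ.hasFDerivAt.clm_apply (hJ.hasFDerivAt.clm_apply (hasFDerivAt_const ξ z))
    have h2 := (hasFDerivAt_const (𝕜 := ℝ) (-ξ) z).congr_of_eventuallyEq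
      (f₁ := fun w => J w (J w ξ)) (hsq.mono fun w hw => hw ξ)
    have := congrArg (fun L : V →L[ℝ] V => L ζ) (h1.unique h2)
    simp only [add_apply, ContinuousLinearMap.comp_apply, ContinuousLinearMap.flip_apply,
      zero_apply, map_zero, zero_add] at this
    exact eq_neg_of_add_eq_zero_left (by rw [add_comm]; exact this)
  simp only [nijenhuisTensor, hsqz, key, map_add, map_sub, map_neg, neg_apply]
  abel

/-- The Nijenhuis tensor vanishes as soon as it vanishes on a subspace `S` with `S + J S = V`. -/
lemma nijenhuisTensor_eq_zero_of_span (hJ : DifferentiableAt ℝ J z)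
    (hsq : ∀ᶠ w in nhds z, ∀ ξ, J w (J w ξ) = -ξ) {S : Set V}
    (hS : ∀ ξ, ∃ a ∈ S, ∃ b ∈ S, ξ = a + J z b)
    (h0 : ∀ a ∈ S, ∀ b ∈ S, nijenhuisTensor J z a b = 0) (ξ η : V) :
    nijenhuisTensor J z ξ η = 0 := by
  have step : ∀ a ∈ S, ∀ ξ, nijenhuisTensor J z ξ a = 0 := by
    intro a ha ξ
    obtain ⟨b, hb, c, hc, rfl⟩ := hS ξ
    rw [nijenhuisTensor_add, nijenhuisTensor_apply_left hJ hsq, h0 b hb a ha, h0 c hc a ha]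
    simp
  obtain ⟨b, hb, c, hc, rfl⟩ := hS ξ
  rw [nijenhuisTensor_add, nijenhuisTensor_apply_left hJ hsq, nijenhuisTensor_antisymm b,
    nijenhuisTensor_antisymm c, step b hb, step c hc]
  simp

end

end NijenhuisTensor

noncomputable section LocalNatural

variable {E : Type*} [NormedAddCommGroup E] [NormedSpace ℝ E]

/-! ### Natural tensors on `E × E*` -/

/-- The horizontal part of `J(u^H + θ^V)` at the covector `p`, for the inner product `B`. -/
def naturalHorPart (A : NaturalTensorCoeffs) (B : E →L[ℝ] E →L[ℝ] ℝ) (p : E →L[ℝ] ℝ) (u : E)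
    (θ : E →L[ℝ] ℝ) : E :=
  let t := 1 / 2 * p (B.inverse p)
  A.a₄ t • u + (A.b₄ t * p u) • B.inverse p - A.a₂ t • B.inverse θ
    - (A.b₂ t * p (B.inverse θ)) • B.inverse p

/-- The vertical part of `J(u^H + θ^V)` at the covector `p`, for the inner product `B`. -/
def naturalVertPart (A : NaturalTensorCoeffs) (B : E →L[ℝ] E →L[ℝ] ℝ) (p : E →L[ℝ] ℝ) (u : E)
    (θ : E →L[ℝ] ℝ) : E →L[ℝ] ℝ :=
  let t := 1 / 2 * p (B.inverse p)
  A.a₁ t • B u + (A.b₁ t * p u) • p + A.a₃ t • θ + (A.b₃ t * p (B.inverse θ)) • p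

/-- `G(u^H + θ^V, v^H + ψ^V)` at the covector `p`, for the inner product `B`. -/
def naturalForm (C : NaturalMetricCoeffs) (B : E →L[ℝ] E →L[ℝ] ℝ) (p : E →L[ℝ] ℝ) (u : E)
    (θ : E →L[ℝ] ℝ) (v : E) (ψ : E →L[ℝ] ℝ) : ℝ :=
  let t := 1 / 2 * p (B.inverse p)
  (C.c₁ t * B u v + C.d₁ t * (p u * p v))
    + (C.c₂ t * θ (B.inverse ψ) + C.d₂ t * (p (B.inverse θ) * p (B.inverse ψ)))
    + (C.c₃ t * ψ u + C.d₃ t * (p u * p (B.inverse ψ)))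
    + (C.c₃ t * θ v + C.d₃ t * (p v * p (B.inverse θ)))

/-- The energy density `t` at the point `z = (y, p)`. -/
def localEnergy (h : E → E →L[ℝ] E →L[ℝ] ℝ) (z : E × (E →L[ℝ] ℝ)) : ℝ :=
  1 / 2 * z.2 ((h z.1).inverse z.2)

/-- The vertical component `σ - p Γ(u, ·)` of the vector `(u, σ)` at the point `z = (y, p)`. -/
def localVert (h : E → E →L[ℝ] E →L[ℝ] ℝ) (z ζ : E × (E →L[ℝ] ℝ)) : E →L[ℝ] ℝ :=
  ζ.2 - z.2.comp (localChristoffel h z.1 ζ.1)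

/-- The vector at `z` with horizontal component `b` and vertical component `a`. -/
def localLift (h : E → E →L[ℝ] E →L[ℝ] ℝ) (z : E × (E →L[ℝ] ℝ)) (b : E) (a : E →L[ℝ] ℝ) :
    E × (E →L[ℝ] ℝ) :=
  (b, a + z.2.comp (localChristoffel h z.1 b))

@[simp] lemma localVert_localLift (h : E → E →L[ℝ] E →L[ℝ] ℝ) (z : E × (E →L[ℝ] ℝ)) (b : E)
    (a : E →L[ℝ] ℝ) : localVert h z (localLift h z b a) = a := by
  simp [localVert, localLift]

lemma localLift_localVert (h : E → E →L[ℝ] E →L[ℝ] ℝ) (z ζ : E × (E →L[ℝ] ℝ)) :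
    localLift h z ζ.1 (localVert h z ζ) = ζ := by
  simp [localVert, localLift]

@[simp] lemma localVert_vertical (h : E → E →L[ℝ] E →L[ℝ] ℝ) (z : E × (E →L[ℝ] ℝ))
    (θ : E →L[ℝ] ℝ) : localVert h z (0, θ) = θ := by
  simp [localVert]

lemma localVert_add (h : E → E →L[ℝ] E →L[ℝ] ℝ) (z ζ ζ' : E × (E →L[ℝ] ℝ)) :
    localVert h z (ζ + ζ') = localVert h z ζ + localVert h z ζ' := by
  simp only [localVert, Prod.fst_add, Prod.snd_add, map_add, ContinuousLinearMap.comp_add]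
  abel

lemma localVert_sub (h : E → E →L[ℝ] E →L[ℝ] ℝ) (z ζ ζ' : E × (E →L[ℝ] ℝ)) :
    localVert h z (ζ - ζ') = localVert h z ζ - localVert h z ζ' := by
  simp only [localVert, Prod.fst_sub, Prod.snd_sub, map_sub, ContinuousLinearMap.comp_sub]
  abel

lemma localVert_smul (h : E → E →L[ℝ] E →L[ℝ] ℝ) (z : E × (E →L[ℝ] ℝ)) (r : ℝ)
    (ζ : E × (E →L[ℝ] ℝ)) : localVert h z (r • ζ) = r • localVert h z ζ := by
  simp only [localVert, Prod.smul_fst, Prod.smul_snd, map_smul, ContinuousLinearMap.comp_smul,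
    smul_sub]

namespace IsLocalMetric

variable {h : E → E →L[ℝ] E →L[ℝ] ℝ} {U : Set E} {z : E × (E →L[ℝ] ℝ)}

lemma eventually_mem (hU : IsLocalMetric h U) (hz : z.1 ∈ U) : ∀ᶠ w in nhds z, w.1 ∈ U :=
  continuous_fst.continuousAt.eventually (hU.isOpen.mem_nhds hz)

end IsLocalMetric

variable [FiniteDimensional ℝ E]

/-- The tensor field `J` in coordinates `(y, p)`. -/
def localJ (A : NaturalTensorCoeffs) (h : E → E →L[ℝ] E →L[ℝ] ℝ) (z : E × (E →L[ℝ] ℝ)) :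
    (E × (E →L[ℝ] ℝ)) →L[ℝ] E × (E →L[ℝ] ℝ) :=
  LinearMap.toContinuousLinearMap
    { toFun := fun ζ => localLift h z
        (naturalHorPart A (h z.1) z.2 ζ.1 (localVert h z ζ))
        (naturalVertPart A (h z.1) z.2 ζ.1 (localVert h z ζ))
      map_add' := by
        intro ζ ζ'
        refine Prod.ext ?_ ?_
        · simp only [localLift, naturalHorPart, localVert_add, Prod.fst_add, map_add, mul_add]
          module
        · simp only [localLift, naturalHorPart, naturalVertPart, localVert_add, Prod.fst_add,
            Prod.snd_add, map_add, map_sub, map_smul, mul_add, ContinuousLinearMap.comp_add,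
            ContinuousLinearMap.comp_sub, ContinuousLinearMap.comp_smul]
          module
      map_smul' := by
        intro r ζ
        refine Prod.ext ?_ ?_
        · simp only [localLift, naturalHorPart, localVert_smul, Prod.smul_fst, map_smul,
            RingHom.id_apply, smul_eq_mul]
          module
        · simp only [localLift, naturalHorPart, naturalVertPart, localVert_smul, Prod.smul_fst,
            Prod.smul_snd, map_add, map_sub, map_smul, ContinuousLinearMap.comp_add,
            ContinuousLinearMap.comp_sub, ContinuousLinearMap.comp_smul, RingHom.id_apply,
            smul_eq_mul]
          module }

lemma localJ_apply (A : NaturalTensorCoeffs) (h : E → E →L[ℝ] E →L[ℝ] ℝ)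
    (z ζ : E × (E →L[ℝ] ℝ)) : localJ A h z ζ = localLift h z
      (naturalHorPart A (h z.1) z.2 ζ.1 (localVert h z ζ))
      (naturalVertPart A (h z.1) z.2 ζ.1 (localVert h z ζ)) := rfl

lemma localJ_localLift (A : NaturalTensorCoeffs) (h : E → E →L[ℝ] E →L[ℝ] ℝ)
    (z : E × (E →L[ℝ] ℝ)) (b : E) (a : E →L[ℝ] ℝ) : localJ A h z (localLift h z b a)
      = localLift h z (naturalHorPart A (h z.1) z.2 b a) (naturalVertPart A (h z.1) z.2 b a) := by
  rw [localJ_apply, localVert_localLift]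
  rfl

lemma localJ_vertical (A : NaturalTensorCoeffs) (h : E → E →L[ℝ] E →L[ℝ] ℝ)
    (w : E × (E →L[ℝ] ℝ)) (θ : E →L[ℝ] ℝ) : localJ A h w (0, θ) = localLift h w
      (naturalHorPart A (h w.1) w.2 0 θ) (naturalVertPart A (h w.1) w.2 0 θ) := by
  rw [localJ_apply, localVert_vertical]

namespace IsLocalMetric

variable {h : E → E →L[ℝ] E →L[ℝ] ℝ} {U : Set E} {z : E × (E →L[ℝ] ℝ)}

lemma localEnergy_nonneg (hU : IsLocalMetric h U) (hz : z.1 ∈ U) : 0 ≤ localEnergy h z := by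
  have h1 := (hU.inner _ hz).nonneg ((h z.1).inverse z.2)
  rw [(hU.inner _ hz).apply_inverse] at h1
  simp only [localEnergy]
  positivity

lemma contDiffAt_sharp (hU : IsLocalMetric h U) (hz : z.1 ∈ U) {θ : E × (E →L[ℝ] ℝ) → E →L[ℝ] ℝ}
    (hθ : ContDiffAt ℝ ∞ θ z) : ContDiffAt ℝ ∞ (fun w => (h w.1).inverse (θ w)) z :=
  ((hU.contDiffAt_inverse hz).comp z contDiffAt_fst).clm_apply hθ

lemma contDiffAt_localEnergy (hU : IsLocalMetric h U) (hz : z.1 ∈ U) :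
    ContDiffAt ℝ ∞ (localEnergy h) z :=
  contDiffAt_const.mul (contDiffAt_snd.clm_apply (hU.contDiffAt_sharp hz contDiffAt_snd))

lemma eventually_energy (hU : IsLocalMetric h U) (hz : z.1 ∈ U) :
    ∀ᶠ w in nhds z, localEnergy h w ∈ Set.Ici (0 : ℝ) :=
  (hU.eventually_mem hz).mono fun _ hw => hU.localEnergy_nonneg hw

lemma contDiffAt_comp_energy (hU : IsLocalMetric h U) (hz : z.1 ∈ U) {f : ℝ → ℝ}
    (hf : ContDiffOn ℝ ∞ f (Set.Ici 0)) : ContDiffAt ℝ ∞ (fun w => f (localEnergy h w)) z := by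
  have h1 := hf (localEnergy h z) (hU.localEnergy_nonneg hz)
  have h2 : ContDiffWithinAt ℝ ∞ (f ∘ localEnergy h) (localEnergy h ⁻¹' Set.Ici 0) z :=
    h1.comp z (hU.contDiffAt_localEnergy hz).contDiffWithinAt fun _ hw => hw
  exact h2.contDiffAt (hU.eventually_energy hz)

/-- The chain rule for a function of the energy density. The function is smooth only on `[0, ∞)`,
which suffices since the energy density is nonnegative also around points where it vanishes. -/
lemma hasFDerivAt_comp_energy (hU : IsLocalMetric h U) (hz : z.1 ∈ U) {f : ℝ → ℝ}
    (hf : ContDiffOn ℝ ∞ f (Set.Ici 0)) {L : (E × (E →L[ℝ] ℝ)) →L[ℝ] ℝ}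
    (hL : HasFDerivAt (localEnergy h) L z) :
    HasFDerivAt (fun w => f (localEnergy h w)) (derivIci f (localEnergy h z) • L) z := by
  have h1 := ((hf (localEnergy h z) (hU.localEnergy_nonneg hz)).differentiableWithinAt
    (by simp)).hasDerivWithinAt
  have h2 : HasFDerivWithinAt (f ∘ localEnergy h) (derivIci f (localEnergy h z) • L)
      (localEnergy h ⁻¹' Set.Ici 0) z :=
    h1.comp_hasFDerivWithinAt z hL.hasFDerivWithinAt fun _ hw => hw
  exact h2.hasFDerivAt (hU.eventually_energy hz)

lemma contDiffAt_localVert (hU : IsLocalMetric h U) (hz : z.1 ∈ U) (ζ : E × (E →L[ℝ] ℝ)) :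
    ContDiffAt ℝ ∞ (fun w => localVert h w ζ) z :=
  contDiffAt_const.sub (contDiffAt_snd.clm_comp
    (((hU.contDiffAt_christoffel hz).comp z contDiffAt_fst).clm_apply contDiffAt_const))

lemma contDiffAt_localJ_apply (hU : IsLocalMetric h U) (hz : z.1 ∈ U) (A : NaturalTensorCoeffs)
    (ζ : E × (E →L[ℝ] ℝ)) : ContDiffAt ℝ ∞ (fun w => localJ A h w ζ) z := by
  have e : ∀ {f : ℝ → ℝ}, ContDiffOn ℝ ∞ f (Set.Ici 0) →
      ContDiffAt ℝ ∞ (fun w => f (localEnergy h w)) z := hU.contDiffAt_comp_energy hz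
  have hν := hU.contDiffAt_localVert hz ζ
  have hp : ContDiffAt ℝ ∞ (fun w : E × (E →L[ℝ] ℝ) => w.2) z := contDiffAt_snd
  have hs := hU.contDiffAt_sharp hz hp
  have hsν := hU.contDiffAt_sharp hz hν
  have hk := hp.clm_apply hsν
  have hpu := hp.clm_apply (contDiffAt_const (c := ζ.1))
  have hhor : ContDiffAt ℝ ∞
      (fun w => naturalHorPart A (h w.1) w.2 ζ.1 (localVert h w ζ)) z :=
    ((((e A.smooth_a₄).smul contDiffAt_const).add (((e A.smooth_b₄).mul hpu).smul hs)).sub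
      ((e A.smooth_a₂).smul hsν)).sub (((e A.smooth_b₂).mul hk).smul hs)
  have hver : ContDiffAt ℝ ∞
      (fun w => naturalVertPart A (h w.1) w.2 ζ.1 (localVert h w ζ)) z :=
    ((((e A.smooth_a₁).smul (((hU.contDiffAt hz).comp z contDiffAt_fst).clm_apply
      contDiffAt_const)).add (((e A.smooth_b₁).mul hpu).smul hp)).add
      ((e A.smooth_a₃).smul hν)).add (((e A.smooth_b₃).mul hk).smul hp)
  exact hhor.prodMk (hver.add (hp.clm_comp
    (((hU.contDiffAt_christoffel hz).comp z contDiffAt_fst).clm_apply hhor)))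

lemma differentiableAt_localJ (hU : IsLocalMetric h U) (hz : z.1 ∈ U) (A : NaturalTensorCoeffs) :
    DifferentiableAt ℝ (localJ A h) z := by
  have h1 : ContDiffOn ℝ ∞ (localJ A h) (U ×ˢ Set.univ) :=
    contDiffOn_clm_apply.2 fun ζ w hw => (hU.contDiffAt_localJ_apply hw.1 A ζ).contDiffWithinAt
  exact (h1.contDiffAt ((hU.isOpen.prod isOpen_univ).mem_nhds ⟨hz, trivial⟩)).differentiableAt
    (by simp)

end IsLocalMetric

end LocalNatural

/-! ### Derivatives of the natural tensors in coordinates -/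

noncomputable section NijenhuisComputation

variable {E : Type*} [NormedAddCommGroup E] [NormedSpace ℝ E]

/-- The covariant derivative at `z`, along a vector with vertical part `ν`, of the horizontal part
of `J θ^V`, for a covector field `θ` parallel at the base point of `z`. -/
def horPartDeriv (A : NaturalTensorCoeffs) (B : E →L[ℝ] E →L[ℝ] ℝ) (p θ ν : E →L[ℝ] ℝ) : E :=
  let t := 1 / 2 * p (B.inverse p)
  (-(derivIci A.a₂ t * ν (B.inverse p))) • B.inverse θ
    - (derivIci A.b₂ t * ν (B.inverse p) * p (B.inverse θ) + A.b₂ t * ν (B.inverse θ)) • B.inverse p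
    - (A.b₂ t * p (B.inverse θ)) • B.inverse ν

/-- The covariant derivative at `z`, along a vector with vertical part `ν`, of the vertical part
of `J θ^V`, for a covector field `θ` parallel at the base point of `z`. -/
def vertPartDeriv (A : NaturalTensorCoeffs) (B : E →L[ℝ] E →L[ℝ] ℝ) (p θ ν : E →L[ℝ] ℝ) :
    E →L[ℝ] ℝ :=
  let t := 1 / 2 * p (B.inverse p)
  (derivIci A.a₃ t * ν (B.inverse p)) • θ
    + (derivIci A.b₃ t * ν (B.inverse p) * p (B.inverse θ) + A.b₃ t * ν (B.inverse θ)) • p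
    + (A.b₃ t * p (B.inverse θ)) • ν

/-- The covector field with value `θ` at the base point of `z` and vanishing covariant derivative
there. -/
def parallelCovector (h : E → E →L[ℝ] E →L[ℝ] ℝ) (z : E × (E →L[ℝ] ℝ)) (θ : E →L[ℝ] ℝ)
    (w : E × (E →L[ℝ] ℝ)) : E →L[ℝ] ℝ :=
  θ + θ.comp (localChristoffel h z.1 (w.1 - z.1))

@[simp] lemma parallelCovector_self (h : E → E →L[ℝ] E →L[ℝ] ℝ) (z : E × (E →L[ℝ] ℝ))
    (θ : E →L[ℝ] ℝ) : parallelCovector h z θ z = θ := by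
  simp [parallelCovector]

lemma exists_hasFDerivAt_parallelCovector (h : E → E →L[ℝ] E →L[ℝ] ℝ) (z : E × (E →L[ℝ] ℝ))
    (θ : E →L[ℝ] ℝ) : ∃ L : (E × (E →L[ℝ] ℝ)) →L[ℝ] (E →L[ℝ] ℝ),
      HasFDerivAt (parallelCovector h z θ) L z ∧
        ∀ ζ, L ζ = θ.comp (localChristoffel h z.1 ζ.1) := by
  refine ⟨_, (((ContinuousLinearMap.compL ℝ E E ℝ θ).hasFDerivAt.comp z
    ((localChristoffel h z.1).hasFDerivAt.comp z
      (hasFDerivAt_fst.sub_const z.1))).const_add θ), fun ζ => ?_⟩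
  rfl

variable [FiniteDimensional ℝ E]

namespace IsLocalMetric

variable {h : E → E →L[ℝ] E →L[ℝ] ℝ} {U : Set E} {z : E × (E →L[ℝ] ℝ)}

/-- The musical isomorphism `♯` commutes with covariant differentiation; this is the derivative of
`h(θ♯, ·) = θ`. -/
lemma exists_hasFDerivAt_sharp (hU : IsLocalMetric h U) (hz : z.1 ∈ U)
    {θ : E × (E →L[ℝ] ℝ) → E →L[ℝ] ℝ} {L : (E × (E →L[ℝ] ℝ)) →L[ℝ] (E →L[ℝ] ℝ)}
    (hθ : HasFDerivAt θ L z) :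
    ∃ L' : (E × (E →L[ℝ] ℝ)) →L[ℝ] E, HasFDerivAt (fun w => (h w.1).inverse (θ w)) L' z ∧
      ∀ ζ, L' ζ = (h z.1).inverse (L ζ - (θ z).comp (localChristoffel h z.1 ζ.1))
        - localChristoffel h z.1 ζ.1 ((h z.1).inverse (θ z)) := by
  have hd : DifferentiableAt ℝ (fun w => (h w.1).inverse (θ w)) z :=
    (((hU.contDiffAt_inverse hz).differentiableAt (by simp)).comp z
      differentiableAt_fst).clm_apply hθ.differentiableAt
  refine ⟨_, hd.hasFDerivAt, fun ζ => ?_⟩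
  have c1 := ((hU.differentiableAt hz).hasFDerivAt.comp z hasFDerivAt_fst).clm_apply hd.hasFDerivAt
  have c2 := hθ.congr_of_eventuallyEq (f₁ := fun w => h w.1 ((h w.1).inverse (θ w)))
    ((hU.eventually_mem hz).mono fun w hw => (hU.inner _ hw).apply_inverse (θ w))
  have key := congrArg (fun L => L ζ) (c1.unique c2)
  have hB := hU.inner _ hz
  refine hB.ext fun w => ?_
  have k2 := congrArg (fun L => L w) key
  simp only [add_apply, ContinuousLinearMap.comp_apply, ContinuousLinearMap.flip_apply,
    ContinuousLinearMap.coe_fst', Function.comp_apply, hU.fderiv_eq hz, hB.apply_inverse] at k2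
  simp only [map_sub, sub_apply, hB.apply_inverse, ContinuousLinearMap.comp_apply]
  linarith

/-- The derivative of `g⁻¹(p, θ)`, for a covector field `θ`. -/
lemma exists_hasFDerivAt_pairing (hU : IsLocalMetric h U) (hz : z.1 ∈ U)
    {θ : E × (E →L[ℝ] ℝ) → E →L[ℝ] ℝ} {L : (E × (E →L[ℝ] ℝ)) →L[ℝ] (E →L[ℝ] ℝ)}
    (hθ : HasFDerivAt θ L z) :
    ∃ L' : (E × (E →L[ℝ] ℝ)) →L[ℝ] ℝ, HasFDerivAt (fun w => w.2 ((h w.1).inverse (θ w))) L' z ∧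
      ∀ ζ, L' ζ = localVert h z ζ ((h z.1).inverse (θ z))
        + (L ζ - (θ z).comp (localChristoffel h z.1 ζ.1)) ((h z.1).inverse z.2) := by
  obtain ⟨L', hL', hL'e⟩ := hU.exists_hasFDerivAt_sharp hz hθ
  refine ⟨_, hasFDerivAt_snd.clm_apply hL', fun ζ => ?_⟩
  simp only [add_apply, ContinuousLinearMap.comp_apply, ContinuousLinearMap.flip_apply,
    ContinuousLinearMap.coe_snd', hL'e, map_sub z.2]
  rw [(hU.inner _ hz).inverse_symm z.2]
  simp only [localVert, sub_apply, ContinuousLinearMap.comp_apply]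
  ring

/-- The differential of the energy density. -/
lemma exists_hasFDerivAt_localEnergy (hU : IsLocalMetric h U) (hz : z.1 ∈ U) :
    ∃ L : (E × (E →L[ℝ] ℝ)) →L[ℝ] ℝ, HasFDerivAt (localEnergy h) L z ∧
      ∀ ζ, L ζ = localVert h z ζ ((h z.1).inverse z.2) := by
  obtain ⟨L, hL, hLe⟩ := hU.exists_hasFDerivAt_pairing hz
    (hasFDerivAt_snd (𝕜 := ℝ) (p := z))
  refine ⟨_, hL.const_mul (1 / 2), fun ζ => ?_⟩
  simp only [smul_apply, hLe, smul_eq_mul, ContinuousLinearMap.coe_snd', localVert]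
  ring

/-- The derivative of the horizontal part of `J θ^V` is its covariant derivative, corrected by a
Christoffel term, for `θ` parallel at the base point. -/
lemma exists_hasFDerivAt_horPart (hU : IsLocalMetric h U) (hz : z.1 ∈ U) (A : NaturalTensorCoeffs)
    (θ : E →L[ℝ] ℝ) :
    ∃ L : (E × (E →L[ℝ] ℝ)) →L[ℝ] E,
      HasFDerivAt (fun w => naturalHorPart A (h w.1) w.2 0 (parallelCovector h z θ w)) L z ∧
      ∀ ζ, L ζ = horPartDeriv A (h z.1) z.2 θ (localVert h z ζ)
        - localChristoffel h z.1 ζ.1 (naturalHorPart A (h z.1) z.2 0 θ) := by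
  obtain ⟨P, hP, hPe⟩ := exists_hasFDerivAt_parallelCovector h z θ
  obtain ⟨Lt, hLt, hLte⟩ := hU.exists_hasFDerivAt_localEnergy hz
  obtain ⟨Ls, hLs, hLse⟩ := hU.exists_hasFDerivAt_sharp hz (hasFDerivAt_snd (𝕜 := ℝ) (p := z))
  obtain ⟨Le, hLe, hLee⟩ := hU.exists_hasFDerivAt_sharp hz hP
  obtain ⟨Lk, hLk, hLke⟩ := hU.exists_hasFDerivAt_pairing hz hP
  have main := (((hU.hasFDerivAt_comp_energy hz A.smooth_a₂ hLt).smul hLe).add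
    (((hU.hasFDerivAt_comp_energy hz A.smooth_b₂ hLt).mul hLk).smul hLs)).neg
  refine ⟨_, main.congr_of_eventuallyEq (.of_forall fun w => ?_), fun ζ => ?_⟩
  · simp only [naturalHorPart, localEnergy]
    simp
    module
  · simp only [Pi.mul_apply, neg_apply, add_apply, smul_apply,
      ContinuousLinearMap.smulRight_apply, hLee, hLse,
      hLke, hPe, hLte, parallelCovector_self, sub_self, zero_apply, map_zero, zero_sub, add_zero,
      horPartDeriv, naturalHorPart, ← localEnergy.eq_def, ContinuousLinearMap.coe_snd',
      ← localVert.eq_def, map_sub, map_neg, map_smul, mul_zero, smul_zero, zero_smul,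
      smul_eq_mul]
    module

/-- The derivative of the vertical part of `J θ^V` is its covariant derivative, corrected by a
Christoffel term, for `θ` parallel at the base point. -/
lemma exists_hasFDerivAt_vertPart (hU : IsLocalMetric h U) (hz : z.1 ∈ U)
    (A : NaturalTensorCoeffs) (θ : E →L[ℝ] ℝ) :
    ∃ L : (E × (E →L[ℝ] ℝ)) →L[ℝ] (E →L[ℝ] ℝ),
      HasFDerivAt (fun w => naturalVertPart A (h w.1) w.2 0 (parallelCovector h z θ w)) L z ∧
      ∀ ζ, L ζ = vertPartDeriv A (h z.1) z.2 θ (localVert h z ζ)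
        + (naturalVertPart A (h z.1) z.2 0 θ).comp (localChristoffel h z.1 ζ.1) := by
  obtain ⟨P, hP, hPe⟩ := exists_hasFDerivAt_parallelCovector h z θ
  obtain ⟨Lt, hLt, hLte⟩ := hU.exists_hasFDerivAt_localEnergy hz
  obtain ⟨Lk, hLk, hLke⟩ := hU.exists_hasFDerivAt_pairing hz hP
  have main := ((hU.hasFDerivAt_comp_energy hz A.smooth_a₃ hLt).smul hP).add
    (((hU.hasFDerivAt_comp_energy hz A.smooth_b₃ hLt).mul hLk).smul
      (hasFDerivAt_snd (𝕜 := ℝ) (p := z)))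
  refine ⟨_, main.congr_of_eventuallyEq (.of_forall fun w => ?_), fun ζ => ?_⟩
  · simp only [naturalVertPart, localEnergy]
    simp
  · have hσ : ζ.2 = localVert h z ζ + z.2.comp (localChristoffel h z.1 ζ.1) := by
      simp [localVert]
    simp only [Pi.mul_apply, add_apply, smul_apply, ContinuousLinearMap.smulRight_apply,
      hLke, hPe, hLte, parallelCovector_self, sub_self, zero_apply, map_zero, add_zero,
      vertPartDeriv, naturalVertPart, ← localEnergy.eq_def, ContinuousLinearMap.coe_snd',
      ContinuousLinearMap.add_comp, ContinuousLinearMap.smul_comp, mul_zero, smul_zero, zero_smul,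
      smul_eq_mul, zero_add]
    rw [hσ]
    module

/-- The derivative of `J θ^V` in coordinates, for `θ` parallel at the base point. The derivative of
the Christoffel symbols enters through the horizontal lift. -/
lemma exists_hasFDerivAt_localJ_parallel (hU : IsLocalMetric h U) (hz : z.1 ∈ U)
    (A : NaturalTensorCoeffs) (θ : E →L[ℝ] ℝ) :
    ∃ L : (E × (E →L[ℝ] ℝ)) →L[ℝ] (E × (E →L[ℝ] ℝ)),
      HasFDerivAt (fun w => localJ A h w (0, parallelCovector h z θ w)) L z ∧
      ∀ ζ, (L ζ).1 = horPartDeriv A (h z.1) z.2 θ (localVert h z ζ)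
          - localChristoffel h z.1 ζ.1 (naturalHorPart A (h z.1) z.2 0 θ) ∧
        (L ζ).2 = vertPartDeriv A (h z.1) z.2 θ (localVert h z ζ)
          + (naturalVertPart A (h z.1) z.2 0 θ).comp (localChristoffel h z.1 ζ.1)
          + (ζ.2.comp (localChristoffel h z.1 (naturalHorPart A (h z.1) z.2 0 θ))
            + z.2.comp (fderiv ℝ (localChristoffel h) z.1 ζ.1 (naturalHorPart A (h z.1) z.2 0 θ)
              + localChristoffel h z.1 (L ζ).1)) := by
  obtain ⟨Lb, hLb, hLbe⟩ := hU.exists_hasFDerivAt_horPart hz A θ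
  obtain ⟨La, hLa, hLae⟩ := hU.exists_hasFDerivAt_vertPart hz A θ
  have hΓ := ((hU.differentiableAt_christoffel hz).hasFDerivAt.comp z hasFDerivAt_fst).clm_apply hLb
  have main := hLb.prodMk (hLa.add ((hasFDerivAt_snd (𝕜 := ℝ) (p := z)).clm_comp hΓ))
  refine ⟨_, main.congr_of_eventuallyEq (.of_forall fun w => ?_), fun ζ => ?_⟩
  · exact localJ_vertical A h w _
  · have h1 : Lb ζ = _ := hLbe ζ
    refine ⟨h1, ?_⟩
    simp only [ContinuousLinearMap.prod_apply, add_apply, hLae, parallelCovector_self,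
      ContinuousLinearMap.comp_apply, ContinuousLinearMap.flip_apply, Function.comp_apply,
      ContinuousLinearMap.compL_apply, ContinuousLinearMap.coe_fst', ContinuousLinearMap.coe_snd']
    abel_nf

end IsLocalMetric

end NijenhuisComputation

/-! ### The Nijenhuis tensor on vertical vectors -/

noncomputable section NijenhuisVertical

variable {E : Type*} [NormedAddCommGroup E] [NormedSpace ℝ E] [FiniteDimensional ℝ E]
  {h : E → E →L[ℝ] E →L[ℝ] ℝ} {U : Set E} {z : E × (E →L[ℝ] ℝ)}

/-- The coefficient of the horizontal part of `N_J` on vertical vectors at energy density `t`. -/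
def NaturalTensorCoeffs.horObstruction (A : NaturalTensorCoeffs) (t : ℝ) : ℝ :=
  A.a₂ t * derivIci A.a₃ t - 2 * A.a₃ t * derivIci A.a₂ t - 2 * t * derivIci A.a₂ t * A.b₃ t
    + 2 * A.a₃ t * A.b₂ t - A.a₂ t * A.b₃ t

/-- The coefficient of the curvature-free vertical part of `N_J` on vertical vectors at energy
density `t`. -/
def NaturalTensorCoeffs.vertObstruction (A : NaturalTensorCoeffs) (t : ℝ) : ℝ :=
  2 * t * A.b₃ t * derivIci A.a₃ t + A.a₁ t * (derivIci A.a₂ t - A.b₂ t)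

/-- The bracket of `J θ^V` and `η^V`, for `θ` and `η` parallel at the base point: all Christoffel
terms cancel except those of the horizontal lift. The linear map `L` is the derivative of `J θ^V`.
-/
lemma bracket_localJ_vertical (A : NaturalTensorCoeffs) {θ η : E →L[ℝ] ℝ}
    {L : (E × (E →L[ℝ] ℝ)) →L[ℝ] (E × (E →L[ℝ] ℝ))}
    (hL : ∀ ζ, (L ζ).1 = horPartDeriv A (h z.1) z.2 θ (localVert h z ζ)
          - localChristoffel h z.1 ζ.1 (naturalHorPart A (h z.1) z.2 0 θ) ∧
        (L ζ).2 = vertPartDeriv A (h z.1) z.2 θ (localVert h z ζ)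
          + (naturalVertPart A (h z.1) z.2 0 θ).comp (localChristoffel h z.1 ζ.1)
          + (ζ.2.comp (localChristoffel h z.1 (naturalHorPart A (h z.1) z.2 0 θ))
            + z.2.comp (fderiv ℝ (localChristoffel h) z.1 ζ.1 (naturalHorPart A (h z.1) z.2 0 θ)
              + localChristoffel h z.1 (L ζ).1))) :
    ((0, η.comp (localChristoffel h z.1 (localJ A h z (0, θ)).1)) : E × (E →L[ℝ] ℝ)) - L (0, η)
      = -localLift h z (horPartDeriv A (h z.1) z.2 θ η) (vertPartDeriv A (h z.1) z.2 θ η) := by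
  have h1 : (L (0, η)).1 = horPartDeriv A (h z.1) z.2 θ η := by
    rw [(hL _).1]; simp
  refine Prod.ext ?_ ?_
  · simp [h1, localLift]
  · rw [Prod.snd_sub, (hL _).2, h1, localJ_vertical]
    simp only [localLift, localVert_vertical, map_zero, zero_apply, ContinuousLinearMap.comp_zero,
      zero_add, add_zero, Prod.snd_neg]
    abel

namespace IsLocalMetric

/-- The Nijenhuis tensor on two vertical vectors: two terms free of curvature, horizontal and
vertical, and a vertical curvature term. -/
theorem nijenhuisTensor_localJ_vertical (hU : IsLocalMetric h U) (hz : z.1 ∈ U)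
    (A : NaturalTensorCoeffs) (hsq : ∀ ξ, localJ A h z (localJ A h z ξ) = -ξ)
    (ha₄ : A.a₄ (localEnergy h z) = -A.a₃ (localEnergy h z)) (θ η : E →L[ℝ] ℝ) :
    (nijenhuisTensor (localJ A h) z (0, θ) (0, η)).1 = A.horObstruction (localEnergy h z) •
        (z.2 ((h z.1).inverse θ) • (h z.1).inverse η
          - z.2 ((h z.1).inverse η) • (h z.1).inverse θ) ∧
    ∀ w, localVert h z (nijenhuisTensor (localJ A h) z (0, θ) (0, η)) w =
      A.vertObstruction (localEnergy h z) *
        (z.2 ((h z.1).inverse θ) * η w - z.2 ((h z.1).inverse η) * θ w)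
        + z.2 (localCurvature h z.1 (naturalHorPart A (h z.1) z.2 0 θ)
            (naturalHorPart A (h z.1) z.2 0 η) w) := by
  obtain ⟨P, hP, hPe⟩ := exists_hasFDerivAt_parallelCovector h z θ
  obtain ⟨Q, hQ, hQe⟩ := exists_hasFDerivAt_parallelCovector h z η
  obtain ⟨L, hL, hLe⟩ := hU.exists_hasFDerivAt_localJ_parallel hz A θ
  obtain ⟨M, hM, hMe⟩ := hU.exists_hasFDerivAt_localJ_parallel hz A η
  -- the bracket is tensorial, so it may be evaluated on the vertical lifts of the covector fields
  -- with values `θ`, `η` that are parallel at the base point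
  have hX := (hasFDerivAt_const (𝕜 := ℝ) (0 : E) z).prodMk hP
  have hY := (hasFDerivAt_const (𝕜 := ℝ) (0 : E) z).prodMk hQ
  have key := nijenhuisTensor_eq (hU.differentiableAt_localJ hz A) hsq hX.differentiableAt
    hY.differentiableAt
  simp only [VectorField.lieBracket, hX.fderiv, hY.fderiv, hL.fderiv, hM.fderiv,
    parallelCovector_self, ContinuousLinearMap.prod_apply, hPe, hQe, zero_apply, map_zero,
    ContinuousLinearMap.comp_zero] at key
  rw [bracket_localJ_vertical A hLe,
    ← neg_sub ((0, θ.comp _) : E × (E →L[ℝ] ℝ)), bracket_localJ_vertical A hMe, neg_neg, map_neg,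
    localJ_localLift, localJ_localLift, sub_neg_eq_add, sub_self, sub_zero] at key
  have hβ := hU.christoffel_symm hz (naturalHorPart A (h z.1) z.2 0 θ)
    (naturalHorPart A (h z.1) z.2 0 η)
  have hB := hU.inner _ hz
  have hps : z.2 ((h z.1).inverse z.2) = 2 * localEnergy h z := by simp [localEnergy]
  have ht : 1 / 2 * (2 * localEnergy h z) = localEnergy h z := by ring
  have hθs := hB.inverse_symm θ z.2
  have hηs := hB.inverse_symm η z.2
  have hηθ := hB.inverse_symm η θ
  constructor
  · rw [← key]
    simp only [localJ_vertical, Prod.fst_sub, (hLe _).1, (hMe _).1, localVert_localLift,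
      Prod.fst_add]
    simp only [localLift, hβ]
    generalize localChristoffel h z.1 _ _ = Γ
    simp only [horPartDeriv, vertPartDeriv, naturalHorPart, naturalVertPart, hps, ht, ha₄, map_add,
      map_sub, map_smul, map_zero, add_apply, smul_apply, zero_apply, smul_eq_mul, hθs, hηs, hηθ,
      NaturalTensorCoeffs.horObstruction]
    module
  · intro w
    -- the derivative of the Christoffel symbols enters through the horizontal lift;
    -- antisymmetrized, it is the leading part of the curvature
    have lift2 : ∀ (F : (E × (E →L[ℝ] ℝ)) →L[ℝ] (E × (E →L[ℝ] ℝ))) (ψ χ : E →L[ℝ] ℝ),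
        (∀ ζ, (F ζ).2 = vertPartDeriv A (h z.1) z.2 ψ (localVert h z ζ)
          + (naturalVertPart A (h z.1) z.2 0 ψ).comp (localChristoffel h z.1 ζ.1)
          + (ζ.2.comp (localChristoffel h z.1 (naturalHorPart A (h z.1) z.2 0 ψ))
            + z.2.comp (fderiv ℝ (localChristoffel h) z.1 ζ.1 (naturalHorPart A (h z.1) z.2 0 ψ)
              + localChristoffel h z.1 (F ζ).1))) →
        localVert h z (F (localJ A h z (0, χ))) w
          = vertPartDeriv A (h z.1) z.2 ψ (naturalVertPart A (h z.1) z.2 0 χ) w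
          + naturalVertPart A (h z.1) z.2 0 ψ
              (localChristoffel h z.1 (naturalHorPart A (h z.1) z.2 0 χ) w)
          + naturalVertPart A (h z.1) z.2 0 χ
              (localChristoffel h z.1 (naturalHorPart A (h z.1) z.2 0 ψ) w)
          + z.2 (localChristoffel h z.1 (naturalHorPart A (h z.1) z.2 0 χ)
              (localChristoffel h z.1 (naturalHorPart A (h z.1) z.2 0 ψ) w))
          + z.2 (fderiv ℝ (localChristoffel h) z.1 (naturalHorPart A (h z.1) z.2 0 χ)
              (naturalHorPart A (h z.1) z.2 0 ψ) w) := by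
      intro F ψ χ hF
      rw [localVert, hF, localJ_vertical, localVert_localLift]
      simp only [localLift, sub_apply, add_apply, ContinuousLinearMap.comp_apply, map_add]
      ring
    rw [← key, hU.localCurvature_eq hz]
    simp only [localVert_sub, localVert_add, localVert_localLift, sub_apply, add_apply,
      lift2 M η θ fun ζ => (hMe ζ).2,
      lift2 L θ η fun ζ => (hLe ζ).2, map_add z.2, map_sub z.2]
    generalize hβθ : naturalHorPart A (h z.1) z.2 0 θ = βθ
    generalize hβη : naturalHorPart A (h z.1) z.2 0 η = βη
    generalize hαθ : naturalVertPart A (h z.1) z.2 0 θ = αθ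
    generalize hαη : naturalVertPart A (h z.1) z.2 0 η = αη
    -- the terms without Christoffel symbols
    have e1 : vertPartDeriv A (h z.1) z.2 η αθ w - vertPartDeriv A (h z.1) z.2 θ αη w
        + naturalVertPart A (h z.1) z.2 (horPartDeriv A (h z.1) z.2 θ η)
            (vertPartDeriv A (h z.1) z.2 θ η) w
        - naturalVertPart A (h z.1) z.2 (horPartDeriv A (h z.1) z.2 η θ)
            (vertPartDeriv A (h z.1) z.2 η θ) w
        = A.vertObstruction (localEnergy h z) *
        (z.2 ((h z.1).inverse θ) * η w - z.2 ((h z.1).inverse η) * θ w) := by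
      subst hαθ hαη
      simp only [horPartDeriv, vertPartDeriv, naturalVertPart, hps, ht, map_add, map_sub,
        map_smul, map_zero, add_apply, sub_apply, smul_apply, zero_apply, smul_eq_mul, hθs, hηs,
        hηθ, NaturalTensorCoeffs.vertObstruction, hB.apply_inverse]
      ring
    rw [← e1]
    ring

end IsLocalMetric

end NijenhuisVertical

/-! ### Nijenhuis tensor and exterior derivative in charts -/

noncomputable section ChartCalculus

open VectorField in
/-- The exterior derivative of a 2-form on a vector space, evaluated on vector fields. -/
lemma exteriorDeriv_vectorSpace {F : Type*} [NormedAddCommGroup F] [NormedSpace ℝ F]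
    {Ω : F → F →L[ℝ] F →L[ℝ] ℝ} {z : F} (hΩ : DifferentiableAt ℝ Ω z)
    (hanti : ∀ v w, Ω z v w = -Ω z w v) {X Y Z : F → F} (hX : DifferentiableAt ℝ X z)
    (hY : DifferentiableAt ℝ Y z) (hZ : DifferentiableAt ℝ Z z) :
    fderiv ℝ (fun w => Ω w (Y w) (Z w)) z (X z) - fderiv ℝ (fun w => Ω w (X w) (Z w)) z (Y z)
      + fderiv ℝ (fun w => Ω w (X w) (Y w)) z (Z z) - Ω z (lieBracket ℝ X Y z) (Z z)
      + Ω z (lieBracket ℝ X Z z) (Y z) - Ω z (lieBracket ℝ Y Z z) (X z)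
      = fderiv ℝ Ω z (X z) (Y z) (Z z) - fderiv ℝ Ω z (Y z) (X z) (Z z)
        + fderiv ℝ Ω z (Z z) (X z) (Y z) := by
  have hd : ∀ {A B : F → F}, DifferentiableAt ℝ A z → DifferentiableAt ℝ B z →
      fderiv ℝ (fun w => Ω w (A w) (B w)) z = _ := fun hA hB =>
    ((hΩ.hasFDerivAt.clm_apply hA.hasFDerivAt).clm_apply hB.hasFDerivAt).fderiv
  simp only [hd hY hZ, hd hX hZ, hd hX hY, lieBracket, add_apply, map_sub, sub_apply,
    ContinuousLinearMap.comp_apply, ContinuousLinearMap.flip_apply]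
  rw [hanti (Y z), hanti (X z) (fderiv ℝ Z z _), hanti (X z) (fderiv ℝ Y z _)]
  ring

variable {F : Type*} [NormedAddCommGroup F] [NormedSpace ℝ F]
  {H : Type*} [TopologicalSpace H] (I : ModelWithCorners ℝ F H)
  {N : Type*} [TopologicalSpace N] [ChartedSpace H N]

/-- Every tangent vector is the value of a local smooth vector field. -/
lemma exists_smoothVectorFieldOn [IsManifold I 1 N] [CompleteSpace F]
    [IsManifold I ∞ N] (p : N) (v : F) :
    ∃ U : Set N, IsOpen U ∧ p ∈ U ∧ ∃ X : (q : N) → TangentSpace I q,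
      SmoothVectorFieldOn I X U ∧ (X p : F) = v := by
  refine ⟨(chartAt H p).source, (chartAt H p).open_source, mem_chart_source H p,
    VectorField.mpullback I 𝓘(ℝ, F) (extChartAt I p) (fun _ => v), fun q hq => ?_, ?_⟩
  · refine (ContMDiffAt.mpullback_vectorField_preimage (n := ∞) (m := ∞) ?_
      (contMDiffAt_extChartAt' hq)
      (isInvertible_mfderiv_extChartAt (by rwa [extChartAt_source])) (by simp)).contMDiffWithinAt
    exact contMDiffWithinAt_vectorSpace_iff_contDiffWithinAt.2 contDiffAt_const
  · have h1 : ∀ T : F →L[ℝ] F, T = ContinuousLinearMap.id ℝ F → ∀ v, T.inverse v = v := by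
      rintro T rfl v
      rw [ContinuousLinearMap.inverse_id]
      rfl
    exact h1 _ (mfderiv_extChartAt_self (I := I) (x := p)) v

variable [I.Boundaryless]

/-- The derivative of the inverse of the chart around `p`, at the point `z` of its target; the
tangent spaces of `N` are identified with `F` by the preferred charts. -/
def chartDeriv (p : N) (z : F) : F →L[ℝ] F :=
  mfderiv 𝓘(ℝ, F) I (extChartAt I p).symm z

/-- The components of a vector field in the chart around `p`. -/
def readField (p : N) (X : (q : N) → TangentSpace I q) (z : F) : F :=
  (chartDeriv I p z).inverse (X ((extChartAt I p).symm z) : F)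

variable {I} in
lemma eventually_mem_target (p : N) :
    ∀ᶠ z in nhds (extChartAt I p p), z ∈ (extChartAt I p).target :=
  extChartAt_target_mem_nhds p

variable [IsManifold I 1 N]

variable {I} in
lemma mdifferentiableAt_extChartAt_symm {p : N} {z : F} (hz : z ∈ (extChartAt I p).target) :
    MDifferentiableAt 𝓘(ℝ, F) I (extChartAt I p).symm z := by
  have := mdifferentiableWithinAt_extChartAt_symm (I := I) hz
  rwa [I.range_eq_univ, mdifferentiableWithinAt_univ] at this

variable {I} in
lemma isInvertible_chartDeriv {p : N} {z : F} (hz : z ∈ (extChartAt I p).target) :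
    (chartDeriv I p z).IsInvertible := by
  have := isInvertible_mfderivWithin_extChartAt_symm (I := I) hz
  rwa [I.range_eq_univ, mfderivWithin_univ] at this

/-- The derivative of the inverse chart is the derivative of a transition map. -/
lemma chartDeriv_eq_fderiv {p : N} {z : F} (hz : z ∈ (extChartAt I p).target) :
    chartDeriv I p z
      = (fderiv ℝ (extChartAt I ((extChartAt I p).symm z) ∘ (extChartAt I p).symm) z :
        F →L[ℝ] F) := by
  rw [chartDeriv, (mdifferentiableAt_extChartAt_symm hz).mfderiv]
  simp [writtenInExtChartAt, fderivWithin_univ]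
  rfl

lemma chartDeriv_self (p : N) :
    chartDeriv I p (extChartAt I p p) = (ContinuousLinearMap.id ℝ F : F →L[ℝ] F) := by
  rw [chartDeriv_eq_fderiv I (mem_extChartAt_target p), extChartAt_to_inv]
  have : (extChartAt I p ∘ (extChartAt I p).symm) =ᶠ[nhds (extChartAt I p p)] id :=
    Filter.eventually_of_mem (extChartAt_target_mem_nhds p) fun z hz =>
      (extChartAt I p).right_inv hz
  rw [this.fderiv_eq, fderiv_id]

lemma readField_self (p : N) (X : (q : N) → TangentSpace I q) :
    readField I p X (extChartAt I p p) = (X p : F) := by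
  rw [readField, chartDeriv_self, ContinuousLinearMap.inverse_id]
  have h : ∀ q, q = p → (X q : F) = (X p : F) := by rintro q rfl; rfl
  exact h _ (extChartAt_to_inv p)

lemma mlieBracket_eq_readField (p : N) (X Y : (q : N) → TangentSpace I q) :
    (VectorField.mlieBracket I X Y p : F)
      = VectorField.lieBracket ℝ (readField I p X) (readField I p Y) (extChartAt I p p) := by
  have h1 : ∀ T : F →L[ℝ] F, T = ContinuousLinearMap.id ℝ F → ∀ v, T.inverse v = v := by
    rintro T rfl v
    rw [ContinuousLinearMap.inverse_id]
    rfl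
  refine (h1 _ (mfderiv_extChartAt_self (I := I) (x := p)) _).trans ?_
  simp only [I.range_eq_univ, Set.preimage_univ, Set.inter_univ,
    VectorField.mpullbackWithin_univ]
  exact congrFun (VectorField.lieBracketWithin_univ (V := readField I p X) (W := readField I p Y)) _

variable {I} in
lemma chartDeriv_readField {p : N} {z : F} (hz : z ∈ (extChartAt I p).target)
    (X : (q : N) → TangentSpace I q) :
    chartDeriv I p z (readField I p X z) = (X ((extChartAt I p).symm z) : F) :=
  (isInvertible_chartDeriv hz).self_apply_inverse _

variable {I} in
/-- The Nijenhuis bracket is computed by the Nijenhuis tensor in a chart. -/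
lemma nijenhuis_eq_nijenhuisTensor {J : (q : N) → TangentSpace I q →ₗ[ℝ] TangentSpace I q} {p : N}
    {J' : F → F →L[ℝ] F} (hJ' : DifferentiableAt ℝ J' (extChartAt I p p))
    (hJJ' : ∀ z ∈ (extChartAt I p).target, ∀ v : F,
      (J ((extChartAt I p).symm z) (chartDeriv I p z v) : F) = chartDeriv I p z (J' z v))
    (hsq : ∀ v, J' (extChartAt I p p) (J' (extChartAt I p p) v) = -v)
    {X Y : (q : N) → TangentSpace I q}
    (hX : DifferentiableAt ℝ (readField I p X) (extChartAt I p p))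
    (hY : DifferentiableAt ℝ (readField I p Y) (extChartAt I p p)) :
    (nijenhuis I J X Y p : F) = nijenhuisTensor J' (extChartAt I p p) (X p : F) (Y p : F) := by
  have hJX : ∀ X : (q : N) → TangentSpace I q,
      readField I p (fun q => J q (X q)) =ᶠ[nhds (extChartAt I p p)]
        fun z => J' z (readField I p X z) := by
    intro X
    filter_upwards [eventually_mem_target p] with z hz
    have h1 := hJJ' z hz (readField I p X z)
    rw [chartDeriv_readField hz] at h1
    exact (congrArg (chartDeriv I p z).inverse h1).trans
      ((isInvertible_chartDeriv hz).inverse_apply_self _)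
  have hJp : ∀ v : F, (J p v : F) = J' (extChartAt I p p) v := by
    intro v
    have h1 := hJJ' _ (mem_extChartAt_target p) v
    rw [chartDeriv_self] at h1
    have h : ∀ q, q = p → (J p v : F) = (J q v : F) := by rintro q rfl; rfl
    exact (h _ (extChartAt_to_inv p)).trans h1
  have h := nijenhuisTensor_eq hJ' hsq hX hY
  rw [readField_self, readField_self] at h
  rw [← h, ← (hJX X).lieBracket_vectorField_eq (hJX Y),
    ← (hJX X).lieBracket_vectorField_eq (Filter.EventuallyEq.refl _ (readField I p Y)),
    ← (Filter.EventuallyEq.refl _ (readField I p X)).lieBracket_vectorField_eq (hJX Y),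
    ← mlieBracket_eq_readField, ← mlieBracket_eq_readField, ← mlieBracket_eq_readField,
    ← mlieBracket_eq_readField]
  have gen : ∀ a b b' c c' d : F, b = b' → c = c' → a - b - c - d = a - b' - c' - d := by
    rintro a b _ c _ d rfl rfl
    rfl
  exact gen _ _ _ _ _ _ (hJp _) (hJp _)

variable {I} in
lemma differentiableAt_readField [CompleteSpace F] [IsManifold I ∞ N] {p : N}
    {X : (q : N) → TangentSpace I q} {U : Set N} (hU : IsOpen U) (hX : SmoothVectorFieldOn I X U)
    (hp : p ∈ U) : DifferentiableAt ℝ (readField I p X) (extChartAt I p p) := by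
  have h1 : ContMDiffAt I I.tangent 1 (fun p => (⟨p, X p⟩ : TangentBundle I N)) p :=
    ((hX p hp).contMDiffAt (hU.mem_nhds hp)).of_le (by simp)
  have h2 := VectorField.contMDiffWithinAt_mpullbackWithin_extChartAt_symm (n := 2)
    (h1.contMDiffWithinAt (s := Set.univ)) uniqueMDiffOn_univ (Set.mem_univ p)
    (by norm_num)
  have h3 := (contMDiffWithinAt_vectorSpace_iff_contDiffWithinAt.1 h2).differentiableWithinAt
    (by simp)
  have h4 := h3.differentiableAt
    (by simpa using extChartAt_target_mem_nhds (I := I) p)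
  rw [I.range_eq_univ, VectorField.mpullbackWithin_univ] at h4
  exact h4

variable {I} in
/-- The directional derivative of a function is computed in a chart. -/
lemma directionalDeriv_eq_fderiv {f : N → ℝ} {p : N} {f' : F → ℝ}
    (hf' : DifferentiableAt ℝ f' (extChartAt I p p))
    (hff' : ∀ᶠ z in nhds (extChartAt I p p), f ((extChartAt I p).symm z) = f' z)
    (v : TangentSpace I p) :
    directionalDeriv I f p v = fderiv ℝ f' (extChartAt I p p) (v : F) := by
  have h1 : DifferentiableAt ℝ (f ∘ (extChartAt I p).symm) (extChartAt I p p) :=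
    hf'.congr_of_eventuallyEq hff'
  have hm : MDifferentiableAt I 𝓘(ℝ, ℝ) f p := by
    have h2 := (h1.mdifferentiableAt).comp p
      (mdifferentiableAt_extChartAt (I := I) (mem_chart_source H p))
    refine h2.congr_of_eventuallyEq ?_
    filter_upwards [extChartAt_source_mem_nhds (I := I) p] with q hq
    exact congrArg f ((extChartAt I p).left_inv hq).symm
  rw [directionalDeriv, hm.mfderiv]
  simp only [writtenInExtChartAt, extChartAt_model_space_eq_id, PartialEquiv.refl_coe,
    Function.id_comp, I.range_eq_univ, fderivWithin_univ]
  exact congrArg (fun L : F →L[ℝ] ℝ => L v) (Filter.EventuallyEq.fderiv_eq hff')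

/-- Integrability is the vanishing of the Nijenhuis tensor in charts. -/
lemma isIntegrableStructure_iff [CompleteSpace F] [IsManifold I ∞ N]
    {J : (q : N) → TangentSpace I q →ₗ[ℝ] TangentSpace I q} {J' : N → F → F →L[ℝ] F}
    (hJ' : ∀ p, DifferentiableAt ℝ (J' p) (extChartAt I p p))
    (hJJ' : ∀ p, ∀ z ∈ (extChartAt I p).target, ∀ v : F,
      (J ((extChartAt I p).symm z) (chartDeriv I p z v) : F) = chartDeriv I p z (J' p z v))
    (hsq : ∀ p v, J' p (extChartAt I p p) (J' p (extChartAt I p p) v) = -v) :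
    IsIntegrableStructure I J ↔
      ∀ p (v w : F), nijenhuisTensor (J' p) (extChartAt I p p) v w = 0 := by
  constructor
  · intro h p v w
    obtain ⟨U, hU, hpU, X, hX, rfl⟩ := exists_smoothVectorFieldOn I p v
    obtain ⟨V, hV, hpV, Y, hY, rfl⟩ := exists_smoothVectorFieldOn I p w
    rw [← nijenhuis_eq_nijenhuisTensor (hJ' p) (hJJ' p) (hsq p)
      (differentiableAt_readField hU hX hpU) (differentiableAt_readField hV hY hpV)]
    exact h (U ∩ V) (hU.inter hV) X Y (hX.mono Set.inter_subset_left)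
      (hY.mono Set.inter_subset_right) p ⟨hpU, hpV⟩
  · intro h U hU X Y hX hY p hp
    exact (nijenhuis_eq_nijenhuisTensor (hJ' p) (hJJ' p) (hsq p)
      (differentiableAt_readField hU hX hp) (differentiableAt_readField hU hY hp)).trans (h p _ _)

variable {I} in
/-- The exterior derivative of a 2-form is computed by the derivative of its components. -/
lemma exteriorDerivTwoForm_eq {Φ : (q : N) → TangentSpace I q → TangentSpace I q → ℝ} {p : N}
    {Ω : F → F →L[ℝ] F →L[ℝ] ℝ} (hΩ : DifferentiableAt ℝ Ω (extChartAt I p p))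
    (hΦΩ : ∀ z ∈ (extChartAt I p).target, ∀ v w : F,
      Φ ((extChartAt I p).symm z) (chartDeriv I p z v) (chartDeriv I p z w) = Ω z v w)
    (hanti : ∀ v w, Ω (extChartAt I p p) v w = -Ω (extChartAt I p p) w v)
    {X Y Z : (q : N) → TangentSpace I q}
    (hX : DifferentiableAt ℝ (readField I p X) (extChartAt I p p))
    (hY : DifferentiableAt ℝ (readField I p Y) (extChartAt I p p))
    (hZ : DifferentiableAt ℝ (readField I p Z) (extChartAt I p p)) :
    exteriorDerivTwoForm I Φ X Y Z p
      = fderiv ℝ Ω (extChartAt I p p) (X p : F) (Y p : F) (Z p : F)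
        - fderiv ℝ Ω (extChartAt I p p) (Y p : F) (X p : F) (Z p : F)
        + fderiv ℝ Ω (extChartAt I p p) (Z p : F) (X p : F) (Y p : F) := by
  have hΦp : ∀ v w : F, Φ p v w = Ω (extChartAt I p p) v w := by
    intro v w
    have h1 := hΦΩ _ (mem_extChartAt_target p) v w
    rw [chartDeriv_self] at h1
    have h : ∀ q, q = p → Φ p v w = Φ q v w := by rintro q rfl; rfl
    exact (h _ (extChartAt_to_inv p)).trans h1
  have hd : ∀ {A B : (q : N) → TangentSpace I q},
      DifferentiableAt ℝ (readField I p A) (extChartAt I p p) →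
      DifferentiableAt ℝ (readField I p B) (extChartAt I p p) → ∀ C : (q : N) → TangentSpace I q,
      directionalDeriv I (fun q => Φ q (A q) (B q)) p (C p)
        = fderiv ℝ (fun z => Ω z (readField I p A z) (readField I p B z)) (extChartAt I p p)
            (readField I p C (extChartAt I p p)) := by
    intro A B hA hB C
    have h2 : ∀ᶠ z in nhds (extChartAt I p p), Φ ((extChartAt I p).symm z)
        (A ((extChartAt I p).symm z)) (B ((extChartAt I p).symm z))
        = Ω z (readField I p A z) (readField I p B z) := by
      filter_upwards [eventually_mem_target p] with z hz
      have h3 := hΦΩ z hz (readField I p A z) (readField I p B z)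
      rwa [chartDeriv_readField hz, chartDeriv_readField hz] at h3
    rw [readField_self]
    exact directionalDeriv_eq_fderiv ((hΩ.clm_apply hA).clm_apply hB) h2 (C p)
  have hΦb : ∀ A B C : (q : N) → TangentSpace I q, Φ p (VectorField.mlieBracket I A B p) (C p)
      = Ω (extChartAt I p p)
          (VectorField.lieBracket ℝ (readField I p A) (readField I p B) (extChartAt I p p))
          (readField I p C (extChartAt I p p)) := by
    intro A B C
    rw [← mlieBracket_eq_readField, readField_self]
    exact hΦp _ _
  rw [exteriorDerivTwoForm, hd hY hZ, hd hX hZ, hd hX hY, hΦb, hΦb, hΦb,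
    exteriorDeriv_vectorSpace hΩ hanti hX hY hZ]
  simp only [readField_self]

/-- Closedness is the vanishing of the exterior derivative in charts. -/
lemma isClosedTwoForm_iff [CompleteSpace F] [IsManifold I ∞ N]
    {Φ : (q : N) → TangentSpace I q → TangentSpace I q → ℝ} {Ω : N → F → F →L[ℝ] F →L[ℝ] ℝ}
    (hΩ : ∀ p, DifferentiableAt ℝ (Ω p) (extChartAt I p p))
    (hΦΩ : ∀ p, ∀ z ∈ (extChartAt I p).target, ∀ v w : F,
      Φ ((extChartAt I p).symm z) (chartDeriv I p z v) (chartDeriv I p z w) = Ω p z v w)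
    (hanti : ∀ p v w, Ω p (extChartAt I p p) v w = -Ω p (extChartAt I p p) w v) :
    IsClosedTwoForm I Φ ↔ ∀ p (u v w : F), fderiv ℝ (Ω p) (extChartAt I p p) u v w
      - fderiv ℝ (Ω p) (extChartAt I p p) v u w + fderiv ℝ (Ω p) (extChartAt I p p) w u v = 0 := by
  constructor
  · intro h p u v w
    obtain ⟨U, hU, hpU, X, hX, rfl⟩ := exists_smoothVectorFieldOn I p u
    obtain ⟨V, hV, hpV, Y, hY, rfl⟩ := exists_smoothVectorFieldOn I p v
    obtain ⟨W, hW, hpW, Z, hZ, rfl⟩ := exists_smoothVectorFieldOn I p w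
    rw [← exteriorDerivTwoForm_eq (hΩ p) (hΦΩ p) (hanti p) (differentiableAt_readField hU hX hpU)
      (differentiableAt_readField hV hY hpV) (differentiableAt_readField hW hZ hpW)]
    exact h (U ∩ (V ∩ W)) (hU.inter (hV.inter hW)) X Y Z (hX.mono Set.inter_subset_left)
      (hY.mono (Set.inter_subset_right.trans Set.inter_subset_left))
      (hZ.mono (Set.inter_subset_right.trans Set.inter_subset_right)) p ⟨hpU, hpV, hpW⟩
  · intro h U hU X Y Z hX hY hZ p hp
    rw [exteriorDerivTwoForm_eq (hΩ p) (hΦΩ p) (hanti p) (differentiableAt_readField hU hX hp)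
      (differentiableAt_readField hU hY hp) (differentiableAt_readField hU hZ hp)]
    exact h p _ _ _

end ChartCalculus

/-! ### The metric in charts -/

noncomputable section MetricInCharts

variable {E : Type*} [NormedAddCommGroup E] [NormedSpace ℝ E]

/-- Transformation law of the Christoffel symbols under a local isometry `ψ`: the symbols of `k`,
pulled back by this law, are symmetric and compatible with `h`, hence are the symbols of `h`. -/
lemma IsLocalMetric.christoffel_transform [FiniteDimensional ℝ E] {h k : E → E →L[ℝ] E →L[ℝ] ℝ}
    {U V : Set E} (hU : IsLocalMetric h U) (hV : IsLocalMetric k V) {y : E} (hy : y ∈ U) {ψ : E → E}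
    (hψ : ContDiffAt ℝ 2 ψ y) (hψy : ψ y ∈ V)
    (hiso : ∀ᶠ z in nhds y, ∀ a b, h z a b = k (ψ z) (fderiv ℝ ψ z a) (fderiv ℝ ψ z b)) (a b : E) :
    fderiv ℝ ψ y (localChristoffel h y a b)
      = localChristoffel k (ψ y) (fderiv ℝ ψ y a) (fderiv ℝ ψ y b)
        + fderiv ℝ (fderiv ℝ ψ) y a b := by
  have hinj : Function.Injective (fderiv ℝ ψ y : E →ₗ[ℝ] E) := by
    refine (injective_iff_map_eq_zero _).2 fun u hu => ?_
    by_contra hne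
    have h1 := (hU.inner y hy).pos u hne
    have hu' : fderiv ℝ ψ y u = 0 := hu
    rw [hiso.self_of_nhds, hu'] at h1
    simp at h1
  let e : E ≃ₗ[ℝ] E := LinearEquiv.ofInjectiveEndo _ hinj
  have he : ∀ v, fderiv ℝ ψ y (e.symm v) = v := fun v => e.apply_symm_apply v
  have hd2 : HasFDerivAt (fderiv ℝ ψ) (fderiv ℝ (fderiv ℝ ψ) y) y :=
    ((hψ.fderiv_right (m := 1) (by norm_num)).differentiableAt (by simp)).hasFDerivAt
  have hd1 : HasFDerivAt ψ (fderiv ℝ ψ y) y := (hψ.differentiableAt (by simp)).hasFDerivAt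
  have hsymm2 : ∀ a b, fderiv ℝ (fderiv ℝ ψ) y a b = fderiv ℝ (fderiv ℝ ψ) y b a := fun a b =>
    hψ.isSymmSndFDerivAt (by simp) a b
  -- the derivative of the isometry relation
  have hDh : ∀ u v w, fderiv ℝ h y u v w
      = fderiv ℝ k (ψ y) (fderiv ℝ ψ y u) (fderiv ℝ ψ y v) (fderiv ℝ ψ y w)
        + k (ψ y) (fderiv ℝ (fderiv ℝ ψ) y u v) (fderiv ℝ ψ y w)
        + k (ψ y) (fderiv ℝ ψ y v) (fderiv ℝ (fderiv ℝ ψ) y u w) := by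
    intro u v w
    have c1 := ((hU.differentiableAt hy).hasFDerivAt.clm_apply (hasFDerivAt_const v y)).clm_apply
      (hasFDerivAt_const w y)
    have c2 := ((((hV.differentiableAt hψy).hasFDerivAt.comp y hd1).clm_apply
      (hd2.clm_apply (hasFDerivAt_const v y))).clm_apply (hd2.clm_apply (hasFDerivAt_const w y)))
    have c3 := c2.congr_of_eventuallyEq (f₁ := fun z => h z v w) (hiso.mono fun z hz => hz v w)
    have := congrArg (fun L => L u) (c1.unique c3)
    simp at this
    linarith
  have hk := (hV.inner _ hψy).symm
  have key := hU.eq_christoffel hy (fun a b => e.symm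
    (localChristoffel k (ψ y) (fderiv ℝ ψ y a) (fderiv ℝ ψ y b) + fderiv ℝ (fderiv ℝ ψ) y a b))
    (fun u v => by simp only [hsymm2 u v, hV.christoffel_symm hψy (fderiv ℝ ψ y u)])
    (fun u v w => by
      rw [hDh, hiso.self_of_nhds, hiso.self_of_nhds, he, he, hV.fderiv_eq hψy]
      simp only [map_add, add_apply]
      ring) a b
  rw [key, he]

variable {M : Type*} [TopologicalSpace M] [ChartedSpace E M] [IsManifold 𝓘(ℝ, E) ∞ M]

/-- The metric as a bilinear form on `E`, which Mathlib identifies with the tangent space. -/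
def metricForm (g : SmoothMetric E M) (x : M) : E →L[ℝ] E →L[ℝ] ℝ := g.inner x

lemma isInnerForm_metricForm (g : SmoothMetric E M) (x : M) : IsInnerForm (metricForm g x) where
  symm := g.symm x
  pos := g.pos x

lemma metricInChart_apply (g : SmoothMetric E M) (x₀ : M) (y u v : E) :
    metricInChart g x₀ y u v = metricForm g ((extChartAt 𝓘(ℝ, E) x₀).symm y)
      (chartDeriv 𝓘(ℝ, E) x₀ y u) (chartDeriv 𝓘(ℝ, E) x₀ y v) := rfl

lemma metricInChart_self (g : SmoothMetric E M) (x : M) :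
    metricInChart g x (extChartAt 𝓘(ℝ, E) x x) = metricForm g x := by
  ext u v
  rw [metricInChart_apply, chartDeriv_self, extChartAt_to_inv]
  rfl

/-- The metric in a chart is the metric in the trivialization of the bundle of bilinear forms,
through which the smoothness of the metric is defined. -/
lemma metricInChart_eq_trivialization (g : SmoothMetric E M) {x₀ : M} {y : E}
    (hy : y ∈ (extChartAt 𝓘(ℝ, E) x₀).target) :
    metricInChart g x₀ y = (trivializationAt (E →L[ℝ] E →L[ℝ] ℝ)
      (fun x : M => TangentSpace 𝓘(ℝ, E) x →L[ℝ] TangentSpace 𝓘(ℝ, E) x →L[ℝ] ℝ) x₀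
      ⟨(extChartAt 𝓘(ℝ, E) x₀).symm y, g.inner _⟩).2 := by
  have hx : (extChartAt 𝓘(ℝ, E) x₀).symm y ∈ (chartAt E x₀).source := by
    rw [← extChartAt_source 𝓘(ℝ, E)]; exact (extChartAt 𝓘(ℝ, E) x₀).map_target hy
  have h1 : (Bundle.Trivialization.symmL ℝ (trivializationAt E (TangentSpace 𝓘(ℝ, E)) x₀)
      ((extChartAt 𝓘(ℝ, E) x₀).symm y) : E →L[ℝ] E) = chartDeriv 𝓘(ℝ, E) x₀ y := by
    have h := TangentBundle.symmL_trivializationAt (I := 𝓘(ℝ, E)) (x₀ := x₀) hx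
    simp only [modelWithCornersSelf_coe, Set.range_id, mfderivWithin_univ] at h
    have h2 : ∀ z, z = y → (mfderiv 𝓘(ℝ, E) 𝓘(ℝ, E) (extChartAt 𝓘(ℝ, E) x₀).symm z : E →L[ℝ] E)
        = chartDeriv 𝓘(ℝ, E) x₀ y := by rintro _ rfl; rfl
    exact h.trans (h2 _ ((extChartAt 𝓘(ℝ, E) x₀).right_inv hy))
  ext u v
  rw [metricInChart_apply, ← h1]
  simp only [hom_trivializationAt_apply, ContinuousLinearMap.inCoordinates,
    ContinuousLinearMap.comp_apply]
  rw [Bundle.Trivialization.continuousLinearMapAt_apply, Bundle.Trivialization.linearMapAt_apply,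
    if_pos (by simpa using hx), hom_trivializationAt_apply, ContinuousLinearMap.inCoordinates]
  exact (congrArg (fun L : ℝ →L[ℝ] ℝ => L (metricForm g ((extChartAt 𝓘(ℝ, E) x₀).symm y)
    (Bundle.Trivialization.symmL ℝ (trivializationAt E (TangentSpace 𝓘(ℝ, E)) x₀)
      ((extChartAt 𝓘(ℝ, E) x₀).symm y) u)
    (Bundle.Trivialization.symmL ℝ (trivializationAt E (TangentSpace 𝓘(ℝ, E)) x₀)
      ((extChartAt 𝓘(ℝ, E) x₀).symm y) v)))
    (Bundle.Trivial.continuousLinearMapAt_trivialization ℝ M ℝ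
      ((extChartAt 𝓘(ℝ, E) x₀).symm y))).symm

lemma contDiffOn_metricInChart (g : SmoothMetric E M) (x₀ : M) :
    ContDiffOn ℝ ∞ (metricInChart g x₀) (extChartAt 𝓘(ℝ, E) x₀).target := by
  intro y hy
  have hx : (extChartAt 𝓘(ℝ, E) x₀).symm y ∈ (chartAt E x₀).source := by
    rw [← extChartAt_source 𝓘(ℝ, E)]; exact (extChartAt 𝓘(ℝ, E) x₀).map_target hy
  have h1 := (Bundle.Trivialization.contMDiffAt_section_iff
      (e := trivializationAt (E →L[ℝ] E →L[ℝ] ℝ)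
      (fun x : M => TangentSpace 𝓘(ℝ, E) x →L[ℝ] TangentSpace 𝓘(ℝ, E) x →L[ℝ] ℝ) x₀)
      (x₀ := (extChartAt 𝓘(ℝ, E) x₀).symm y)
      (by simpa using hx)).1 (g.contMDiff _)
  have h2 := h1.comp y ((contMDiffOn_extChartAt_symm (n := ∞) x₀).contMDiffAt
    ((isOpen_extChartAt_target x₀).mem_nhds hy))
  refine (ContDiffAt.congr_of_eventuallyEq h2.contDiffAt ?_).contDiffWithinAt
  filter_upwards [(isOpen_extChartAt_target x₀).mem_nhds hy] with z hz
  exact metricInChart_eq_trivialization g hz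

lemma isLocalMetric_metricInChart (g : SmoothMetric E M) (x₀ : M) :
    IsLocalMetric (metricInChart g x₀) (extChartAt 𝓘(ℝ, E) x₀).target where
  isOpen := isOpen_extChartAt_target x₀
  inner y hy :=
    { symm := fun u v => by
        rw [metricInChart_apply, metricInChart_apply, (isInnerForm_metricForm g _).symm]
      pos := fun u hu => by
        rw [metricInChart_apply]
        refine (isInnerForm_metricForm g _).pos _ fun h0 => hu ?_
        have := (isInvertible_chartDeriv (I := 𝓘(ℝ, E)) hy).inverse_apply_self u
        rw [← this, h0, map_zero] }
  contDiffOn := contDiffOn_metricInChart g x₀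

end MetricInCharts

/-! ### Transition maps of the cotangent bundle -/

noncomputable section Transition

section

variable {F : Type*} [NormedAddCommGroup F] [NormedSpace ℝ F]
  {H : Type*} [TopologicalSpace H] {I : ModelWithCorners ℝ F H}
  {N : Type*} [TopologicalSpace N] [ChartedSpace H N]

/-- The transition map from the chart around `p` to the chart around `q`. -/
def chartTransition (I : ModelWithCorners ℝ F H) (p q : N) : F → F :=
  extChartAt I q ∘ (extChartAt I p).symm

variable [I.Boundaryless] {p q : N} {w : F}

lemma eventually_mem_source (hw : w ∈ (extChartAt I p).target)
    (hq : (extChartAt I p).symm w ∈ (extChartAt I q).source) :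
    ∀ᶠ v in nhds w, v ∈ (extChartAt I p).target ∧
      (extChartAt I p).symm v ∈ (extChartAt I q).source :=
  Filter.Eventually.and ((isOpen_extChartAt_target p).mem_nhds hw)
    ((continuousAt_extChartAt_symm'' hw).preimage_mem_nhds
      ((isOpen_extChartAt_source q).mem_nhds hq))

variable [IsManifold I ∞ N]

lemma contDiffAt_chartTransition (hw : w ∈ (extChartAt I p).target)
    (hq : (extChartAt I p).symm w ∈ (extChartAt I q).source) :
    ContDiffAt ℝ ∞ (chartTransition I p q) w := by
  have h1 := contDiffWithinAt_ext_coord_change (I := I) (n := ∞) q p (y := w)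
    (by simpa [PartialEquiv.trans_source] using ⟨by simpa using hw, by simpa using hq⟩)
  rwa [I.range_eq_univ, contDiffWithinAt_univ] at h1

lemma chartDeriv_comp (hw : w ∈ (extChartAt I p).target)
    (hq : (extChartAt I p).symm w ∈ (extChartAt I q).source) :
    chartDeriv I p w = (chartDeriv I q (chartTransition I p q w)).comp
      (fderiv ℝ (chartTransition I p q) w) := by
  have : IsManifold I 1 N := IsManifold.of_le (n := ∞) (by simp)
  have hd := ((contDiffAt_chartTransition hw hq).differentiableAt (by simp)).mdifferentiableAt
  have h1 := mdifferentiableAt_extChartAt_symm (I := I) ((extChartAt I q).map_source hq)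
  have h2 := mfderiv_comp w h1 hd
  rw [mfderiv_eq_fderiv] at h2
  refine Eq.trans ?_ h2
  refine Filter.EventuallyEq.mfderiv_eq ?_
  filter_upwards [eventually_mem_source hw hq] with v hv
  exact ((extChartAt I q).left_inv hv.2).symm

end

variable {E : Type*} [NormedAddCommGroup E] [NormedSpace ℝ E]
variable {M : Type*} [TopologicalSpace M] [ChartedSpace E M] [IsManifold 𝓘(ℝ, E) ∞ M]

lemma mem_extChartAt_source_cotangentBundle (p q : CotangentBundle E M) :
    q ∈ (extChartAt (cotangentModel E) p).source
      ↔ q.proj ∈ (extChartAt 𝓘(ℝ, E) p.proj).source := by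
  rw [FiberBundle.extChartAt]
  simp +contextual

lemma mem_extChartAt_target_cotangentBundle (p : CotangentBundle E M) (z : E × (E →L[ℝ] ℝ)) :
    z ∈ (extChartAt (cotangentModel E) p).target
      ↔ z.1 ∈ (extChartAt 𝓘(ℝ, E) p.proj).target := by
  rw [FiberBundle.extChartAt]
  simp
  intro h
  exact (chartAt E p.proj).map_target h

/-- The covector `p` as a linear form on `E`. -/
def covector (p : CotangentBundle E M) : E →L[ℝ] ℝ := p.snd

/-- In induced charts, the base point and the components of a covector. -/
lemma extChartAt_cotangentBundle_eq (p q : CotangentBundle E M)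
    (hq : q.proj ∈ (extChartAt 𝓘(ℝ, E) p.proj).source) :
    extChartAt (cotangentModel E) p q = (extChartAt 𝓘(ℝ, E) p.proj q.proj,
      (covector q).comp (chartDeriv 𝓘(ℝ, E) p.proj (extChartAt 𝓘(ℝ, E) p.proj q.proj))) :=
  extChartAt_cotangentBundle p q (by rwa [extChartAt_source] at hq)

/-- The point of `T*M` with coordinates `z` in the chart around `p`. -/
lemma cotangentBundle_symm (p : CotangentBundle E M) {z : E × (E →L[ℝ] ℝ)}
    (hz : z ∈ (extChartAt (cotangentModel E) p).target) :
    ((extChartAt (cotangentModel E) p).symm z).proj = (extChartAt 𝓘(ℝ, E) p.proj).symm z.1 ∧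
      (covector ((extChartAt (cotangentModel E) p).symm z)).comp
        (chartDeriv 𝓘(ℝ, E) p.proj z.1) = z.2 := by
  have h1 := (mem_extChartAt_source_cotangentBundle _ _).1
    ((extChartAt (cotangentModel E) p).map_target hz)
  have h2 := extChartAt_cotangentBundle_eq p _ h1
  rw [(extChartAt (cotangentModel E) p).right_inv hz] at h2
  have h3 := congrArg Prod.fst h2
  have h4 := congrArg Prod.snd h2
  simp only at h3 h4
  rw [← h3] at h4
  exact ⟨by rw [h3, (extChartAt 𝓘(ℝ, E) p.proj).left_inv h1], h4.symm⟩

/-- Transition maps of `T*M`: covectors are pulled back. -/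
lemma chartTransition_cotangentBundle (p : CotangentBundle E M) {z : E × (E →L[ℝ] ℝ)}
    (hz : z ∈ (extChartAt (cotangentModel E) p).target) (q : CotangentBundle E M)
    (hq : (extChartAt 𝓘(ℝ, E) p.proj).symm z.1 ∈ (extChartAt 𝓘(ℝ, E) q.proj).source) :
    chartTransition (cotangentModel E) p q z = (chartTransition 𝓘(ℝ, E) p.proj q.proj z.1,
      z.2.comp (fderiv ℝ (chartTransition 𝓘(ℝ, E) q.proj p.proj)
        (chartTransition 𝓘(ℝ, E) p.proj q.proj z.1))) := by
  obtain ⟨h1, h2⟩ := cotangentBundle_symm p hz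
  have hz1 := (mem_extChartAt_target_cotangentBundle p z).1 hz
  have h3 : chartTransition (cotangentModel E) p q z = _ :=
    extChartAt_cotangentBundle_eq q ((extChartAt (cotangentModel E) p).symm z) (by rwa [h1])
  rw [h3, h1]
  refine Prod.ext rfl ?_
  have h4 := chartDeriv_comp (I := 𝓘(ℝ, E)) (p := q.proj) (q := p.proj)
    (w := chartTransition 𝓘(ℝ, E) p.proj q.proj z.1) ((extChartAt 𝓘(ℝ, E) q.proj).map_source hq)
    (by
      rw [chartTransition, Function.comp_apply, (extChartAt 𝓘(ℝ, E) q.proj).left_inv hq]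
      exact (extChartAt 𝓘(ℝ, E) p.proj).map_target hz1)
  have h5 : chartTransition 𝓘(ℝ, E) q.proj p.proj (chartTransition 𝓘(ℝ, E) p.proj q.proj z.1)
      = z.1 := by
    rw [chartTransition, chartTransition, Function.comp_apply, Function.comp_apply,
      (extChartAt 𝓘(ℝ, E) q.proj).left_inv hq, (extChartAt 𝓘(ℝ, E) p.proj).right_inv hz1]
  rw [h5] at h4
  change (covector _).comp (chartDeriv 𝓘(ℝ, E) q.proj
    (chartTransition 𝓘(ℝ, E) p.proj q.proj z.1)) = _
  rw [h4, ← ContinuousLinearMap.comp_assoc, h2]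

/-- Transition maps of `M` are isometries. -/
lemma metricInChart_chartTransition (g : SmoothMetric E M) {x x' : M} {w : E}
    (hw : w ∈ (extChartAt 𝓘(ℝ, E) x).target)
    (hx : (extChartAt 𝓘(ℝ, E) x).symm w ∈ (extChartAt 𝓘(ℝ, E) x').source) (a b : E) :
    metricInChart g x w a b = metricInChart g x' (chartTransition 𝓘(ℝ, E) x x' w)
      (fderiv ℝ (chartTransition 𝓘(ℝ, E) x x') w a)
      (fderiv ℝ (chartTransition 𝓘(ℝ, E) x x') w b) := by
  rw [metricInChart_apply, metricInChart_apply, chartDeriv_comp hw hx]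
  simp only [ContinuousLinearMap.comp_apply]
  rw [chartTransition, Function.comp_apply, (extChartAt 𝓘(ℝ, E) x').left_inv hx]

/-- The horizontal component of a tangent vector of `T*M` given in a chart. -/
def chartBase (p : CotangentBundle E M) (z ζ : E × (E →L[ℝ] ℝ)) : E :=
  (chartDeriv (cotangentModel E) p z ζ).1

/-- The vertical component, as a form on `E`, of a tangent vector of `T*M` given in a chart. -/
def chartVert (g : SmoothMetric E M) (p : CotangentBundle E M) (z ζ : E × (E →L[ℝ] ℝ)) :
    E →L[ℝ] ℝ :=
  verticalPart g ((extChartAt (cotangentModel E) p).symm z) (chartDeriv (cotangentModel E) p z ζ)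

/-- The derivative of the inverse of the chart around `p`. The second derivative of the transition
map of `M` enters because covectors are pulled back by its derivative. -/
lemma chartDeriv_cotangentBundle (p : CotangentBundle E M) {z : E × (E →L[ℝ] ℝ)}
    (hz : z ∈ (extChartAt (cotangentModel E) p).target) (ζ : E × (E →L[ℝ] ℝ)) {x : M}
    (hx : x = ((extChartAt (cotangentModel E) p).symm z).proj) :
    chartDeriv (cotangentModel E) p z ζ = (chartDeriv 𝓘(ℝ, E) p.proj z.1 ζ.1,
      ζ.2.comp (fderiv ℝ (chartTransition 𝓘(ℝ, E) x p.proj) (extChartAt 𝓘(ℝ, E) x x))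
        + z.2.comp (fderiv ℝ (fderiv ℝ (chartTransition 𝓘(ℝ, E) x p.proj))
          (extChartAt 𝓘(ℝ, E) x x) (chartDeriv 𝓘(ℝ, E) p.proj z.1 ζ.1))) := by
  have i1 : IsManifold 𝓘(ℝ, E) 1 M := IsManifold.of_le (n := ∞) (by simp)
  have i2 : IsManifold (cotangentModel E) 1 (CotangentBundle E M) :=
    IsManifold.of_le (n := ∞) (by simp)
  obtain ⟨h1, h2⟩ := cotangentBundle_symm p hz
  have hz1 := (mem_extChartAt_target_cotangentBundle p z).1 hz
  have hx' : (extChartAt 𝓘(ℝ, E) p.proj).symm z.1 = x := by rw [hx, h1]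
  have hxs : (extChartAt 𝓘(ℝ, E) p.proj).symm z.1 ∈ (extChartAt 𝓘(ℝ, E) x).source := by
    rw [hx']; exact mem_extChartAt_source x
  have hxs' : x ∈ (extChartAt 𝓘(ℝ, E) p.proj).source := by
    rw [← hx']; exact (extChartAt 𝓘(ℝ, E) p.proj).map_target hz1
  have hFy : chartTransition 𝓘(ℝ, E) p.proj x z.1 = extChartAt 𝓘(ℝ, E) x x := by
    rw [chartTransition, Function.comp_apply, hx']
  have hF : HasFDerivAt (chartTransition 𝓘(ℝ, E) p.proj x) (chartDeriv 𝓘(ℝ, E) p.proj z.1) z.1 := by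
    rw [chartDeriv_eq_fderiv _ hz1, hx']
    exact ((contDiffAt_chartTransition hz1 hxs).differentiableAt (by simp)).hasFDerivAt
  have hH : ContDiffAt ℝ ∞ (chartTransition 𝓘(ℝ, E) x p.proj) (extChartAt 𝓘(ℝ, E) x x) :=
    contDiffAt_chartTransition (mem_extChartAt_target x) (by rwa [extChartAt_to_inv])
  have hH' : HasFDerivAt (fderiv ℝ (chartTransition 𝓘(ℝ, E) x p.proj))
      (fderiv ℝ (fderiv ℝ (chartTransition 𝓘(ℝ, E) x p.proj)) (extChartAt 𝓘(ℝ, E) x x))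
      (chartTransition 𝓘(ℝ, E) p.proj x z.1) := by
    rw [hFy]
    exact ((hH.fderiv_right (m := 1) (by norm_cast)).differentiableAt (by simp)).hasFDerivAt
  have hfst : HasFDerivAt (fun w : E × (E →L[ℝ] ℝ) => chartTransition 𝓘(ℝ, E) p.proj x w.1)
      ((chartDeriv 𝓘(ℝ, E) p.proj z.1).comp (ContinuousLinearMap.fst ℝ E (E →L[ℝ] ℝ))) z :=
    hF.comp z hasFDerivAt_fst
  have hsnd := (hasFDerivAt_snd (𝕜 := ℝ) (p := z)).clm_comp (HasFDerivAt.comp z hH' hfst)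
  have hΨ := (hfst.prodMk hsnd).congr_of_eventuallyEq
    (f₁ := chartTransition (cotangentModel E) p ((extChartAt (cotangentModel E) p).symm z)) (by
      filter_upwards [(isOpen_extChartAt_target p).mem_nhds hz,
        continuous_fst.continuousAt.eventually (eventually_mem_source hz1 hxs)] with w hw hw'
      rw [chartTransition_cotangentBundle p hw _ (by rw [← hx]; exact hw'.2), ← hx]
      rfl)
  have h3 : chartDeriv (cotangentModel E) p z = _ :=
    (chartDeriv_eq_fderiv (cotangentModel E) hz).trans hΨ.fderiv
  rw [h3]
  refine Prod.ext rfl ?_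
  change z.2.comp _ + ζ.2.comp (fderiv ℝ (chartTransition 𝓘(ℝ, E) x p.proj)
    (chartTransition 𝓘(ℝ, E) p.proj x z.1)) = _
  rw [hFy, add_comm]
  rfl

/-- The horizontal component in a chart. -/
lemma chartBase_eq (p : CotangentBundle E M) {z : E × (E →L[ℝ] ℝ)}
    (hz : z ∈ (extChartAt (cotangentModel E) p).target) (ζ : E × (E →L[ℝ] ℝ)) :
    chartBase p z ζ = chartDeriv 𝓘(ℝ, E) p.proj z.1 ζ.1 :=
  congrArg Prod.fst (chartDeriv_cotangentBundle p hz ζ rfl)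

variable [FiniteDimensional ℝ E]

/-- The vertical component is a tensor: in every chart it is computed by the Christoffel symbols of
that chart. -/
lemma chartVert_comp (g : SmoothMetric E M) (p : CotangentBundle E M) {z : E × (E →L[ℝ] ℝ)}
    (hz : z ∈ (extChartAt (cotangentModel E) p).target) (ζ : E × (E →L[ℝ] ℝ)) :
    (chartVert g p z ζ).comp (chartDeriv 𝓘(ℝ, E) p.proj z.1)
      = localVert (metricInChart g p.proj) z ζ := by
  have i1 : IsManifold 𝓘(ℝ, E) 1 M := IsManifold.of_le (n := ∞) (by simp)
  obtain ⟨h1, h2⟩ := cotangentBundle_symm p hz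
  have hz1 := (mem_extChartAt_target_cotangentBundle p z).1 hz
  obtain ⟨q, hq⟩ : ∃ q, q = (extChartAt (cotangentModel E) p).symm z := ⟨_, rfl⟩
  obtain ⟨x, hx⟩ : ∃ x, x = q.proj := ⟨_, rfl⟩
  have hx' : (extChartAt 𝓘(ℝ, E) p.proj).symm z.1 = x := by rw [hx, hq, h1]
  have hxs : (extChartAt 𝓘(ℝ, E) p.proj).symm z.1 ∈ (extChartAt 𝓘(ℝ, E) x).source := by
    rw [hx']; exact mem_extChartAt_source x
  have hxs' : (extChartAt 𝓘(ℝ, E) x).symm (extChartAt 𝓘(ℝ, E) x x)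
      ∈ (extChartAt 𝓘(ℝ, E) p.proj).source := by
    rw [extChartAt_to_inv, ← hx']; exact (extChartAt 𝓘(ℝ, E) p.proj).map_target hz1
  have hHx : chartTransition 𝓘(ℝ, E) x p.proj (extChartAt 𝓘(ℝ, E) x x) = z.1 := by
    rw [chartTransition, Function.comp_apply, extChartAt_to_inv, ← hx',
      (extChartAt 𝓘(ℝ, E) p.proj).right_inv hz1]
  have hinv : (chartDeriv 𝓘(ℝ, E) p.proj z.1).comp
      (fderiv ℝ (chartTransition 𝓘(ℝ, E) x p.proj) (extChartAt 𝓘(ℝ, E) x x))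
        = ContinuousLinearMap.id ℝ E := by
    rw [← hHx, ← chartDeriv_comp (mem_extChartAt_target x) hxs', chartDeriv_self]
  have hinv' : ∀ u, fderiv ℝ (chartTransition 𝓘(ℝ, E) x p.proj) (extChartAt 𝓘(ℝ, E) x x)
      (chartDeriv 𝓘(ℝ, E) p.proj z.1 u) = u := by
    intro u
    have hi := (isInvertible_chartDeriv (I := 𝓘(ℝ, E)) hz1).inverse_apply_self
    exact (Function.LeftInverse.injective hi)
      (DFunLike.congr_fun hinv (chartDeriv 𝓘(ℝ, E) p.proj z.1 u))
  have hchr := (isLocalMetric_metricInChart g x).christoffel_transform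
    (isLocalMetric_metricInChart g p.proj) (mem_extChartAt_target x)
    (ψ := chartTransition 𝓘(ℝ, E) x p.proj)
    ((contDiffAt_chartTransition (mem_extChartAt_target x) hxs').of_le (by norm_cast))
    (by rw [hHx]; exact hz1)
    (by
      filter_upwards [eventually_mem_source (mem_extChartAt_target x) hxs'] with w hw a b
      exact metricInChart_chartTransition g hw.1 hw.2 a b)
    (chartDeriv 𝓘(ℝ, E) p.proj z.1 ζ.1)
  have hcov : covector q = z.2.comp
      (fderiv ℝ (chartTransition 𝓘(ℝ, E) x p.proj) (extChartAt 𝓘(ℝ, E) x x)) := by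
    rw [← h2, ContinuousLinearMap.comp_assoc, hinv, ContinuousLinearMap.comp_id, hq]
  have hv : chartVert g p z ζ = (chartDeriv (cotangentModel E) p z ζ).2
      - (covector q).comp (localChristoffel (metricInChart g x) (extChartAt 𝓘(ℝ, E) x x)
        (chartDeriv (cotangentModel E) p z ζ).1) := by
    subst hx hq
    rfl
  rw [hv, chartDeriv_cotangentBundle p hz ζ (hx.trans (congrArg _ hq)), hcov, localVert]
  ext u
  have h5 := hchr (chartDeriv 𝓘(ℝ, E) p.proj z.1 u)
  rw [hinv', hinv', hHx] at h5
  simp only [ContinuousLinearMap.comp_apply, sub_apply, add_apply, h5, hinv', map_add]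
  ring

end Transition

/-! ### Natural tensors in charts -/

noncomputable section NaturalityInCharts

section Isometry

variable {E : Type*} [NormedAddCommGroup E] [NormedSpace ℝ E] [FiniteDimensional ℝ E]
  {B B' : E →L[ℝ] E →L[ℝ] ℝ} {L : E →L[ℝ] E}

/-- Linear isometries commute with `♯`. -/
lemma IsInnerForm.map_inverse_comp (hB : IsInnerForm B) (hB' : IsInnerForm B')
    (hL : L.IsInvertible) (hiso : ∀ u v, B u v = B' (L u) (L v)) (θ : E →L[ℝ] ℝ) :
    L (B.inverse (θ.comp L)) = B'.inverse θ := by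
  have h1 : B' (L (B.inverse (θ.comp L))) = θ := by
    ext v
    have h2 : L (L.inverse v) = v := hL.self_apply_inverse v
    rw [← h2, ← hiso, hB.apply_inverse, ContinuousLinearMap.comp_apply]
  rw [← hB'.inverse_apply (L _), h1]

lemma naturalHorPart_isometry (hB : IsInnerForm B) (hB' : IsInnerForm B') (hL : L.IsInvertible)
    (hiso : ∀ u v, B u v = B' (L u) (L v)) (A : NaturalTensorCoeffs) (p : E →L[ℝ] ℝ) (u : E)
    (θ : E →L[ℝ] ℝ) :
    L (naturalHorPart A B (p.comp L) u (θ.comp L)) = naturalHorPart A B' p (L u) θ := by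
  simp only [naturalHorPart, map_add, map_sub, map_smul, ContinuousLinearMap.comp_apply,
    hB.map_inverse_comp hB' hL hiso]

lemma naturalVertPart_isometry (hB : IsInnerForm B) (hB' : IsInnerForm B') (hL : L.IsInvertible)
    (hiso : ∀ u v, B u v = B' (L u) (L v)) (A : NaturalTensorCoeffs) (p : E →L[ℝ] ℝ) (u : E)
    (θ : E →L[ℝ] ℝ) :
    naturalVertPart A B (p.comp L) u (θ.comp L) = (naturalVertPart A B' p (L u) θ).comp L := by
  ext v
  simp only [naturalVertPart, ContinuousLinearMap.comp_apply, add_apply, smul_apply,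
    hB.map_inverse_comp hB' hL hiso, hiso]

lemma naturalForm_isometry (hB : IsInnerForm B) (hB' : IsInnerForm B') (hL : L.IsInvertible)
    (hiso : ∀ u v, B u v = B' (L u) (L v)) (C : NaturalMetricCoeffs) (p : E →L[ℝ] ℝ) (u : E)
    (θ : E →L[ℝ] ℝ) (v : E) (ψ : E →L[ℝ] ℝ) :
    naturalForm C B (p.comp L) u (θ.comp L) v (ψ.comp L)
      = naturalForm C B' p (L u) θ (L v) ψ := by
  simp only [naturalForm, ContinuousLinearMap.comp_apply, hB.map_inverse_comp hB' hL hiso, hiso]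

end Isometry

variable {E : Type*} [NormedAddCommGroup E] [NormedSpace ℝ E]
variable {M : Type*} [TopologicalSpace M] [ChartedSpace E M] [IsManifold 𝓘(ℝ, E) ∞ M]

/-- `basePart` in terms of the model space. -/
def modelBase (q : CotangentBundle E M) (ξ : E × (E →L[ℝ] ℝ)) : E := basePart q ξ

/-- `verticalPart` in terms of the model space. -/
def modelVert (g : SmoothMetric E M) (q : CotangentBundle E M) (ξ : E × (E →L[ℝ] ℝ)) :
    E →L[ℝ] ℝ := verticalPart g q ξ

lemma modelVert_ext (g : SmoothMetric E M) (q : CotangentBundle E M) {ξ η : E × (E →L[ℝ] ℝ)}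
    (h1 : modelBase q ξ = modelBase q η) (h2 : modelVert g q ξ = modelVert g q η) : ξ = η := by
  have hξ := horizontalLift_add_verticalLift g q ξ
  have hη := horizontalLift_add_verticalLift g q η
  exact hξ.symm.trans ((congrArg₂ (fun a b => horizontalLift g q a + verticalLift q b) h1 h2).trans
    hη)

lemma modelBase_naturalJ (g : SmoothMetric E M) (A : NaturalTensorCoeffs) (q : CotangentBundle E M)
    (ξ : E × (E →L[ℝ] ℝ)) : modelBase q (naturalJ g A q ξ)
      = naturalHorPart A (metricForm g q.proj) (covector q) (modelBase q ξ) (modelVert g q ξ) := by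
  change basePart q (naturalJHor g A q (basePart q ξ) + naturalJVert g A q (verticalPart g q ξ)) = _
  simp only [naturalJHor, naturalJVert, map_add, map_sub, map_smul, basePart_horizontalLift,
    basePart_verticalLift, smul_zero, zero_add, add_zero, zero_sub]
  rw [← add_sub_assoc, ← sub_eq_add_neg]
  rfl

lemma modelVert_naturalJ (g : SmoothMetric E M) (A : NaturalTensorCoeffs) (q : CotangentBundle E M)
    (ξ : E × (E →L[ℝ] ℝ)) : modelVert g q (naturalJ g A q ξ)
      = naturalVertPart A (metricForm g q.proj) (covector q) (modelBase q ξ) (modelVert g q ξ) := by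
  change verticalPart g q
      (naturalJHor g A q (basePart q ξ) + naturalJVert g A q (verticalPart g q ξ)) = _
  simp only [naturalJHor, naturalJVert, map_add, map_sub, map_smul, verticalPart_horizontalLift,
    verticalPart_verticalLift, smul_zero, sub_zero, add_zero]
  rw [← add_assoc]
  rfl

lemma naturalMetric_eq_naturalForm (g : SmoothMetric E M) (C : NaturalMetricCoeffs)
    (q : CotangentBundle E M) (ξ η : E × (E →L[ℝ] ℝ)) : naturalMetric g C q ξ η
      = naturalForm C (metricForm g q.proj) (covector q) (modelBase q ξ) (modelVert g q ξ)
        (modelBase q η) (modelVert g q η) := rfl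

variable (g : SmoothMetric E M) (p : CotangentBundle E M) {z : E × (E →L[ℝ] ℝ)}

lemma metricInChart_isometry (hz : z ∈ (extChartAt (cotangentModel E) p).target) (u v : E) :
    metricInChart g p.proj z.1 u v
      = metricForm g ((extChartAt (cotangentModel E) p).symm z).proj
        (chartDeriv 𝓘(ℝ, E) p.proj z.1 u) (chartDeriv 𝓘(ℝ, E) p.proj z.1 v) := by
  rw [metricInChart_apply, (cotangentBundle_symm p hz).1]

variable [FiniteDimensional ℝ E]

/-- In the chart around `p` the tensor field `J` is `localJ`. -/
lemma naturalJ_chartDeriv (A : NaturalTensorCoeffs)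
    (hz : z ∈ (extChartAt (cotangentModel E) p).target) (ζ : E × (E →L[ℝ] ℝ)) :
    naturalJ g A ((extChartAt (cotangentModel E) p).symm z)
        (chartDeriv (cotangentModel E) p z ζ)
      = chartDeriv (cotangentModel E) p z (localJ A (metricInChart g p.proj) z ζ) := by
  have i1 : IsManifold 𝓘(ℝ, E) 1 M := IsManifold.of_le (n := ∞) (by simp)
  have hz1 := (mem_extChartAt_target_cotangentBundle p z).1 hz
  have hB := (isLocalMetric_metricInChart g p.proj).inner z.1 hz1
  have hL := isInvertible_chartDeriv (I := 𝓘(ℝ, E)) hz1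
  refine modelVert_ext g ((extChartAt (cotangentModel E) p).symm z) ?_ ?_
  · refine (modelBase_naturalJ g A _ _).trans ?_
    change naturalHorPart A _ _ (chartBase p z ζ) (chartVert g p z ζ)
      = chartBase p z (localJ A (metricInChart g p.proj) z ζ)
    rw [chartBase_eq p hz, chartBase_eq p hz,
      ← naturalHorPart_isometry hB (isInnerForm_metricForm g _) hL (metricInChart_isometry g p hz),
      (cotangentBundle_symm p hz).2, chartVert_comp g p hz, localJ_apply]
    rfl
  · refine (modelVert_naturalJ g A _ _).trans ?_
    change naturalVertPart A _ _ (chartBase p z ζ) (chartVert g p z ζ)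
      = chartVert g p z (localJ A (metricInChart g p.proj) z ζ)
    have h1 := chartVert_comp g p hz (localJ A (metricInChart g p.proj) z ζ)
    have h2 := naturalVertPart_isometry hB (isInnerForm_metricForm g _) hL
      (metricInChart_isometry g p hz) A (covector ((extChartAt (cotangentModel E) p).symm z)) ζ.1
      (chartVert g p z ζ)
    rw [(cotangentBundle_symm p hz).2, chartVert_comp g p hz, ← chartBase_eq p hz] at h2
    have hv : localVert (metricInChart g p.proj) z (localJ A (metricInChart g p.proj) z ζ)
        = naturalVertPart A (metricInChart g p.proj z.1) z.2 ζ.1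
          (localVert (metricInChart g p.proj) z ζ) := by
      rw [localJ_apply, localVert_localLift]
    rw [hv, h2] at h1
    ext v
    have h3 := DFunLike.congr_fun h1 ((chartDeriv 𝓘(ℝ, E) p.proj z.1).inverse v)
    simp only [ContinuousLinearMap.comp_apply, hL.self_apply_inverse] at h3
    exact h3.symm

/-- In the chart around `p` the metric `G` is `naturalForm`. -/
lemma naturalMetric_chartDeriv (C : NaturalMetricCoeffs)
    (hz : z ∈ (extChartAt (cotangentModel E) p).target) (ζ ζ' : E × (E →L[ℝ] ℝ)) :
    naturalMetric g C ((extChartAt (cotangentModel E) p).symm z)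
        (chartDeriv (cotangentModel E) p z ζ) (chartDeriv (cotangentModel E) p z ζ')
      = naturalForm C (metricInChart g p.proj z.1) z.2 ζ.1
        (localVert (metricInChart g p.proj) z ζ) ζ'.1
        (localVert (metricInChart g p.proj) z ζ') := by
  have i1 : IsManifold 𝓘(ℝ, E) 1 M := IsManifold.of_le (n := ∞) (by simp)
  have hz1 := (mem_extChartAt_target_cotangentBundle p z).1 hz
  have hB := (isLocalMetric_metricInChart g p.proj).inner z.1 hz1
  have hL := isInvertible_chartDeriv (I := 𝓘(ℝ, E)) hz1
  refine (naturalMetric_eq_naturalForm g C _ _ _).trans ?_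
  change naturalForm C _ _ (chartBase p z ζ) (chartVert g p z ζ) (chartBase p z ζ')
    (chartVert g p z ζ') = _
  rw [chartBase_eq p hz, chartBase_eq p hz,
    ← naturalForm_isometry hB (isInnerForm_metricForm g _) hL (metricInChart_isometry g p hz),
    (cotangentBundle_symm p hz).2, chartVert_comp g p hz, chartVert_comp g p hz]

/-- In the chart around `p` the relation `J² = -1` reads `localJ² = -1`. -/
lemma localJ_sq {A : NaturalTensorCoeffs} (hsq : ∀ (q : CotangentBundle E M)
      (ξ : CotangentTangent q), naturalJ g A q (naturalJ g A q ξ) = -ξ)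
    (hz : z ∈ (extChartAt (cotangentModel E) p).target) (ζ : E × (E →L[ℝ] ℝ)) :
    localJ A (metricInChart g p.proj) z (localJ A (metricInChart g p.proj) z ζ) = -ζ := by
  have i2 : IsManifold (cotangentModel E) 1 (CotangentBundle E M) :=
    IsManifold.of_le (n := ∞) (by simp)
  have h1 := naturalJ_chartDeriv g p A hz ζ
  have h2 := naturalJ_chartDeriv g p A hz (localJ A (metricInChart g p.proj) z ζ)
  have h3 : (chartDeriv (cotangentModel E) p z
      (localJ A (metricInChart g p.proj) z (localJ A (metricInChart g p.proj) z ζ)))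
      = -chartDeriv (cotangentModel E) p z ζ :=
    h2.symm.trans ((congrArg _ h1.symm).trans (hsq _ _))
  rw [← map_neg] at h3
  exact (Function.LeftInverse.injective
    (isInvertible_chartDeriv (I := cotangentModel E) hz).inverse_apply_self) h3

end NaturalityInCharts

/-! ### Algebra of almost Hermitian structures of natural lift type -/

noncomputable section HermitianAlgebra

/-- In an almost Hermitian plane with `J = (-a₃, -a₂; a₁, a₃)` the Gram matrix is proportional to
`(a₁, a₃; a₃, a₂)`. -/
lemma hermitian_plane {a₁ a₂ a₃ c₁ c₂ c₃ : ℝ} (ha : 0 < a₁) (hdet : a₁ * a₂ = 1 + a₃ ^ 2)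
    (h1 : a₃ ^ 2 * c₁ - 2 * a₃ * a₁ * c₃ + a₁ ^ 2 * c₂ = c₁)
    (h2 : a₃ * a₂ * c₁ - (a₃ ^ 2 + a₁ * a₂) * c₃ + a₁ * a₃ * c₂ = c₃) :
    c₁ * a₂ = c₂ * a₁ ∧ c₁ * a₃ = c₃ * a₁ := by
  have h3 : c₁ * a₃ = c₃ * a₁ := by
    linear_combination (-a₃ / 2) * h1 + a₁ / 2 * h2 + (a₃ * c₁ / 2 * (-1) + a₁ * c₃ / 2) * hdet
  refine ⟨mul_left_cancel₀ ha.ne' ?_, h3⟩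
  linear_combination c₁ * hdet - h1 - 2 * a₃ * (-h3)

variable {E : Type*} [NormedAddCommGroup E] [NormedSpace ℝ E]

/-- The conditions on an almost Hermitian structure at the covector `p`, for the inner product
`B`. -/
structure IsHermitianAt (A : NaturalTensorCoeffs) (C : NaturalMetricCoeffs)
    (B : E →L[ℝ] E →L[ℝ] ℝ) (p : E →L[ℝ] ℝ) : Prop where
  sq_hor : ∀ u θ, naturalHorPart A B p (naturalHorPart A B p u θ) (naturalVertPart A B p u θ) = -u
  sq_vert : ∀ u θ,
    naturalVertPart A B p (naturalHorPart A B p u θ) (naturalVertPart A B p u θ) = -θ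
  pos : ∀ u, u ≠ 0 → 0 < naturalForm C B p u 0 u 0
  hermitian : ∀ u θ v ψ, naturalForm C B p (naturalHorPart A B p u θ) (naturalVertPart A B p u θ)
    (naturalHorPart A B p v ψ) (naturalVertPart A B p v ψ) = naturalForm C B p u θ v ψ

/-- The relations between the coefficients of an almost Hermitian structure of natural lift type.
The radial ones say nothing at `t = 0`, where there is no radial direction. -/
structure HermitianRelations (A : NaturalTensorCoeffs) (C : NaturalMetricCoeffs) : Prop where
  a₄_eq : ∀ t, 0 ≤ t → A.a₄ t = -A.a₃ t
  det_eq : ∀ t, 0 ≤ t → A.a₁ t * A.a₂ t = 1 + A.a₃ t ^ 2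
  b₄_eq : ∀ t, 0 < t → A.b₄ t = -A.b₃ t
  radial_det_eq : ∀ t, 0 < t → (A.a₁ t + 2 * t * A.b₁ t) * (A.a₂ t + 2 * t * A.b₂ t)
    = 1 + (A.a₃ t + 2 * t * A.b₃ t) ^ 2
  gram : ∀ t, 0 ≤ t → 0 < C.c₁ t ∧ C.c₁ t * A.a₂ t = C.c₂ t * A.a₁ t ∧
    C.c₁ t * A.a₃ t = C.c₃ t * A.a₁ t
  radial_gram : ∀ t, 0 < t → 0 < C.c₁ t + 2 * t * C.d₁ t ∧
    (C.c₁ t + 2 * t * C.d₁ t) * (A.a₂ t + 2 * t * A.b₂ t)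
      = (C.c₂ t + 2 * t * C.d₂ t) * (A.a₁ t + 2 * t * A.b₁ t) ∧
    (C.c₁ t + 2 * t * C.d₁ t) * (A.a₃ t + 2 * t * A.b₃ t)
      = (C.c₃ t + 2 * t * C.d₃ t) * (A.a₁ t + 2 * t * A.b₁ t)

variable [FiniteDimensional ℝ E] {A : NaturalTensorCoeffs} {C : NaturalMetricCoeffs}
  {B : E →L[ℝ] E →L[ℝ] ℝ} {p : E →L[ℝ] ℝ}

/-- The relations on the plane of `v^H` and `(g_v)^V`, for `v` annihilated by `p`. -/
lemma IsHermitianAt.relations_ker (hB : IsInnerForm B) (h : IsHermitianAt A C B p) {v : E}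
    (hv : v ≠ 0) (hpv : p v = 0) {t : ℝ} (ht : t = 1 / 2 * p (B.inverse p)) (ha : 0 < A.a₁ t) :
    A.a₄ t = -A.a₃ t ∧ A.a₁ t * A.a₂ t = 1 + A.a₃ t ^ 2 ∧ 0 < C.c₁ t ∧
      C.c₁ t * A.a₂ t = C.c₂ t * A.a₁ t ∧ C.c₁ t * A.a₃ t = C.c₃ t * A.a₁ t := by
  have hBv := hB.pos v hv
  have hpi : p (B.inverse (B v)) = 0 := by rw [hB.inverse_apply, hpv]
  have hH : ∀ x y : ℝ, naturalHorPart A B p (x • v) (y • B v)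
      = (x * A.a₄ t - y * A.a₂ t) • v := by
    intro x y
    simp only [naturalHorPart, ← ht, map_smul, hB.inverse_apply, hpv, smul_eq_mul, mul_zero,
      zero_smul, add_zero, sub_zero]
    module
  have hV : ∀ x y : ℝ, naturalVertPart A B p (x • v) (y • B v)
      = (x * A.a₁ t + y * A.a₃ t) • B v := by
    intro x y
    simp only [naturalVertPart, ← ht, map_smul, hB.inverse_apply, hpv, smul_eq_mul, mul_zero,
      zero_smul, add_zero]
    module
  have hG : ∀ x y x' y' : ℝ, naturalForm C B p (x • v) (y • B v) (x' • v) (y' • B v)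
      = (C.c₁ t * (x * x') + C.c₂ t * (y * y') + C.c₃ t * (x * y' + x' * y)) * B v v := by
    intro x y x' y'
    simp only [naturalForm, ← ht, map_smul, smul_apply, hB.inverse_apply, hpv, smul_eq_mul,
      mul_zero, add_zero]
    ring
  have h1 := h.sq_hor ((1 : ℝ) • v) ((0 : ℝ) • B v)
  have h2 := h.sq_vert ((1 : ℝ) • v) ((0 : ℝ) • B v)
  have h3 := h.hermitian ((1 : ℝ) • v) ((0 : ℝ) • B v) ((1 : ℝ) • v) ((0 : ℝ) • B v)
  have h4 := h.hermitian ((1 : ℝ) • v) ((0 : ℝ) • B v) ((0 : ℝ) • v) ((1 : ℝ) • B v)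
  have h5 := h.pos v hv
  rw [hH, hV, hH] at h1
  rw [hH, hV, hV] at h2
  rw [hH, hV, hG, hG] at h3
  rw [hH, hV, hH, hV, hG, hG] at h4
  have h5' := hG 1 0 1 0
  rw [one_smul, zero_smul] at h5'
  rw [h5'] at h5
  have e1 : (A.a₄ t * A.a₄ t - A.a₁ t * A.a₂ t + 1) * B v v = 0 := by
    have := congrArg (B v) h1
    simp only [map_smul, map_neg, smul_eq_mul] at this
    linear_combination this
  have e2 : (A.a₁ t * (A.a₄ t + A.a₃ t)) * B v v = 0 := by
    have := DFunLike.congr_fun h2 v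
    simp only [smul_apply, neg_apply, smul_eq_mul] at this
    linear_combination this
  have e3 := (mul_eq_zero.1 e1).resolve_right hBv.ne'
  have e4 := (mul_eq_zero.1 ((mul_eq_zero.1 e2).resolve_right hBv.ne')).resolve_left ha.ne'
  have ha4 : A.a₄ t = -A.a₃ t := by linarith
  rw [ha4] at h3 h4 e3
  have hdet : A.a₁ t * A.a₂ t = 1 + A.a₃ t ^ 2 := by linarith
  have h3' := mul_right_cancel₀ hBv.ne' h3
  have h4' := mul_right_cancel₀ hBv.ne' h4
  have hc : 0 < C.c₁ t := by
    have := pos_of_mul_pos_left h5 hBv.le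
    linarith
  obtain ⟨g1, g2⟩ := hermitian_plane ha hdet (c₁ := C.c₁ t) (c₂ := C.c₂ t) (c₃ := C.c₃ t)
    (by linear_combination h3') (by linear_combination h4')
  exact ⟨ha4, hdet, hc, g1, g2⟩

/-- The relations on the plane of `(p♯)^H` and `p^V`. -/
lemma IsHermitianAt.relations_radial (hB : IsInnerForm B) (h : IsHermitianAt A C B p) {t : ℝ}
    (ht : t = 1 / 2 * p (B.inverse p)) (ht0 : 0 < t) (ha : 0 < A.a₁ t + 2 * t * A.b₁ t) :
    A.a₄ t + 2 * t * A.b₄ t = -(A.a₃ t + 2 * t * A.b₃ t) ∧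
    (A.a₁ t + 2 * t * A.b₁ t) * (A.a₂ t + 2 * t * A.b₂ t) = 1 + (A.a₃ t + 2 * t * A.b₃ t) ^ 2 ∧
    0 < C.c₁ t + 2 * t * C.d₁ t ∧
    (C.c₁ t + 2 * t * C.d₁ t) * (A.a₂ t + 2 * t * A.b₂ t)
      = (C.c₂ t + 2 * t * C.d₂ t) * (A.a₁ t + 2 * t * A.b₁ t) ∧
    (C.c₁ t + 2 * t * C.d₁ t) * (A.a₃ t + 2 * t * A.b₃ t)
      = (C.c₃ t + 2 * t * C.d₃ t) * (A.a₁ t + 2 * t * A.b₁ t) := by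
  have hps : p (B.inverse p) = 2 * t := by linarith
  have h2t : 0 < 2 * t := by linarith
  have hs : B.inverse p ≠ 0 := by
    intro h0
    rw [h0, map_zero] at hps
    linarith
  have hH : ∀ x y : ℝ, naturalHorPart A B p (x • B.inverse p) (y • p)
      = (x * (A.a₄ t + 2 * t * A.b₄ t) - y * (A.a₂ t + 2 * t * A.b₂ t)) • B.inverse p := by
    intro x y
    simp only [naturalHorPart, ← ht]
    simp only [map_smul, hps, smul_eq_mul]
    module
  have hV : ∀ x y : ℝ, naturalVertPart A B p (x • B.inverse p) (y • p)
      = (x * (A.a₁ t + 2 * t * A.b₁ t) + y * (A.a₃ t + 2 * t * A.b₃ t)) • p := by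
    intro x y
    simp only [naturalVertPart, ← ht]
    simp only [map_smul, hB.apply_inverse, hps, smul_eq_mul]
    module
  have hG : ∀ x y x' y' : ℝ,
      naturalForm C B p (x • B.inverse p) (y • p) (x' • B.inverse p) (y' • p)
      = ((C.c₁ t + 2 * t * C.d₁ t) * (x * x') + (C.c₂ t + 2 * t * C.d₂ t) * (y * y')
        + (C.c₃ t + 2 * t * C.d₃ t) * (x * y' + x' * y)) * (2 * t) := by
    intro x y x' y'
    simp only [naturalForm, ← ht]
    simp only [map_smul, smul_apply, hB.apply_inverse, hps, smul_eq_mul]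
    ring
  have h1 := h.sq_hor ((1 : ℝ) • B.inverse p) ((0 : ℝ) • p)
  have h2 := h.sq_vert ((1 : ℝ) • B.inverse p) ((0 : ℝ) • p)
  have h3 := h.hermitian ((1 : ℝ) • B.inverse p) ((0 : ℝ) • p) ((1 : ℝ) • B.inverse p) ((0 : ℝ) • p)
  have h4 := h.hermitian ((1 : ℝ) • B.inverse p) ((0 : ℝ) • p) ((0 : ℝ) • B.inverse p) ((1 : ℝ) • p)
  have h5 := h.pos _ hs
  rw [hH, hV, hH] at h1
  rw [hH, hV, hV] at h2
  rw [hH, hV, hG, hG] at h3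
  rw [hH, hV, hH, hV, hG, hG] at h4
  have h5' := hG 1 0 1 0
  rw [one_smul, zero_smul] at h5'
  rw [h5'] at h5
  generalize A.a₁ t + 2 * t * A.b₁ t = s₁ at *
  generalize A.a₂ t + 2 * t * A.b₂ t = s₂ at *
  generalize A.a₃ t + 2 * t * A.b₃ t = s₃ at *
  generalize A.a₄ t + 2 * t * A.b₄ t = s₄ at *
  generalize C.c₁ t + 2 * t * C.d₁ t = k₁ at *
  generalize C.c₂ t + 2 * t * C.d₂ t = k₂ at *
  generalize C.c₃ t + 2 * t * C.d₃ t = k₃ at *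
  have e1 : (s₄ * s₄ - s₁ * s₂ + 1) * (2 * t) = 0 := by
    have := congrArg p h1
    simp only [map_smul, map_neg, smul_eq_mul, hps] at this
    linear_combination this
  have e2 : (s₁ * (s₄ + s₃)) * (2 * t) = 0 := by
    have := DFunLike.congr_fun h2 (B.inverse p)
    simp only [smul_apply, neg_apply, smul_eq_mul, hps] at this
    linear_combination this
  have e3 := (mul_eq_zero.1 e1).resolve_right h2t.ne'
  have e4 := (mul_eq_zero.1 ((mul_eq_zero.1 e2).resolve_right h2t.ne')).resolve_left ha.ne'
  have ha4 : s₄ = -s₃ := by linarith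
  rw [ha4] at h3 h4 e3
  have hdet : s₁ * s₂ = 1 + s₃ ^ 2 := by linarith
  have h3' := mul_right_cancel₀ h2t.ne' h3
  have h4' := mul_right_cancel₀ h2t.ne' h4
  have hc : 0 < k₁ := by
    have := pos_of_mul_pos_left h5 h2t.le
    linarith
  obtain ⟨g1, g2⟩ := hermitian_plane ha hdet (c₁ := k₁) (c₂ := k₂) (c₃ := k₃)
    (by linear_combination h3') (by linear_combination h4')
  exact ⟨ha4, hdet, hc, g1, g2⟩

/-- In dimension at least two there is a covector of any given energy density, annihilating some
nonzero vector. -/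
lemma IsInnerForm.exists_covector (hB : IsInnerForm B) (hdim : 2 ≤ Module.finrank ℝ E) {t : ℝ}
    (ht : 0 ≤ t) : ∃ (p : E →L[ℝ] ℝ) (v : E), t = 1 / 2 * p (B.inverse p) ∧ v ≠ 0 ∧ p v = 0 := by
  have : Nontrivial E := Module.nontrivial_of_finrank_pos (R := ℝ) (by omega)
  obtain ⟨e, he⟩ := exists_ne (0 : E)
  have hpe := hB.pos e he
  obtain ⟨v, hv, hv0⟩ : ∃ v ∈ LinearMap.ker (B e : E →ₗ[ℝ] ℝ), v ≠ 0 := by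
    refine (Submodule.ne_bot_iff _).1 fun h0 => ?_
    have h1 := LinearMap.finrank_range_add_finrank_ker (B e : E →ₗ[ℝ] ℝ)
    rw [h0, finrank_bot] at h1
    have h2 := Submodule.finrank_le (LinearMap.range (B e : E →ₗ[ℝ] ℝ))
    rw [Module.finrank_self] at h2
    omega
  refine ⟨Real.sqrt (2 * t / B e e) • B e, v, ?_, hv0, ?_⟩
  · rw [map_smul, hB.inverse_apply, map_smul, smul_apply, smul_eq_mul, smul_eq_mul, ← mul_assoc,
      ← mul_assoc, mul_assoc (1 / 2), Real.mul_self_sqrt (by positivity)]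
    field_simp
  · have : B e v = 0 := hv
    rw [smul_apply, this, smul_zero]

/-- The algebraic content of the almost Hermitian condition. -/
lemma hermitianRelations_of_isHermitianAt (hB : IsInnerForm B) (hdim : 2 ≤ Module.finrank ℝ E)
    (hsign : A.IsPositive) (h : ∀ p, IsHermitianAt A C B p) : HermitianRelations A C := by
  have h1 : ∀ t, 0 ≤ t → A.a₄ t = -A.a₃ t ∧ A.a₁ t * A.a₂ t = 1 + A.a₃ t ^ 2 ∧ 0 < C.c₁ t ∧
      C.c₁ t * A.a₂ t = C.c₂ t * A.a₁ t ∧ C.c₁ t * A.a₃ t = C.c₃ t * A.a₁ t := by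
    intro t ht
    obtain ⟨p, v, hp, hv, hpv⟩ := hB.exists_covector hdim ht
    exact (h p).relations_ker hB hv hpv hp (hsign t ht).1
  have h2 : ∀ t, 0 < t → A.a₄ t + 2 * t * A.b₄ t = -(A.a₃ t + 2 * t * A.b₃ t) ∧
      (A.a₁ t + 2 * t * A.b₁ t) * (A.a₂ t + 2 * t * A.b₂ t)
        = 1 + (A.a₃ t + 2 * t * A.b₃ t) ^ 2 ∧
      0 < C.c₁ t + 2 * t * C.d₁ t ∧
      (C.c₁ t + 2 * t * C.d₁ t) * (A.a₂ t + 2 * t * A.b₂ t)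
        = (C.c₂ t + 2 * t * C.d₂ t) * (A.a₁ t + 2 * t * A.b₁ t) ∧
      (C.c₁ t + 2 * t * C.d₁ t) * (A.a₃ t + 2 * t * A.b₃ t)
        = (C.c₃ t + 2 * t * C.d₃ t) * (A.a₁ t + 2 * t * A.b₁ t) := by
    intro t ht
    obtain ⟨p, v, hp, hv, hpv⟩ := hB.exists_covector hdim ht.le
    exact (h p).relations_radial hB hp ht (hsign t ht.le).2.2.1
  exact
    { a₄_eq := fun t ht => (h1 t ht).1
      det_eq := fun t ht => (h1 t ht).2.1
      b₄_eq := fun t ht => by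
        have e1 := (h2 t ht).1
        have e2 := (h1 t ht.le).1
        have : 2 * t * (A.b₄ t + A.b₃ t) = 0 := by linarith
        have := (mul_eq_zero.1 this).resolve_left (by positivity)
        linarith
      radial_det_eq := fun t ht => (h2 t ht).2.1
      gram := fun t ht => (h1 t ht).2.2
      radial_gram := fun t ht => (h2 t ht).2.2 }

/-- The proportionality factors exist: `λ = c₁ / a₁` and
`λ + 2t μ = (c₁ + 2t d₁) / (a₁ + 2t b₁)`. -/
lemma HermitianRelations.exists_factors (hsign : A.IsPositive) (h : HermitianRelations A C) :
    ∃ lam mu : ℝ → ℝ, AreProportionalityFactors A C lam mu := by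
  have ht0 : ContDiffOn ℝ ∞ (fun t : ℝ => 2 * t) (Set.Ici 0) :=
    (contDiff_const.mul contDiff_id).contDiffOn
  have hs : ContDiffOn ℝ ∞ (fun t => A.a₁ t + 2 * t * A.b₁ t) (Set.Ici 0) :=
    A.smooth_a₁.add (ht0.mul A.smooth_b₁)
  have hrad : ∀ t, 0 ≤ t → C.c₁ t / A.a₁ t
      + 2 * t * ((C.d₁ t * A.a₁ t - A.b₁ t * C.c₁ t) / (A.a₁ t * (A.a₁ t + 2 * t * A.b₁ t)))
      = (C.c₁ t + 2 * t * C.d₁ t) / (A.a₁ t + 2 * t * A.b₁ t) := by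
    intro t ht
    obtain ⟨p1, -, p2, -⟩ := hsign t ht
    field_simp
    ring
  have hfirst : ∀ t, 0 ≤ t → C.c₁ t = C.c₁ t / A.a₁ t * A.a₁ t ∧
      C.c₂ t = C.c₁ t / A.a₁ t * A.a₂ t ∧ C.c₃ t = C.c₁ t / A.a₁ t * A.a₃ t := by
    intro t ht
    obtain ⟨p1, -⟩ := hsign t ht
    obtain ⟨-, q2, q3⟩ := h.gram t ht
    refine ⟨?_, ?_, ?_⟩ <;> field_simp <;> linarith
  -- this is `μ` with the division by `2t` carried out, so that it is smooth up to `t = 0`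
  refine ⟨fun t => C.c₁ t / A.a₁ t, fun t => (C.d₁ t * A.a₁ t - A.b₁ t * C.c₁ t) /
    (A.a₁ t * (A.a₁ t + 2 * t * A.b₁ t)),
    { smooth_lam := C.smooth_c₁.div A.smooth_a₁ fun t ht => (hsign t ht).1.ne'
      smooth_mu := ((C.smooth_d₁.mul A.smooth_a₁).sub (A.smooth_b₁.mul C.smooth_c₁)).div
        (A.smooth_a₁.mul hs) fun t ht => (mul_pos (hsign t ht).1 (hsign t ht).2.2.1).ne'
      lam_pos := fun t ht => div_pos (h.gram t ht).1 (hsign t ht).1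
      lam_add_pos := fun t ht => ?_
      first := hfirst
      second := fun t ht => ?_ }⟩
  · rw [hrad t ht]
    refine div_pos ?_ (hsign t ht).2.2.1
    rcases ht.eq_or_lt with rfl | ht'
    · simpa using (h.gram 0 le_rfl).1
    · exact (h.radial_gram t ht').1
  · rw [hrad t ht]
    have p2 := (hsign t ht).2.2.1
    rcases ht.eq_or_lt with rfl | ht'
    · simpa using hfirst 0 le_rfl
    · obtain ⟨-, q2, q3⟩ := h.radial_gram t ht'
      rw [div_mul_eq_mul_div, div_mul_eq_mul_div, div_mul_eq_mul_div, eq_div_iff p2.ne',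
        eq_div_iff p2.ne', eq_div_iff p2.ne']
      exact ⟨rfl, q2.symm, q3.symm⟩

end HermitianAlgebra

/-! ### The fundamental form in coordinates -/

noncomputable section FundamentalForm

lemma eq_on_nonneg_of_pos {f g : ℝ → ℝ} (hf : ContinuousOn f (Set.Ici 0))
    (hg : ContinuousOn g (Set.Ici 0)) (h : ∀ t, 0 < t → f t = g t) (t : ℝ) (ht : 0 ≤ t) :
    f t = g t :=
  Set.EqOn.of_subset_closure (s := Set.Ioi 0) (t := Set.Ici 0) (fun t ht => h t ht) hf hg
    Set.Ioi_subset_Ici_self (by rw [closure_Ioi]) ht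

lemma continuousOn_derivIci {f : ℝ → ℝ} (hf : ContDiffOn ℝ ∞ f (Set.Ici 0)) :
    ContinuousOn (derivIci f) (Set.Ici 0) :=
  hf.continuousOn_derivWithin (uniqueDiffOn_Ici 0) (by simp)

section Algebra

variable {E : Type*} [NormedAddCommGroup E] [NormedSpace ℝ E] [FiniteDimensional ℝ E]
  {A : NaturalTensorCoeffs} {C : NaturalMetricCoeffs} {lam mu : ℝ → ℝ}
  {B : E →L[ℝ] E →L[ℝ] ℝ}

lemma IsInnerForm.cometric_pos (hB : IsInnerForm B) {p : E →L[ℝ] ℝ} (hp : p ≠ 0) :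
    0 < p (B.inverse p) := by
  have h1 : B.inverse p ≠ 0 := fun h0 => hp (by rw [← hB.apply_inverse p, h0, map_zero])
  have h2 := hB.pos _ h1
  rwa [hB.apply_inverse] at h2

/-- The fundamental form in terms of the proportionality factors. -/
lemma naturalForm_naturalJ (hB : IsInnerForm B) (hR : HermitianRelations A C)
    (hF : AreProportionalityFactors A C lam mu) (p : E →L[ℝ] ℝ) (u : E) (θ : E →L[ℝ] ℝ) (v : E)
    (ψ : E →L[ℝ] ℝ) :
    naturalForm C B p u θ (naturalHorPart A B p v ψ) (naturalVertPart A B p v ψ)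
      = lam (1 / 2 * p (B.inverse p)) * (θ v - ψ u)
        + mu (1 / 2 * p (B.inverse p)) * (θ (B.inverse p) * p v - ψ (B.inverse p) * p u) := by
  have hBs : ∀ u, B u (B.inverse p) = p u := fun u => by rw [hB.symm, hB.apply_inverse]
  have hBθ : ∀ u θ, B u (B.inverse θ) = θ u := fun u θ => by rw [hB.symm, hB.apply_inverse]
  rcases eq_or_ne p 0 with rfl | hp
  · obtain ⟨e1, e2, e3⟩ := hF.first 0 le_rfl
    have e4 := hR.a₄_eq 0 le_rfl
    have e5 := hR.det_eq 0 le_rfl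
    simp only [naturalForm, naturalHorPart, naturalVertPart, zero_apply, mul_zero, zero_smul,
      add_zero, sub_zero, map_sub, map_add, map_smul, map_zero, smul_apply, smul_eq_mul,
      add_apply, hB.inverse_apply, hBθ, hB.symm v u, e1, e2, e3, e4]
    linear_combination (lam 0 * (θ v - ψ u)) * e5
  · obtain ⟨t, ht⟩ : ∃ t, t = 1 / 2 * p (B.inverse p) := ⟨_, rfl⟩
    have ht0 : 0 < t := by rw [ht]; exact mul_pos (by norm_num) (hB.cometric_pos hp)
    have hps : p (B.inverse p) = 2 * t := by linarith
    obtain ⟨e1, e2, e3⟩ := hF.first t ht0.le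
    obtain ⟨f1, f2, f3⟩ := hF.second t ht0.le
    have e4 := hR.a₄_eq t ht0.le
    have e5 := hR.det_eq t ht0.le
    have e6 := hR.b₄_eq t ht0
    have e7 := hR.radial_det_eq t ht0
    have h2t : 2 * t ≠ 0 := by positivity
    -- the relations for the radial coefficients minus those for `aᵢ`, `cᵢ`, divided by `2t`
    have g1 : C.d₁ t = lam t * A.b₁ t + mu t * (A.a₁ t + 2 * t * A.b₁ t) :=
      mul_left_cancel₀ h2t (by rw [e1] at f1; linear_combination f1)
    have g2 : C.d₂ t = lam t * A.b₂ t + mu t * (A.a₂ t + 2 * t * A.b₂ t) :=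
      mul_left_cancel₀ h2t (by rw [e2] at f2; linear_combination f2)
    have g3 : C.d₃ t = lam t * A.b₃ t + mu t * (A.a₃ t + 2 * t * A.b₃ t) :=
      mul_left_cancel₀ h2t (by rw [e3] at f3; linear_combination f3)
    have e8 : A.a₁ t * A.b₂ t + A.b₁ t * A.a₂ t + 2 * t * (A.b₁ t * A.b₂ t)
        = 2 * A.a₃ t * A.b₃ t + 2 * t * A.b₃ t ^ 2 :=
      mul_left_cancel₀ h2t (by linear_combination e7 - e5)
    simp only [naturalForm, naturalHorPart, naturalVertPart, ← ht]
    simp only [map_sub, map_add, map_smul, smul_apply, smul_eq_mul, add_apply,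
      hB.inverse_apply, hBθ, hB.symm v u, hps, hB.inverse_symm p θ, hB.inverse_symm p ψ,
      e1, e2, e3, e4, e6, g1, g2, g3]
    linear_combination (lam t * (θ v - ψ u)) * e5
      + (θ (B.inverse p) * p v - ψ (B.inverse p) * p u) * (mu t * e7 + lam t * e8)

end Algebra

section Local

variable {E : Type*} [NormedAddCommGroup E] [NormedSpace ℝ E]

/-- The 2-form `α ∧ β`. -/
def wedgeForm {F : Type*} [NormedAddCommGroup F] [NormedSpace ℝ F] (α β : F →L[ℝ] ℝ) :
    F →L[ℝ] F →L[ℝ] ℝ := α.smulRight β - β.smulRight α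

lemma differentiableAt_wedgeForm {G F : Type*} [NormedAddCommGroup G] [NormedSpace ℝ G]
    [NormedAddCommGroup F] [NormedSpace ℝ F] {α β : G → F →L[ℝ] ℝ} {z : G}
    (hα : DifferentiableAt ℝ α z) (hβ : DifferentiableAt ℝ β z) :
    DifferentiableAt ℝ (fun w => wedgeForm (α w) (β w)) z := by
  have hS : ∀ {α β : G → F →L[ℝ] ℝ}, DifferentiableAt ℝ α z → DifferentiableAt ℝ β z →
      DifferentiableAt ℝ (fun w => (α w).smulRight (β w)) z := by
    intro α β hα hβ
    have h1 : DifferentiableAt ℝ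
        (fun w => ContinuousLinearMap.smulRightL ℝ F (F →L[ℝ] ℝ) (α w)) z :=
      (ContinuousLinearMap.smulRightL ℝ F (F →L[ℝ] ℝ)).differentiableAt.comp z hα
    exact h1.clm_apply hβ
  exact (hS hα hβ).sub (hS hβ hα)

/-- The Liouville form of `E × E*`, as a linear function of the point. -/
def liouvilleForm (E : Type*) [NormedAddCommGroup E] [NormedSpace ℝ E] :
    (E × (E →L[ℝ] ℝ)) →L[ℝ] (E × (E →L[ℝ] ℝ)) →L[ℝ] ℝ :=
  ((ContinuousLinearMap.compL ℝ (E × (E →L[ℝ] ℝ)) E ℝ).flip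
    (ContinuousLinearMap.fst ℝ E (E →L[ℝ] ℝ))) ∘L ContinuousLinearMap.snd ℝ E (E →L[ℝ] ℝ)

lemma liouvilleForm_apply (z ζ : E × (E →L[ℝ] ℝ)) : liouvilleForm E z ζ = z.2 ζ.1 := by
  simp [liouvilleForm]

/-- The canonical symplectic form of `E × E*`, the exterior derivative of the Liouville form. -/
def canonicalForm (E : Type*) [NormedAddCommGroup E] [NormedSpace ℝ E] :
    (E × (E →L[ℝ] ℝ)) →L[ℝ] (E × (E →L[ℝ] ℝ)) →L[ℝ] ℝ :=
  liouvilleForm E - (liouvilleForm E).flip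

lemma canonicalForm_apply (ζ ζ' : E × (E →L[ℝ] ℝ)) :
    canonicalForm E ζ ζ' = ζ.2 ζ'.1 - ζ'.2 ζ.1 := by
  simp [canonicalForm, liouvilleForm_apply]

/-- The form `λ ω + μ dt ∧ τ`, where `ω` is the canonical form and `τ` the Liouville form. -/
def localOmega (lam mu : ℝ → ℝ) (h : E → E →L[ℝ] E →L[ℝ] ℝ) (z : E × (E →L[ℝ] ℝ)) :
    (E × (E →L[ℝ] ℝ)) →L[ℝ] (E × (E →L[ℝ] ℝ)) →L[ℝ] ℝ :=
  lam (localEnergy h z) • canonicalForm E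
    + mu (localEnergy h z) • wedgeForm (fderiv ℝ (localEnergy h) z) (liouvilleForm E z)

lemma localOmega_antisymm (lam mu : ℝ → ℝ) (h : E → E →L[ℝ] E →L[ℝ] ℝ)
    (z ζ ζ' : E × (E →L[ℝ] ℝ)) : localOmega lam mu h z ζ ζ' = -localOmega lam mu h z ζ' ζ := by
  simp only [localOmega, wedgeForm, add_apply, smul_apply, sub_apply, smul_eq_mul,
    canonicalForm_apply, ContinuousLinearMap.smulRight_apply]
  ring

variable [FiniteDimensional ℝ E] {A : NaturalTensorCoeffs} {C : NaturalMetricCoeffs}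
  {lam mu : ℝ → ℝ} {h : E → E →L[ℝ] E →L[ℝ] ℝ} {U : Set E} {z : E × (E →L[ℝ] ℝ)}

namespace IsLocalMetric

lemma fderiv_localEnergy (hU : IsLocalMetric h U) (hz : z.1 ∈ U) (ζ : E × (E →L[ℝ] ℝ)) :
    fderiv ℝ (localEnergy h) z ζ = localVert h z ζ ((h z.1).inverse z.2) := by
  obtain ⟨L, hL, hLe⟩ := hU.exists_hasFDerivAt_localEnergy hz
  rw [hL.fderiv, hLe]

/-- The fundamental form in coordinates. -/
lemma naturalForm_localJ (hU : IsLocalMetric h U) (hz : z.1 ∈ U) (hR : HermitianRelations A C)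
    (hF : AreProportionalityFactors A C lam mu) (ζ ζ' : E × (E →L[ℝ] ℝ)) :
    naturalForm C (h z.1) z.2 ζ.1 (localVert h z ζ) (localJ A h z ζ').1
        (localVert h z (localJ A h z ζ')) = localOmega lam mu h z ζ ζ' := by
  rw [localJ_apply, localVert_localLift]
  simp only [localLift]
  rw [naturalForm_naturalJ (hU.inner _ hz) hR hF]
  simp only [localOmega, wedgeForm, add_apply, smul_apply, sub_apply, smul_eq_mul,
    canonicalForm_apply, ContinuousLinearMap.smulRight_apply, liouvilleForm_apply,
    hU.fderiv_localEnergy hz]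
  have h1 : localVert h z ζ ζ'.1 - localVert h z ζ' ζ.1 = ζ.2 ζ'.1 - ζ'.2 ζ.1 := by
    simp only [localVert, sub_apply, ContinuousLinearMap.comp_apply]
    rw [hU.christoffel_symm hz ζ.1 ζ'.1]
    ring
  rw [h1]
  simp only [localEnergy]
  ring

lemma hasFDerivAt_fderiv_localEnergy (hU : IsLocalMetric h U) (hz : z.1 ∈ U) :
    HasFDerivAt (fderiv ℝ (localEnergy h)) (fderiv ℝ (fderiv ℝ (localEnergy h)) z) z :=
  (((hU.contDiffAt_localEnergy hz).fderiv_right (m := 1) (by norm_cast)).differentiableAt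
    (by simp)).hasFDerivAt

lemma differentiableAt_localOmega (hU : IsLocalMetric h U) (hz : z.1 ∈ U)
    (hlam : ContDiffOn ℝ ∞ lam (Set.Ici 0)) (hmu : ContDiffOn ℝ ∞ mu (Set.Ici 0)) :
    DifferentiableAt ℝ (localOmega lam mu h) z := by
  have hdt := ((hU.contDiffAt_localEnergy hz).differentiableAt (by simp)).hasFDerivAt
  have hd2 := (hU.hasFDerivAt_fderiv_localEnergy hz).differentiableAt
  have hτ : DifferentiableAt ℝ (fun w => liouvilleForm E w) z :=
    (liouvilleForm E).differentiableAt
  exact ((hU.hasFDerivAt_comp_energy hz hlam hdt).differentiableAt.smul_const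
    (canonicalForm E)).add ((hU.hasFDerivAt_comp_energy hz hmu hdt).differentiableAt.smul
      (differentiableAt_wedgeForm hd2 hτ))

lemma fderiv_localOmega (hU : IsLocalMetric h U) (hz : z.1 ∈ U)
    (hlam : ContDiffOn ℝ ∞ lam (Set.Ici 0)) (hmu : ContDiffOn ℝ ∞ mu (Set.Ici 0))
    (u v w : E × (E →L[ℝ] ℝ)) : fderiv ℝ (localOmega lam mu h) z u v w
      = derivIci lam (localEnergy h z) * fderiv ℝ (localEnergy h) z u * canonicalForm E v w
        + derivIci mu (localEnergy h z) * fderiv ℝ (localEnergy h) z u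
          * (fderiv ℝ (localEnergy h) z v * z.2 w.1 - fderiv ℝ (localEnergy h) z w * z.2 v.1)
        + mu (localEnergy h z) * (fderiv ℝ (fderiv ℝ (localEnergy h)) z u v * z.2 w.1
          + fderiv ℝ (localEnergy h) z v * u.2 w.1
          - fderiv ℝ (fderiv ℝ (localEnergy h)) z u w * z.2 v.1
          - fderiv ℝ (localEnergy h) z w * u.2 v.1) := by
  have hdt := ((hU.contDiffAt_localEnergy hz).differentiableAt (by simp)).hasFDerivAt
  have hd2 := hU.hasFDerivAt_fderiv_localEnergy hz
  have hτ : ∀ w : E × (E →L[ℝ] ℝ), HasFDerivAt (fun y : E × (E →L[ℝ] ℝ) => y.2 w.1)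
      ((liouvilleForm E).flip w) z := by
    intro w
    refine ((liouvilleForm E).flip w).hasFDerivAt.congr_of_eventuallyEq (.of_forall fun y => ?_)
    exact (liouvilleForm_apply y w).symm
  have hd3 : ∀ w, HasFDerivAt (fun y => fderiv ℝ (localEnergy h) y w)
      ((fderiv ℝ (fderiv ℝ (localEnergy h)) z).flip w) z := by
    intro w
    refine (hd2.clm_apply (hasFDerivAt_const w z)).congr_fderiv ?_
    simp
  have c1 : HasFDerivAt (fun y => localOmega lam mu h y v w)
      (((fderiv ℝ (localOmega lam mu h) z).flip v).flip w) z := by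
    refine (((hU.differentiableAt_localOmega hz hlam hmu).hasFDerivAt.clm_apply
      (hasFDerivAt_const v z)).clm_apply (hasFDerivAt_const w z)).congr_fderiv ?_
    ext <;> simp
  have c2 := ((hU.hasFDerivAt_comp_energy hz hlam hdt).mul_const (canonicalForm E v w)).add
    ((hU.hasFDerivAt_comp_energy hz hmu hdt).mul
      (((hd3 v).mul (hτ w)).sub ((hd3 w).mul (hτ v))))
  have c3 := c2.congr_of_eventuallyEq (f₁ := fun y => localOmega lam mu h y v w)
    (.of_forall fun y => by
      simp only [localOmega, wedgeForm, add_apply, smul_apply, sub_apply, smul_eq_mul,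
        ContinuousLinearMap.smulRight_apply, Pi.add_apply, Pi.mul_apply, Pi.sub_apply,
        liouvilleForm_apply]
      ring)
  have := congrArg (fun L : (E × (E →L[ℝ] ℝ)) →L[ℝ] ℝ => L u) (c1.unique c3)
  simp only [add_apply, smul_apply, sub_apply, smul_eq_mul,
    ContinuousLinearMap.flip_apply, liouvilleForm_apply, Pi.mul_apply, Pi.sub_apply] at this
  rw [this]
  ring

/-- `d(λ ω + μ dt ∧ τ) = (λ' - μ) dt ∧ ω`. -/
lemma exteriorDeriv_localOmega (hU : IsLocalMetric h U) (hz : z.1 ∈ U)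
    (hlam : ContDiffOn ℝ ∞ lam (Set.Ici 0)) (hmu : ContDiffOn ℝ ∞ mu (Set.Ici 0))
    (u v w : E × (E →L[ℝ] ℝ)) :
    fderiv ℝ (localOmega lam mu h) z u v w - fderiv ℝ (localOmega lam mu h) z v u w
        + fderiv ℝ (localOmega lam mu h) z w u v
      = (derivIci lam (localEnergy h z) - mu (localEnergy h z)) *
        (localVert h z u ((h z.1).inverse z.2) * canonicalForm E v w
          - localVert h z v ((h z.1).inverse z.2) * canonicalForm E u w
          + localVert h z w ((h z.1).inverse z.2) * canonicalForm E u v) := by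
  have hsymm : ∀ a b, fderiv ℝ (fderiv ℝ (localEnergy h)) z a b
      = fderiv ℝ (fderiv ℝ (localEnergy h)) z b a := fun a b =>
    ((hU.contDiffAt_localEnergy hz).of_le (n := ∞) (m := 2) (by norm_cast)).isSymmSndFDerivAt
      (by simp) a b
  rw [hU.fderiv_localOmega hz hlam hmu, hU.fderiv_localOmega hz hlam hmu,
    hU.fderiv_localOmega hz hlam hmu, hsymm v u, hsymm w u, hsymm w v]
  simp only [← hU.fderiv_localEnergy hz, canonicalForm_apply]
  ring

/-- At a covector of positive energy density the form `dt ∧ ω` is nonzero. -/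
lemma exists_energy_wedge_ne_zero (hU : IsLocalMetric h U) (hz : z.1 ∈ U)
    (ht : 0 < localEnergy h z) {v : E} (hv : v ≠ 0) (hzv : z.2 v = 0) :
    ∃ ξ η ζ, localVert h z ξ ((h z.1).inverse z.2) * canonicalForm E η ζ
          - localVert h z η ((h z.1).inverse z.2) * canonicalForm E ξ ζ
          + localVert h z ζ ((h z.1).inverse z.2) * canonicalForm E ξ η ≠ 0 := by
  have hB := hU.inner _ hz
  -- on `p^V`, `(h_v)^V`, `v^H` only `dt(p^V) ω((h_v)^V, v^H) = 2t h(v, v)` survives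
  refine ⟨(0, z.2), (0, h z.1 v), localLift h z v 0, ?_⟩
  have h1 : h z.1 v ((h z.1).inverse z.2) = 0 := by
    rw [hB.symm, hB.apply_inverse, hzv]
  rw [localVert_vertical, localVert_vertical, localVert_localLift, h1]
  simp only [canonicalForm_apply, localLift, zero_apply, zero_mul, sub_zero, add_zero, map_zero]
  refine mul_ne_zero ?_ (hB.pos v hv).ne'
  simp only [localEnergy] at ht
  linarith

end IsLocalMetric

end Local

end FundamentalForm

/-! ### The Kähler condition -/

noncomputable section KahlerCriterion

variable {E : Type*} [NormedAddCommGroup E] [NormedSpace ℝ E]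
variable {M : Type*} [TopologicalSpace M] [ChartedSpace E M] [IsManifold 𝓘(ℝ, E) ∞ M]
  {g : SmoothMetric E M} {A : NaturalTensorCoeffs} {C : NaturalMetricCoeffs}

lemma exists_modelVert (g : SmoothMetric E M) (q : CotangentBundle E M) (u : E) (θ : E →L[ℝ] ℝ) :
    ∃ ξ : E × (E →L[ℝ] ℝ), modelBase q ξ = u ∧ modelVert g q ξ = θ := by
  exact ⟨(u, θ + christoffelZero g q u), rfl, add_sub_cancel_right θ (christoffelZero g q u)⟩

lemma modelBase_neg (q : CotangentBundle E M) (ξ : E × (E →L[ℝ] ℝ)) :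
    modelBase q (-ξ) = -modelBase q ξ := map_neg (basePart q) ξ

lemma modelVert_neg (g : SmoothMetric E M) (q : CotangentBundle E M) (ξ : E × (E →L[ℝ] ℝ)) :
    modelVert g q (-ξ) = -modelVert g q ξ := map_neg (verticalPart g q) ξ

/-- The almost Hermitian condition at a covector. -/
lemma isHermitianAt_of_isAlmostHermitian
    (hGJ : IsAlmostHermitian (cotangentModel E) (naturalMetric g C) (naturalJ g A)) (x : M)
    (p : E →L[ℝ] ℝ) : IsHermitianAt A C (metricForm g x) p := by
  let q : CotangentBundle E M := ⟨x, p⟩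
  have hH : ∀ ξ : E × (E →L[ℝ] ℝ), modelBase q (naturalJ g A q ξ)
      = naturalHorPart A (metricForm g x) p (modelBase q ξ) (modelVert g q ξ) :=
    modelBase_naturalJ g A q
  have hV : ∀ ξ : E × (E →L[ℝ] ℝ), modelVert g q (naturalJ g A q ξ)
      = naturalVertPart A (metricForm g x) p (modelBase q ξ) (modelVert g q ξ) :=
    modelVert_naturalJ g A q
  have hG : ∀ ξ η : E × (E →L[ℝ] ℝ), naturalMetric g C q ξ η
      = naturalForm C (metricForm g x) p (modelBase q ξ) (modelVert g q ξ)
        (modelBase q η) (modelVert g q η) := naturalMetric_eq_naturalForm g C q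
  have hsq : ∀ ξ : E × (E →L[ℝ] ℝ), (naturalJ g A q (naturalJ g A q ξ) : E × (E →L[ℝ] ℝ)) = -ξ :=
    hGJ.sq_eq_neg q
  constructor
  · intro u θ
    obtain ⟨ξ, rfl, rfl⟩ := exists_modelVert g q u θ
    rw [← hH, ← hV, ← modelBase_neg, ← hsq ξ]
    exact (hH _).symm
  · intro u θ
    obtain ⟨ξ, rfl, rfl⟩ := exists_modelVert g q u θ
    rw [← hH, ← hV, ← modelVert_neg, ← hsq ξ]
    exact (hV _).symm
  · intro u hu
    obtain ⟨ξ, h1, h2⟩ := exists_modelVert g q u 0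
    have h3 := hGJ.pos q ξ (by
      rintro rfl
      exact hu (h1.symm.trans (map_zero (basePart q))))
    rw [← h1, ← h2]
    exact h3.trans_eq (hG ξ ξ)
  · intro u θ v ψ
    obtain ⟨ξ, rfl, rfl⟩ := exists_modelVert g q u θ
    obtain ⟨η, rfl, rfl⟩ := exists_modelVert g q v ψ
    rw [← hG, ← hH, ← hV, ← hH, ← hV]
    exact (hG _ _).symm.trans (hGJ.hermitian q ξ η)

/-- The chart of `T*M` around `q` at `q` itself. -/
lemma extChartAt_cotangentBundle_self (q : CotangentBundle E M) :
    extChartAt (cotangentModel E) q q = (extChartAt 𝓘(ℝ, E) q.proj q.proj, covector q) := by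
  have : IsManifold 𝓘(ℝ, E) 1 M := IsManifold.of_le (n := ∞) (by simp)
  rw [extChartAt_cotangentBundle_eq q q (mem_extChartAt_source _), chartDeriv_self]
  rfl

lemma extChartAt_cotangentBundle_self_mem (q : CotangentBundle E M) :
    (extChartAt (cotangentModel E) q q).1 ∈ (extChartAt 𝓘(ℝ, E) q.proj).target :=
  (mem_extChartAt_target_cotangentBundle q _).1 (mem_extChartAt_target q)

variable [FiniteDimensional ℝ E]

lemma hermitianRelations [Nonempty M] (hdim : 2 ≤ Module.finrank ℝ E) (hsign : A.IsPositive)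
    (hGJ : IsAlmostHermitian (cotangentModel E) (naturalMetric g C) (naturalJ g A)) :
    HermitianRelations A C :=
  let x : M := Classical.arbitrary M
  hermitianRelations_of_isHermitianAt (isInnerForm_metricForm g x) hdim hsign
    (isHermitianAt_of_isAlmostHermitian hGJ x)

/-- Some point of `T*M` has a given energy density and annihilates a nonzero vector. -/
lemma exists_cotangent_energy [Nonempty M] (g : SmoothMetric E M)
    (hdim : 2 ≤ Module.finrank ℝ E) {t : ℝ} (ht : 0 ≤ t) :
    ∃ (q : CotangentBundle E M) (v : E), v ≠ 0 ∧ covector q v = 0 ∧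
      localEnergy (metricInChart g q.proj) (extChartAt (cotangentModel E) q q) = t := by
  let x : M := Classical.arbitrary M
  obtain ⟨p, v, hp, hv, hpv⟩ := (isInnerForm_metricForm g x).exists_covector hdim ht
  refine ⟨⟨x, p⟩, v, hv, hpv, ?_⟩
  rw [extChartAt_cotangentBundle_self, hp, localEnergy, metricInChart_self]
  rfl

/-- In the chart around `q` the fundamental form is `localOmega`. -/
lemma fundamentalForm_chartDeriv (hR : HermitianRelations A C) {lam mu : ℝ → ℝ}
    (hF : AreProportionalityFactors A C lam mu) (q : CotangentBundle E M) {z : E × (E →L[ℝ] ℝ)}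
    (hz : z ∈ (extChartAt (cotangentModel E) q).target) (v w : E × (E →L[ℝ] ℝ)) :
    fundamentalForm (cotangentModel E) (naturalMetric g C) (naturalJ g A)
        ((extChartAt (cotangentModel E) q).symm z) (chartDeriv (cotangentModel E) q z v)
        (chartDeriv (cotangentModel E) q z w)
      = localOmega lam mu (metricInChart g q.proj) z v w := by
  have hz1 := (mem_extChartAt_target_cotangentBundle q z).1 hz
  have h1 := (isLocalMetric_metricInChart g q.proj).naturalForm_localJ hz1 hR hF v w
  have h2 := naturalMetric_chartDeriv g q C hz v (localJ A (metricInChart g q.proj) z w)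
  rw [← h1, ← h2]
  exact congrArg (naturalMetric g C _ _) (naturalJ_chartDeriv g q A hz w)

lemma isClosedTwoForm_fundamentalForm_iff_chart (hR : HermitianRelations A C) {lam mu : ℝ → ℝ}
    (hF : AreProportionalityFactors A C lam mu) :
    IsClosedTwoForm (cotangentModel E)
        (fundamentalForm (cotangentModel E) (naturalMetric g C) (naturalJ g A))
      ↔ ∀ (q : CotangentBundle E M) (u v w : E × (E →L[ℝ] ℝ)),
        fderiv ℝ (localOmega lam mu (metricInChart g q.proj))
          (extChartAt (cotangentModel E) q q) u v w
        - fderiv ℝ (localOmega lam mu (metricInChart g q.proj))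
          (extChartAt (cotangentModel E) q q) v u w
        + fderiv ℝ (localOmega lam mu (metricInChart g q.proj))
          (extChartAt (cotangentModel E) q q) w u v = 0 := by
  have i2 : IsManifold (cotangentModel E) 1 (CotangentBundle E M) :=
    IsManifold.of_le (n := ∞) (by simp)
  have h1 : ∀ q : CotangentBundle E M, DifferentiableAt ℝ
      (localOmega lam mu (metricInChart g q.proj)) (extChartAt (cotangentModel E) q q) := fun q =>
    (isLocalMetric_metricInChart g q.proj).differentiableAt_localOmega
      (extChartAt_cotangentBundle_self_mem q) hF.smooth_lam hF.smooth_mu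
  have h2 : ∀ (q : CotangentBundle E M) (v w : E × (E →L[ℝ] ℝ)),
      localOmega lam mu (metricInChart g q.proj) (extChartAt (cotangentModel E) q q) v w
        = -localOmega lam mu (metricInChart g q.proj) (extChartAt (cotangentModel E) q q) w v :=
    fun q v w => localOmega_antisymm _ _ _ _ _ _
  exact isClosedTwoForm_iff (cotangentModel E) (N := CotangentBundle E M)
    (Φ := fundamentalForm (cotangentModel E) (naturalMetric g C) (naturalJ g A))
    (Ω := fun q => localOmega lam mu (metricInChart g q.proj)) h1
    (fun q z hz v w => fundamentalForm_chartDeriv hR hF q hz v w) h2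

/-- The fundamental form is closed exactly when `μ = λ'`. -/
lemma isClosedTwoForm_fundamentalForm_iff [Nonempty M] (hdim : 2 ≤ Module.finrank ℝ E)
    (hR : HermitianRelations A C) {lam mu : ℝ → ℝ} (hF : AreProportionalityFactors A C lam mu) :
    IsClosedTwoForm (cotangentModel E)
        (fundamentalForm (cotangentModel E) (naturalMetric g C) (naturalJ g A))
      ↔ ∀ t : ℝ, 0 ≤ t → mu t = derivIci lam t := by
  rw [isClosedTwoForm_fundamentalForm_iff_chart hR hF]
  have key := fun q : CotangentBundle E M =>
    (isLocalMetric_metricInChart g q.proj).exteriorDeriv_localOmega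
      (extChartAt_cotangentBundle_self_mem q) hF.smooth_lam hF.smooth_mu
  constructor
  · intro h
    refine eq_on_nonneg_of_pos hF.smooth_mu.continuousOn (continuousOn_derivIci hF.smooth_lam) ?_
    intro t ht
    obtain ⟨q, v, hv, hqv, hqt⟩ := exists_cotangent_energy g hdim ht.le
    obtain ⟨ξ, η, ζ, hne⟩ := (isLocalMetric_metricInChart g q.proj).exists_energy_wedge_ne_zero
      (extChartAt_cotangentBundle_self_mem q) (hqt ▸ ht) hv
      (by rw [extChartAt_cotangentBundle_self]; exact hqv)
    have h1 := (mul_eq_zero.1 ((key q ξ η ζ).symm.trans (h q ξ η ζ))).resolve_right hne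
    rw [hqt] at h1
    linarith
  · intro h q u v w
    rw [key, h _ ((isLocalMetric_metricInChart g q.proj).localEnergy_nonneg
      (extChartAt_cotangentBundle_self_mem q)), sub_self, zero_mul]

end KahlerCriterion

/-! ### The equations of integrability as functions of the energy density -/

noncomputable section IntegrabilityScalars

namespace NaturalTensorCoeffs

variable (A : NaturalTensorCoeffs) (c t : ℝ)

/-- The denominator of the integrability formulas. -/
def denom : ℝ :=
  A.a₁ t - 2 * t * derivIci A.a₁ t - 2 * c * t * A.a₂ t - 4 * c * t ^ 2 * derivIci A.a₂ t

/-- The numerator of the formula for `b₁`. -/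
def numer₁ : ℝ :=
  2 * c ^ 2 * t * A.a₂ t ^ 2 + 2 * c * t * A.a₁ t * derivIci A.a₂ t + A.a₁ t * derivIci A.a₁ t - c
    + 3 * c * A.a₃ t ^ 2

/-- The numerator of the formula for `b₂`. -/
def numer₂ : ℝ :=
  2 * t * derivIci A.a₃ t ^ 2 - 2 * t * derivIci A.a₁ t * derivIci A.a₂ t + c * A.a₂ t ^ 2
    + 2 * c * t * A.a₂ t * derivIci A.a₂ t + A.a₁ t * derivIci A.a₂ t

/-- The numerator of the formula for `b₃`. -/
def numer₃ : ℝ :=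
  A.a₁ t * derivIci A.a₃ t + 2 * c * A.a₂ t * A.a₃ t + 4 * c * t * derivIci A.a₂ t * A.a₃ t
    - 2 * c * t * A.a₂ t * derivIci A.a₃ t

/-- On integrable structures this is the product of `denom` and `a₁ + 2t b₁`; it does not involve
derivatives. -/
def radialNumer : ℝ :=
  A.a₁ t ^ 2 - 4 * c * t + 4 * c * t * A.a₃ t ^ 2 + 4 * c ^ 2 * t ^ 2 * A.a₂ t ^ 2

/-- The equations for `b₂`, `b₃` expressing the vanishing of `N_J` over a space of constant
curvature `c`. -/
def ObstructionsVanish : Prop :=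
  A.horObstruction t = 0 ∧
    A.vertObstruction t + c * A.a₂ t * (A.a₂ t + 2 * t * A.b₂ t) = 0

variable {A c t} {C : NaturalMetricCoeffs}

lemma hasDerivWithinAt {f : ℝ → ℝ} (hf : ContDiffOn ℝ ∞ f (Set.Ici 0)) (ht : 0 ≤ t) :
    HasDerivWithinAt f (derivIci f t) (Set.Ici 0) t :=
  ((hf t ht).differentiableWithinAt (by simp)).hasDerivWithinAt

/-- The derivative of the relation `a₁a₂ = 1 + a₃²`. -/
lemma deriv_det_eq (hR : HermitianRelations A C) (ht : 0 ≤ t) :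
    derivIci A.a₁ t * A.a₂ t + A.a₁ t * derivIci A.a₂ t = 2 * A.a₃ t * derivIci A.a₃ t := by
  have h1 := (hasDerivWithinAt A.smooth_a₁ ht).mul (hasDerivWithinAt A.smooth_a₂ ht)
  have h2 := ((hasDerivWithinAt A.smooth_a₃ ht).pow 2).const_add 1
  have h3 := h2.congr (f₁ := A.a₁ * A.a₂) (fun s hs => hR.det_eq s hs) (hR.det_eq t ht)
  have h4 := (uniqueDiffOn_Ici (0 : ℝ) t ht).eq_deriv _ h1 h3
  rw [h4]
  ring

/-- Cramer's rule for the equations of the obstructions. -/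
lemma ObstructionsVanish.cramer (hR : HermitianRelations A C) (ht : 0 ≤ t) (ha₂ : 0 < A.a₂ t)
    (h : A.ObstructionsVanish c t) :
    A.b₂ t * A.denom c t = A.numer₂ c t ∧ A.b₃ t * A.denom c t = A.numer₃ c t := by
  have h2 := deriv_det_eq hR ht
  obtain ⟨e1, e2⟩ := h
  simp only [horObstruction, vertObstruction] at e1 e2
  simp only [denom, numer₂, numer₃]
  constructor <;> refine mul_left_cancel₀ ha₂.ne' ?_
  · linear_combination (-(2 * t * derivIci A.a₂ t + A.a₂ t)) * e2
      - (2 * t * derivIci A.a₃ t) * e1 + (2 * t * derivIci A.a₂ t - 2 * t * A.b₂ t) * h2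
  · linear_combination (2 * c * t * A.a₂ t - A.a₁ t) * e1 - (2 * A.a₃ t) * e2
      - (2 * t * A.b₃ t) * h2

lemma obstructionsVanish_of_cramer (hR : HermitianRelations A C) (ht : 0 ≤ t) (ha₂ : 0 < A.a₂ t)
    (hD : A.denom c t ≠ 0) (hb₂ : A.b₂ t * A.denom c t = A.numer₂ c t)
    (hb₃ : A.b₃ t * A.denom c t = A.numer₃ c t) : A.ObstructionsVanish c t := by
  have h2 := deriv_det_eq hR ht
  have hD' : A.a₂ t * A.denom c t ≠ 0 := mul_ne_zero ha₂.ne' hD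
  simp only [denom, numer₂, numer₃] at hb₂ hb₃ hD'
  constructor <;> refine mul_left_cancel₀ hD' ?_
  · simp only [horObstruction]
    linear_combination (2 * A.a₃ t * A.a₂ t) * hb₂
      - ((2 * t * derivIci A.a₂ t + A.a₂ t) * A.a₂ t) * hb₃
      - (2 * t * A.a₂ t * derivIci A.a₃ t) * h2
  · simp only [vertObstruction]
    linear_combination ((2 * c * t * A.a₂ t - A.a₁ t) * A.a₂ t) * hb₂
      + (2 * t * derivIci A.a₃ t * A.a₂ t) * hb₃
      - (2 * t * ((2 * c * t * A.a₂ t - A.a₁ t) * derivIci A.a₂ t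
        + A.a₁ t * derivIci A.a₂ t + c * A.a₂ t ^ 2)) * h2

/-- As `radialNumer` will be the product of `denom` and `a₁ + 2t b₁`, this is the formula for `b₁`,
multiplied by `2t` and the denominator. -/
lemma radialNumer_sub (hR : HermitianRelations A C) (ht : 0 ≤ t) :
    A.radialNumer c t - A.denom c t * A.a₁ t = 2 * t * A.numer₁ c t := by
  simp only [radialNumer, denom, numer₁]
  linear_combination (2 * c * t) * hR.det_eq t ht

/-- The relation `s₁s₂ = 1 + s₃²` between the radial coefficients, cleared of denominators. -/
lemma radialNumer_mul (hR : HermitianRelations A C) (ht : 0 ≤ t) (ha₂ : 0 < A.a₂ t) :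
    A.radialNumer c t * (A.denom c t * A.a₂ t + 2 * t * A.numer₂ c t)
      = A.denom c t ^ 2 + (A.denom c t * A.a₃ t + 2 * t * A.numer₃ c t) ^ 2 := by
  have h1 : A.a₁ t = (1 + A.a₃ t ^ 2) / A.a₂ t := by
    rw [eq_div_iff ha₂.ne', hR.det_eq t ht]
  have h2 : derivIci A.a₁ t
      = (2 * A.a₃ t * derivIci A.a₃ t - A.a₁ t * derivIci A.a₂ t) / A.a₂ t := by
    rw [eq_div_iff ha₂.ne', ← deriv_det_eq hR ht]
    ring
  simp only [radialNumer, denom, numer₂, numer₃, h2, h1]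
  field_simp
  ring

/-- Where the denominator does not vanish, it relates `a₁ + 2t b₁` to `radialNumer`. -/
lemma denom_mul_radial (hR : HermitianRelations A C) (hsign : A.IsPositive) (ht : 0 < t)
    (hD : A.denom c t ≠ 0) (h : A.ObstructionsVanish c t) :
    A.denom c t * (A.a₁ t + 2 * t * A.b₁ t) = A.radialNumer c t := by
  obtain ⟨-, p2, -, p4⟩ := hsign t ht.le
  obtain ⟨e1, e2⟩ := h.cramer hR ht.le p2
  have e3 := radialNumer_mul (c := c) hR ht.le p2
  have e4 := hR.radial_det_eq t ht
  rw [← e1, ← e2] at e3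
  refine mul_right_cancel₀ (mul_ne_zero hD p4.ne') ?_
  linear_combination A.denom c t ^ 2 * e4 - e3

/-- The function `radialNumer` satisfies a first order equation with `denom` as source. -/
lemma hasDerivWithinAt_radialNumer (hR : HermitianRelations A C) (ht : 0 < t) :
    HasDerivWithinAt (A.radialNumer c)
      ((A.radialNumer c t - (A.a₁ t + 2 * c * t * A.a₂ t) * A.denom c t) / t) (Set.Ici 0) t := by
  have d1 := hasDerivWithinAt A.smooth_a₁ ht.le
  have d2 := hasDerivWithinAt A.smooth_a₂ ht.le
  have d3 := hasDerivWithinAt A.smooth_a₃ ht.le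
  have dt := hasDerivWithinAt_id t (Set.Ici (0 : ℝ))
  have key := (((d1.pow 2).sub (dt.const_mul (4 * c))).add
    ((dt.const_mul (4 * c)).mul (d3.pow 2))).add
    (((dt.pow 2).const_mul (4 * c ^ 2)).mul (d2.pow 2))
  refine (key.congr_of_eventuallyEq (f₁ := A.radialNumer c) (.of_forall fun s => ?_) ?_).congr_deriv
    ?_
  · simp [radialNumer]
  · simp [radialNumer]
  · rw [eq_div_iff ht.ne']
    simp only [radialNumer, denom, id_eq, Pi.pow_apply]
    linear_combination (-4 * c * t ^ 2) * deriv_det_eq hR ht.le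

lemma continuousOn_denom (A : NaturalTensorCoeffs) (c : ℝ) :
    ContinuousOn (A.denom c) (Set.Ici 0) := by
  have h1 := A.smooth_a₁.continuousOn
  have h2 := A.smooth_a₂.continuousOn
  have d1 := continuousOn_derivIci A.smooth_a₁
  have d2 := continuousOn_derivIci A.smooth_a₂
  unfold denom
  fun_prop

lemma continuousOn_numer₁ (A : NaturalTensorCoeffs) (c : ℝ) :
    ContinuousOn (A.numer₁ c) (Set.Ici 0) := by
  have h1 := A.smooth_a₁.continuousOn
  have h2 := A.smooth_a₂.continuousOn
  have h3 := A.smooth_a₃.continuousOn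
  have d1 := continuousOn_derivIci A.smooth_a₁
  have d2 := continuousOn_derivIci A.smooth_a₂
  unfold numer₁
  fun_prop

lemma continuousOn_radialNumer (A : NaturalTensorCoeffs) (c : ℝ) :
    ContinuousOn (A.radialNumer c) (Set.Ici 0) := by
  have h1 := A.smooth_a₁.continuousOn
  have h2 := A.smooth_a₂.continuousOn
  have h3 := A.smooth_a₃.continuousOn
  unfold radialNumer
  fun_prop

/-- The denominator does not vanish. Up to its first zero `T` it is the quotient of `radialNumer` by
`a₁ + 2t b₁`, so `radialNumer` solves there a homogeneous linear equation, regular away from `0`;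
since it vanishes at `T`, it vanishes before `T`. -/
lemma denom_ne_zero (hR : HermitianRelations A C) (hsign : A.IsPositive)
    (h : ∀ t, 0 ≤ t → A.ObstructionsVanish c t) (t : ℝ) (ht : 0 ≤ t) : A.denom c t ≠ 0 := by
  intro h0
  let Z : Set ℝ := Set.Ici 0 ∩ A.denom c ⁻¹' {0}
  have hZ : IsClosed Z := (continuousOn_denom A c).preimage_isClosed_of_isClosed isClosed_Ici
    isClosed_singleton
  have hbdd : BddBelow Z := ⟨0, fun s hs => hs.1⟩
  obtain ⟨hT0, hTD⟩ : sInf Z ∈ Z := hZ.csInf_mem ⟨t, ht, h0⟩ hbdd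
  have hbefore : ∀ s, 0 ≤ s → s < sInf Z → A.denom c s ≠ 0 := fun s hs hsT h1 =>
    notMem_of_lt_csInf hsT hbdd ⟨hs, h1⟩
  generalize sInf Z = T at hT0 hTD hbefore
  have hTD' : A.denom c T = 0 := hTD
  have hTpos : 0 < T := by
    refine lt_of_le_of_ne hT0 ?_
    rintro rfl
    have := (hsign 0 le_rfl).1
    simp only [denom] at hTD'
    norm_num at hTD'
    exact this.ne' hTD'
  have hsub : Set.Icc (T / 2) T ⊆ Set.Ici 0 := fun s hs => le_trans (by positivity) hs.1
  have hpos : ∀ s ∈ Set.Icc (T / 2) T, 0 < s := fun s hs => lt_of_lt_of_le (by positivity) hs.1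
  have ha₁ := A.smooth_a₁.continuousOn.mono hsub
  have ha₂ := A.smooth_a₂.continuousOn.mono hsub
  have hb₁ := A.smooth_b₁.continuousOn.mono hsub
  have hS := (continuousOn_radialNumer A c).mono hsub
  have hD := (continuousOn_denom A c).mono hsub
  have hs₁ : ContinuousOn (fun s => A.a₁ s + 2 * s * A.b₁ s) (Set.Icc (T / 2) T) := by fun_prop
  have hs₁pos : ∀ s ∈ Set.Icc (T / 2) T, 0 < A.a₁ s + 2 * s * A.b₁ s := fun s hs =>
    (hsign s (hsub hs)).2.2.1
  have hrel : ∀ s ∈ Set.Icc (T / 2) T,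
      A.denom c s * (A.a₁ s + 2 * s * A.b₁ s) = A.radialNumer c s := by
    refine Set.EqOn.of_subset_closure (s := Set.Ico (T / 2) T) (fun s hs => ?_) (hD.mul hs₁) hS
      Set.Ico_subset_Icc_self (by rw [closure_Ico (by linarith)])
    have hs' := Set.Ico_subset_Icc_self hs
    exact denom_mul_radial hR hsign (hpos s hs') (hbefore s (hsub hs') hs.2) (h s (hsub hs'))
  let k : ℝ → ℝ := fun s =>
    (1 - (A.a₁ s + 2 * c * s * A.a₂ s) / (A.a₁ s + 2 * s * A.b₁ s)) / s
  have hk : ContinuousOn k (Set.Icc (T / 2) T) := by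
    refine ContinuousOn.div (continuousOn_const.sub (ContinuousOn.div (by fun_prop) hs₁
      fun s hs => (hs₁pos s hs).ne')) continuousOn_id fun s hs => (hpos s hs).ne'
  obtain ⟨K, hK⟩ := isCompact_Icc.exists_bound_of_continuousOn hk
  have hzero : Set.EqOn (A.radialNumer c) (fun _ => 0) (Set.Icc (T / 2) T) := by
    refine ODE_solution_unique_of_mem_Icc_left (v := fun s x => k s * x) (K := K.toNNReal)
      (s := fun _ => Set.univ) (fun s hs => ?_) hS (fun s hs => ?_) (fun _ _ => trivial)
      continuousOn_const (fun s hs => ?_) (fun _ _ => trivial) ?_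
    · refine (LipschitzWith.of_dist_le_mul fun x y => ?_).lipschitzOnWith
      rw [Real.dist_eq, Real.dist_eq, ← mul_sub, abs_mul]
      exact mul_le_mul_of_nonneg_right ((hK s (Set.Ioc_subset_Icc_self hs)).trans
        (Real.le_coe_toNNReal K)) (abs_nonneg _)
    · have hs' := Set.Ioc_subset_Icc_self hs
      have hp := hpos s hs'
      have h1 := ((hasDerivWithinAt_radialNumer (c := c) hR hp).hasDerivAt
        (Ici_mem_nhds hp)).hasDerivWithinAt (s := Set.Iic s)
      refine h1.congr_deriv ?_
      have h2 := hs₁pos s hs'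
      rw [← hrel s hs']
      simp only [k]
      field_simp
    · simpa using hasDerivWithinAt_const s (Set.Iic s) (0 : ℝ)
    · rw [← hrel T ⟨by linarith, le_rfl⟩, hTD', zero_mul]
  have hmem : T / 2 ∈ Set.Icc (T / 2) T := ⟨le_rfl, by linarith⟩
  have h1 := hrel _ hmem
  rw [hzero hmem] at h1
  exact hbefore (T / 2) (by positivity) (by linarith)
    ((mul_eq_zero.1 h1).resolve_right (hs₁pos _ hmem).ne')

/-- The equations of the obstructions are equivalent to the integrability formulas. -/
lemma forall_obstructionsVanish_iff (hR : HermitianRelations A C) (hsign : A.IsPositive) :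
    (∀ t, 0 ≤ t → A.ObstructionsVanish c t) ↔ IntegrabilityFormulas A c := by
  constructor
  · intro h
    have hD := denom_ne_zero hR hsign h
    have h1 : ∀ t, 0 ≤ t → A.b₁ t * A.denom c t = A.numer₁ c t := by
      refine eq_on_nonneg_of_pos (A.smooth_b₁.continuousOn.mul (continuousOn_denom A c))
        (continuousOn_numer₁ A c) fun t ht => ?_
      refine mul_left_cancel₀ (mul_ne_zero two_ne_zero ht.ne') ?_
      rw [← radialNumer_sub hR ht.le, ← denom_mul_radial hR hsign ht (hD t ht.le) (h t ht.le)]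
      ring
    intro t ht
    obtain ⟨h2, h3⟩ := (h t ht).cramer hR ht (hsign t ht).2.1
    exact ⟨hD t ht, (eq_div_iff (hD t ht)).2 (h1 t ht), (eq_div_iff (hD t ht)).2 h2,
      (eq_div_iff (hD t ht)).2 h3⟩
  · intro h t ht
    obtain ⟨hD, -, h2, h3⟩ := h t ht
    exact obstructionsVanish_of_cramer hR ht (hsign t ht).2.1 hD ((eq_div_iff hD).1 h2)
      ((eq_div_iff hD).1 h3)

end NaturalTensorCoeffs

end IntegrabilityScalars

/-! ### Integrability and constant curvature -/

noncomputable section IntegrabilityGeometry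

variable {E : Type*} [NormedAddCommGroup E] [NormedSpace ℝ E]

/-- Algebraic curvature tensors on `E` with the inner product `B`. -/
structure IsCurvatureLike (B : E →L[ℝ] E →L[ℝ] ℝ) (R : E → E → E → E) : Prop where
  add : ∀ u u' v w, R (u + u') v w = R u v w + R u' v w
  smul : ∀ (r : ℝ) u v w, R (r • u) v w = r • R u v w
  antisymm : ∀ u v w, R u v w = -R v u w
  skew : ∀ u v w x, B (R u v w) x = -B w (R u v x)
  bianchi : ∀ u v w, R u v w + R v w u + R w u v = 0

namespace IsCurvatureLike

variable {B : E →L[ℝ] E →L[ℝ] ℝ} {R : E → E → E → E}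

lemma add_right (hR : IsCurvatureLike B R) (u v v' w : E) :
    R u (v + v') w = R u v w + R u v' w := by
  rw [hR.antisymm, hR.add, hR.antisymm u v, hR.antisymm u v']
  abel

lemma smul_right (hR : IsCurvatureLike B R) (r : ℝ) (u v w : E) :
    R u (r • v) w = r • R u v w := by
  rw [hR.antisymm, hR.smul, hR.antisymm u v, smul_neg]

lemma self (hR : IsCurvatureLike B R) (u w : E) : R u u w = 0 := by
  have h : (2 : ℝ) • R u u w = 0 := by
    rw [two_smul]
    exact eq_neg_iff_add_eq_zero.1 (hR.antisymm u u w)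
  exact (smul_eq_zero.1 h).resolve_left two_ne_zero

/-- Constant sectional curvature determines the curvature tensor. -/
lemma eq_of_constant (hR : IsCurvatureLike B R) (hB : IsInnerForm B) {c : ℝ}
    (hc : ∀ u v, LinearIndependent ℝ ![u, v] →
      B (R u v v) u = c * (B u u * B v v - B u v ^ 2)) (u v w x : E) :
    B (R u v w) x = c * (B v w * B u x - B u w * B v x) := by
  refine sub_eq_zero.1 (curvatureLike_eq_zero
    (f := fun u v w x => B (R u v w) x - c * (B v w * B u x - B u w * B v x))
    ?_ ?_ ?_ ?_ ?_ u v w x)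
  · intro u u' v w x
    simp only [hR.add, map_add, add_apply]
    ring
  · intro u v w x
    rw [hR.antisymm u v, map_neg, neg_apply]
    ring
  · intro u v w x
    rw [hR.skew, hB.symm w]
    ring
  · intro u v w x
    have h := congrArg (fun e => B e x) (hR.bianchi u v w)
    simp only [map_add, add_apply, map_zero, zero_apply] at h
    rw [hB.symm w u, hB.symm w v, hB.symm v u]
    linear_combination h
  · intro u v
    by_cases hi : LinearIndependent ℝ ![u, v]
    · rw [hc u v hi, hB.symm v u]
      ring
    · rw [LinearIndependent.pair_iff] at hi
      push Not at hi
      obtain ⟨a, b, hab, hne⟩ := hi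
      rcases eq_or_ne b 0 with rfl | hb
      · have ha : a ≠ 0 := fun h0 => hne h0 rfl
        have hu : u = 0 := by simpa [ha] using hab
        have : R u v v = 0 := by simpa [hu] using hR.smul 0 0 v v
        rw [this, hu]
        simp
      · have hv : v = (-a / b) • u := by
          have : b • v = b • ((-a / b) • u) := by
            rw [smul_smul, mul_div_cancel₀ _ hb, neg_smul]
            exact eq_neg_of_add_eq_zero_right hab
          exact smul_right_injective E hb this
        have : R u v v = 0 := by
          conv_lhs => rw [hv]
          rw [hR.smul_right, hR.self, smul_zero]
        rw [this, hv]
        simp only [map_smul, map_zero, zero_apply, smul_apply, smul_eq_mul]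
        ring

end IsCurvatureLike

/-- The vanishing of the Nijenhuis tensor on vertical vectors at the covector `p`, for the inner
product `B` and the curvature tensor `R`. -/
def VerticalNijenhuisVanishes (A : NaturalTensorCoeffs) (B : E →L[ℝ] E →L[ℝ] ℝ)
    (R : E → E → E → E) (p : E →L[ℝ] ℝ) : Prop :=
  ∀ θ η : E →L[ℝ] ℝ, A.horObstruction (1 / 2 * p (B.inverse p)) •
      (p (B.inverse θ) • B.inverse η - p (B.inverse η) • B.inverse θ) = 0 ∧
    ∀ w, A.vertObstruction (1 / 2 * p (B.inverse p))
        * (p (B.inverse θ) * η w - p (B.inverse η) * θ w)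
      + p (R (naturalHorPart A B p 0 θ) (naturalHorPart A B p 0 η) w) = 0

namespace NaturalTensorCoeffs

variable (A : NaturalTensorCoeffs)

lemma continuousOn_horObstruction : ContinuousOn A.horObstruction (Set.Ici 0) := by
  have h2 := A.smooth_a₂.continuousOn
  have h3 := A.smooth_a₃.continuousOn
  have k2 := A.smooth_b₂.continuousOn
  have k3 := A.smooth_b₃.continuousOn
  have d2 := continuousOn_derivIci A.smooth_a₂
  have d3 := continuousOn_derivIci A.smooth_a₃
  unfold horObstruction
  fun_prop

lemma continuousOn_vertObstruction : ContinuousOn A.vertObstruction (Set.Ici 0) := by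
  have h1 := A.smooth_a₁.continuousOn
  have k2 := A.smooth_b₂.continuousOn
  have k3 := A.smooth_b₃.continuousOn
  have d2 := continuousOn_derivIci A.smooth_a₂
  have d3 := continuousOn_derivIci A.smooth_a₃
  unfold vertObstruction
  fun_prop

end NaturalTensorCoeffs

section Algebra

variable [FiniteDimensional ℝ E] {A : NaturalTensorCoeffs} {B : E →L[ℝ] E →L[ℝ] ℝ}
  {R : E → E → E → E}

/-- The vanishing of the Nijenhuis tensor at the covectors `g_{ru}` determines the sectional
curvature of all planes through `u`, by the coefficients at any given energy density. -/
lemma sectional_of_verticalNijenhuisVanishes (hB : IsInnerForm B) (hR : IsCurvatureLike B R)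
    (h : ∀ p, VerticalNijenhuisVanishes A B R p) {u v : E} (hi : LinearIndependent ℝ ![u, v])
    {t : ℝ} (ht : 0 < t) : A.horObstruction t = 0 ∧
      A.a₂ t * (A.a₂ t + 2 * t * A.b₂ t) * B (R u v v) u
        = -A.vertObstruction t * (B u u * B v v - B u v ^ 2) := by
  have hu : u ≠ 0 := hi.ne_zero 0
  have hBu := hB.pos u hu
  have hgram := hB.gram_pos hi
  -- the covector `g_{ru}` has energy density `t`
  obtain ⟨r, hr, hr2⟩ : ∃ r : ℝ, 0 < r ∧ r ^ 2 * B u u = 2 * t :=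
    ⟨Real.sqrt (2 * t / B u u), by positivity, by
      rw [Real.sq_sqrt (by positivity)]; field_simp⟩
  obtain ⟨p, hp⟩ : ∃ p, p = r • B u := ⟨_, rfl⟩
  have hs : B.inverse p = r • u := by rw [hp, map_smul, hB.inverse_apply]
  have hpp : p (r • u) = 2 * t := by
    rw [hp, map_smul, smul_apply, smul_eq_mul, smul_eq_mul, ← hr2]
    ring
  have hpv : p v = r * B u v := by rw [hp, smul_apply, smul_eq_mul]
  have ht' : 1 / 2 * (2 * t) = t := by ring
  -- `θ = p` and `η = g_v` lift to vectors whose images under `J` have horizontal parts spanning the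
  -- plane of `u` and `v`
  obtain ⟨h1, h2⟩ := h p p (B v)
  have h3 := h2 v
  simp only [naturalHorPart, hs, hpp, ht', hB.inverse_apply, map_zero, smul_zero, mul_zero,
    zero_smul, add_zero, zero_sub] at h1 h3
  have e1 : -(A.a₂ t • r • u) - (A.b₂ t * (2 * t)) • r • u
      = (-(A.a₂ t + 2 * t * A.b₂ t) * r) • u := by module
  have e2 : -(A.a₂ t • v) - (A.b₂ t * p v) • r • u
      = (-A.a₂ t) • v + (-(A.b₂ t * p v) * r) • u := by module
  rw [e1, e2, hR.smul, hR.add_right, hR.smul_right, hR.smul_right, hR.self, smul_zero, add_zero,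
    smul_smul, map_smul, smul_eq_mul] at h3
  have hr2' : r ^ 2 ≠ 0 := by positivity
  constructor
  · have h4 := congrArg (fun e => B e v) h1
    simp only [map_smul, map_sub, smul_apply, sub_apply, smul_eq_mul, map_zero, zero_apply] at h4
    have h5 : A.horObstruction t * (r ^ 2 * (B u u * B v v - B u v ^ 2)) = 0 := by
      rw [hpv] at h4
      linear_combination h4 + A.horObstruction t * B v v * hr2
    exact (mul_eq_zero.1 h5).resolve_right (mul_ne_zero hr2' hgram.ne')
  · have h6 : p (R u v v) = r * B (R u v v) u := by
      rw [hp, smul_apply, smul_eq_mul, hB.symm]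
    rw [h6, hpv] at h3
    refine mul_left_cancel₀ hr2' ?_
    linear_combination h3 + A.vertObstruction t * B v v * hr2

/-- Over a space of constant curvature `c` the Nijenhuis tensor vanishes on vertical vectors as soon
as the obstructions vanish. -/
lemma verticalNijenhuisVanishes_of_constant (hB : IsInnerForm B) (hR : IsCurvatureLike B R) {c : ℝ}
    (hc : ∀ u v, LinearIndependent ℝ ![u, v] →
      B (R u v v) u = c * (B u u * B v v - B u v ^ 2))
    (hA : ∀ t, 0 ≤ t → A.ObstructionsVanish c t) (p : E →L[ℝ] ℝ) :
    VerticalNijenhuisVanishes A B R p := by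
  intro θ η
  obtain ⟨t, ht⟩ : ∃ t, t = 1 / 2 * p (B.inverse p) := ⟨_, rfl⟩
  have ht0 : 0 ≤ t := by
    have := hB.nonneg (B.inverse p)
    rw [hB.apply_inverse] at this
    rw [ht]
    positivity
  obtain ⟨h1, h2⟩ := hA t ht0
  have hps : p (B.inverse p) = 2 * t := by linarith
  have hpB : ∀ x, p x = B x (B.inverse p) := fun x => by rw [hB.symm, hB.apply_inverse]
  refine ⟨by rw [← ht, h1, zero_smul], fun w => ?_⟩
  rw [hpB (R _ _ w), hR.eq_of_constant hB hc, ← hpB, ← hpB]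
  simp only [naturalHorPart, ← ht]
  simp only [map_zero, smul_zero, mul_zero, zero_smul, add_zero, zero_sub, map_sub, map_neg,
    map_smul, sub_apply, neg_apply, smul_apply, smul_eq_mul, hB.apply_inverse, hps]
  linear_combination (p (B.inverse θ) * η w - p (B.inverse η) * θ w) * h2

end Algebra

lemma IsLocalMetric.isCurvatureLike [FiniteDimensional ℝ E] {h : E → E →L[ℝ] E →L[ℝ] ℝ}
    {U : Set E} {y : E} (hU : IsLocalMetric h U) (hy : y ∈ U) :
    IsCurvatureLike (h y) (localCurvature h y) where
  add u u' v w := by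
    simp only [hU.localCurvature_eq hy, map_add, add_apply]
    abel
  smul r u v w := by
    simp only [hU.localCurvature_eq hy, map_smul, smul_apply, smul_sub, smul_add]
  antisymm := hU.localCurvature_antisymm hy
  skew := hU.localCurvature_skew hy
  bianchi := hU.localCurvature_bianchi hy

variable {M : Type*} [TopologicalSpace M] [ChartedSpace E M] [IsManifold 𝓘(ℝ, E) ∞ M]
  {g : SmoothMetric E M} {A : NaturalTensorCoeffs}
  {C : NaturalMetricCoeffs}

/-- The curvature tensor at `x`, on the model space. -/
def modelCurvature (g : SmoothMetric E M) (x : M) : E → E → E → E :=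
  localCurvature (metricInChart g x) (extChartAt 𝓘(ℝ, E) x x)

lemma sectionalCurvature_eq (g : SmoothMetric E M) (x : M) (u v : E) :
    sectionalCurvature g x u v = metricForm g x (modelCurvature g x u v v) u
      / (metricForm g x u u * metricForm g x v v - metricForm g x u v ^ 2) := rfl

lemma hasConstantSectionalCurvature_iff (g : SmoothMetric E M) (c : ℝ) :
    HasConstantSectionalCurvature g c ↔ ∀ (x : M) (u v : E), LinearIndependent ℝ ![u, v] →
      metricForm g x (modelCurvature g x u v v) u
        = c * (metricForm g x u u * metricForm g x v v - metricForm g x u v ^ 2) :=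
  forall_congr' fun x => forall₂_congr fun u v => imp_congr_right fun hi =>
    (Iff.of_eq (congrArg (· = c) (sectionalCurvature_eq g x u v))).trans
      (div_eq_iff ((isInnerForm_metricForm g x).gram_pos hi).ne')

/-- In the chart around `q`, at `q`, the metric is that of the tangent space. -/
lemma metricInChart_extChartAt_cotangentBundle_self (g : SmoothMetric E M)
    (q : CotangentBundle E M) :
    metricInChart g q.proj (extChartAt (cotangentModel E) q q).1 = metricForm g q.proj ∧
      (extChartAt (cotangentModel E) q q).2 = covector q := by
  rw [extChartAt_cotangentBundle_self]
  exact ⟨metricInChart_self g q.proj, rfl⟩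

variable [FiniteDimensional ℝ E]

lemma isCurvatureLike_modelCurvature (g : SmoothMetric E M) (x : M) :
    IsCurvatureLike (metricForm g x) (modelCurvature g x) := by
  have h := (isLocalMetric_metricInChart g x).isCurvatureLike (mem_extChartAt_target x)
  rwa [metricInChart_self] at h

/-- Vertical vectors and their images under `J` span, as `a₂` and `a₂ + 2t b₂` do not vanish. -/
lemma IsLocalMetric.exists_vertical_add_localJ {h : E → E →L[ℝ] E →L[ℝ] ℝ} {U : Set E}
    {z : E × (E →L[ℝ] ℝ)} (hU : IsLocalMetric h U) (hz : z.1 ∈ U) (hsign : A.IsPositive)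
    (ξ : E × (E →L[ℝ] ℝ)) : ∃ a ∈ Set.range (fun θ : E →L[ℝ] ℝ => ((0, θ) : E × (E →L[ℝ] ℝ))),
      ∃ b ∈ Set.range (fun θ : E →L[ℝ] ℝ => ((0, θ) : E × (E →L[ℝ] ℝ))),
        ξ = a + localJ A h z b := by
  obtain ⟨-, h2, -, h4⟩ := hsign _ (hU.localEnergy_nonneg hz)
  have hB := hU.inner _ hz
  obtain ⟨t, ht⟩ : ∃ t, t = localEnergy h z := ⟨_, rfl⟩
  rw [← ht] at h2 h4
  have ht' : 1 / 2 * z.2 ((h z.1).inverse z.2) = t := ht.symm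
  have hps : z.2 ((h z.1).inverse z.2) = 2 * t := by linarith
  -- `θ` solves `-a₂ θ♯ - b₂ g⁻¹(p, θ) p♯ = u` for the base component `u` of `ξ`
  let m : ℝ := A.b₂ t * z.2 ξ.1 / (A.a₂ t * (A.a₂ t + 2 * t * A.b₂ t))
  let θ : E →L[ℝ] ℝ := (-(A.a₂ t)⁻¹) • h z.1 ξ.1 + m • z.2
  have hθ : naturalHorPart A (h z.1) z.2 0 θ = ξ.1 := by
    simp only [naturalHorPart, ht', θ]
    simp only [map_zero, mul_zero, zero_smul, smul_zero, map_add, map_smul,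
      hB.inverse_apply, hps, smul_eq_mul, zero_sub, add_zero]
    have h1 : A.a₂ t * (A.a₂ t)⁻¹ = 1 := mul_inv_cancel₀ h2.ne'
    have hm' : m * (A.a₂ t * (A.a₂ t + 2 * t * A.b₂ t)) = A.b₂ t * z.2 ξ.1 :=
      div_mul_cancel₀ _ (mul_pos h2 h4).ne'
    have hm : A.a₂ t * m + A.b₂ t * (-(A.a₂ t)⁻¹ * z.2 ξ.1 + m * (2 * t)) = 0 := by
      refine mul_left_cancel₀ h2.ne' ?_
      linear_combination hm' - A.b₂ t * z.2 ξ.1 * h1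
    generalize (h z.1).inverse z.2 = s
    have : -(A.a₂ t • (-(A.a₂ t)⁻¹ • ξ.1 + m • s))
        - (A.b₂ t * (-(A.a₂ t)⁻¹ * z.2 ξ.1 + m * (2 * t))) • s
        = (A.a₂ t * (A.a₂ t)⁻¹) • ξ.1
          - (A.a₂ t * m + A.b₂ t * (-(A.a₂ t)⁻¹ * z.2 ξ.1 + m * (2 * t))) • s := by module
    rw [this, h1, hm, one_smul, zero_smul, sub_zero]
  refine ⟨(0, ξ.2 - (localJ A h z (0, θ)).2), ⟨_, rfl⟩, (0, θ), ⟨θ, rfl⟩, Prod.ext ?_ ?_⟩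
  · rw [Prod.fst_add, localJ_apply, localVert_vertical]
    simp only [localLift]
    rw [hθ, zero_add]
  · rw [Prod.snd_add, sub_add_cancel]

/-- The structure is integrable exactly when its Nijenhuis tensor vanishes on pairs of vertical
vectors, at the centre of each chart. -/
lemma isIntegrableStructure_iff_vertical (hsign : A.IsPositive) (hR : HermitianRelations A C)
    (hsq : ∀ (q : CotangentBundle E M) (ξ : CotangentTangent q),
      naturalJ g A q (naturalJ g A q ξ) = -ξ) :
    IsIntegrableStructure (cotangentModel E) (naturalJ g A) ↔ ∀ (x : M) (p : E →L[ℝ] ℝ),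
      VerticalNijenhuisVanishes A (metricForm g x) (modelCurvature g x) p := by
  have hU := fun q : CotangentBundle E M => isLocalMetric_metricInChart g q.proj
  have hz := fun q : CotangentBundle E M => extChartAt_cotangentBundle_self_mem q
  have hd : ∀ q : CotangentBundle E M, DifferentiableAt ℝ
      (localJ A (metricInChart g q.proj)) (extChartAt (cotangentModel E) q q) := fun q =>
    (hU q).differentiableAt_localJ (hz q) A
  have hs : ∀ (q : CotangentBundle E M) (v : E × (E →L[ℝ] ℝ)),
      localJ A (metricInChart g q.proj) (extChartAt (cotangentModel E) q q)
        (localJ A (metricInChart g q.proj) (extChartAt (cotangentModel E) q q) v) = -v := fun q v =>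
    localJ_sq g q hsq (mem_extChartAt_target q) v
  have h1 : IsIntegrableStructure (cotangentModel E) (naturalJ g A) ↔
      ∀ (q : CotangentBundle E M) (v w : E × (E →L[ℝ] ℝ)),
        nijenhuisTensor (localJ A (metricInChart g q.proj)) (extChartAt (cotangentModel E) q q) v w
          = 0 :=
    isIntegrableStructure_iff (cotangentModel E) (N := CotangentBundle E M) (J := naturalJ g A)
      (J' := fun q => localJ A (metricInChart g q.proj)) hd
      (fun q z hz v => naturalJ_chartDeriv g q A hz v) hs
  have h2 : ∀ q : CotangentBundle E M, (∀ v w,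
      nijenhuisTensor (localJ A (metricInChart g q.proj)) (extChartAt (cotangentModel E) q q) v w
        = 0) ↔ VerticalNijenhuisVanishes A (metricForm g q.proj) (modelCurvature g q.proj)
          (covector q) := by
    intro q
    have key := (hU q).nijenhuisTensor_localJ_vertical (hz q) A (hs q)
      (hR.a₄_eq _ ((hU q).localEnergy_nonneg (hz q)))
    obtain ⟨e1, e2⟩ := metricInChart_extChartAt_cotangentBundle_self g q
    have e3 : localEnergy (metricInChart g q.proj) (extChartAt (cotangentModel E) q q)
        = 1 / 2 * covector q ((metricForm g q.proj).inverse (covector q)) := by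
      rw [localEnergy, e1, e2]
    have e4 : localCurvature (metricInChart g q.proj) (extChartAt (cotangentModel E) q q).1
        = modelCurvature g q.proj := by
      rw [extChartAt_cotangentBundle_self]
      rfl
    rw [e1, e2, e3, e4] at key
    constructor
    · intro h0 θ η
      obtain ⟨k1, k2⟩ := key θ η
      rw [h0] at k1 k2
      refine ⟨k1.symm, fun w => ?_⟩
      rw [← k2 w]
      simp [localVert]
    · intro h0
      refine nijenhuisTensor_eq_zero_of_span (hd q) ?_
        ((hU q).exists_vertical_add_localJ (hz q) hsign) ?_
      · filter_upwards [(isOpen_extChartAt_target q).mem_nhds (mem_extChartAt_target q)] with w hw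
        exact localJ_sq g q hsq hw
      · rintro _ ⟨θ, rfl⟩ _ ⟨η, rfl⟩
        obtain ⟨k1, k2⟩ := key θ η
        obtain ⟨k3, k4⟩ := h0 θ η
        rw [k3] at k1
        have k5 : localVert (metricInChart g q.proj) (extChartAt (cotangentModel E) q q)
            (nijenhuisTensor (localJ A (metricInChart g q.proj))
              (extChartAt (cotangentModel E) q q) (0, θ) (0, η)) = 0 := by
          ext w
          rw [k2, k4, zero_apply]
        rw [← localLift_localVert (metricInChart g q.proj) (extChartAt (cotangentModel E) q q)
          (nijenhuisTensor _ _ _ _), k5, k1]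
        simp [localLift]
  rw [h1, forall_congr' h2]
  exact ⟨fun h x p => h ⟨x, p⟩, fun h q => h q.proj (covector q)⟩

/-- Integrability means constant sectional curvature together with the equations for `b₂`, `b₃`. -/
lemma isIntegrableStructure_iff_obstructionsVanish [Nonempty M] (hdim : 2 ≤ Module.finrank ℝ E)
    (hsign : A.IsPositive) (hR : HermitianRelations A C)
    (hsq : ∀ (q : CotangentBundle E M) (ξ : CotangentTangent q),
      naturalJ g A q (naturalJ g A q ξ) = -ξ) :
    IsIntegrableStructure (cotangentModel E) (naturalJ g A) ↔ ∃ c : ℝ,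
      HasConstantSectionalCurvature g c ∧ ∀ t, 0 ≤ t → A.ObstructionsVanish c t := by
  rw [isIntegrableStructure_iff_vertical hsign hR hsq]
  simp only [hasConstantSectionalCurvature_iff]
  constructor
  · intro h
    have key := fun (x : M) {u v : E} (hi : LinearIndependent ℝ ![u, v]) {t : ℝ} (ht : 0 < t) =>
      sectional_of_verticalNijenhuisVanishes (isInnerForm_metricForm g x)
        (isCurvatureLike_modelCurvature g x) (h x) hi ht
    have hpos : ∀ t, 0 ≤ t → 0 < A.a₂ t * (A.a₂ t + 2 * t * A.b₂ t) := fun t ht =>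
      mul_pos (hsign t ht).2.1 (hsign t ht).2.2.2
    -- the curvature read off at energy density `1`; any other positive value gives the same
    obtain ⟨c, hc⟩ : ∃ c, c = -A.vertObstruction 1 / (A.a₂ 1 * (A.a₂ 1 + 2 * 1 * A.b₂ 1)) :=
      ⟨_, rfl⟩
    have hsec : ∀ (x : M) (u v : E), LinearIndependent ℝ ![u, v] →
        metricForm g x (modelCurvature g x u v v) u
          = c * (metricForm g x u u * metricForm g x v v - metricForm g x u v ^ 2) := by
      intro x u v hi
      rw [hc, div_mul_eq_mul_div, eq_div_iff (hpos 1 zero_le_one).ne', ← (key x hi one_pos).2]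
      ring
    -- comparison with the curvature read off at energy density `t`
    have hA : ∀ t, 0 < t → A.ObstructionsVanish c t := by
      intro t ht
      let x : M := Classical.arbitrary M
      have : Nontrivial E := Module.nontrivial_of_finrank_pos (R := ℝ) (by omega)
      obtain ⟨u, hu⟩ := exists_ne (0 : E)
      obtain ⟨v, hi⟩ := exists_linearIndependent_pair_of_one_lt_finrank (R := ℝ) (by omega) hu
      obtain ⟨k1, k2⟩ := key x hi ht
      rw [hsec x u v hi] at k2
      refine ⟨k1, mul_right_cancel₀ ((isInnerForm_metricForm g x).gram_pos hi).ne' ?_⟩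
      linear_combination k2
    refine ⟨c, hsec, fun t ht => ⟨?_, ?_⟩⟩
    · exact eq_on_nonneg_of_pos A.continuousOn_horObstruction continuousOn_const
        (fun t ht => (hA t ht).1) t ht
    · refine eq_on_nonneg_of_pos (A.continuousOn_vertObstruction.add ?_) continuousOn_const
        (fun t ht => (hA t ht).2) t ht
      have h1 := A.smooth_a₂.continuousOn
      have h2 := A.smooth_b₂.continuousOn
      fun_prop
  · rintro ⟨c, hc, hA⟩ x p
    exact verticalNijenhuisVanishes_of_constant (isInnerForm_metricForm g x)
      (isCurvatureLike_modelCurvature g x) (hc x) hA p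

end IntegrabilityGeometry

theorem mainTheorem1
    {E : Type*} [NormedAddCommGroup E] [NormedSpace ℝ E] [FiniteDimensional ℝ E]
    (hdim : 2 ≤ Module.finrank ℝ E)
    {M : Type*} [TopologicalSpace M] [ChartedSpace E M] [IsManifold 𝓘(ℝ, E) ∞ M]
    [T2Space M] [SecondCountableTopology M] [Nonempty M]
    (g : SmoothMetric E M)
    (A : NaturalTensorCoeffs) (C : NaturalMetricCoeffs)
    (hsign : A.IsPositive)
    (hGJ : IsAlmostHermitian (cotangentModel E) (naturalMetric g C) (naturalJ g A)) :
    (∃ lam mu : ℝ → ℝ, AreProportionalityFactors A C lam mu) ∧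
    (∀ lam mu : ℝ → ℝ, AreProportionalityFactors A C lam mu →
      (IsKahlerStructure (cotangentModel E) (naturalMetric g C) (naturalJ g A) ↔
        IsIntegrableStructure (cotangentModel E) (naturalJ g A) ∧
          ∀ t : ℝ, 0 ≤ t → mu t = derivIci lam t)) ∧
    (2 < Module.finrank ℝ E → ConnectedSpace M →
      (IsIntegrableStructure (cotangentModel E) (naturalJ g A) ↔
        ∃ c : ℝ, HasConstantSectionalCurvature g c ∧ IntegrabilityFormulas A c)) := by
  have hR := hermitianRelations hdim hsign hGJ
  refine ⟨hR.exists_factors hsign, fun lam mu hF => ?_, fun _ _ => ?_⟩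
  · have hclosed := isClosedTwoForm_fundamentalForm_iff (g := g) hdim hR hF
    exact ⟨fun h => ⟨h.integrable, hclosed.1 h.closed⟩, fun h => ⟨hGJ, h.1, hclosed.2 h.2⟩⟩
  · rw [isIntegrableStructure_iff_obstructionsVanish hdim hsign hR hGJ.sq_eq_neg]
    simp only [NaturalTensorCoeffs.forall_obstructionsVanish_iff hR hsign]
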